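/- **Setting.** Let $X$ be a compact metric space, $T\colon X\to X$ a homeomorphism and $V\to X$ a real vector bundle of finite constant dimension $d$ with a continuous Euclidean metric $\|\cdot\|$. A *linear cocycle over $T$* is a continuous map $\mathcal A\colon V\to V$ that sends each fiber $V_x$ isomorphically and linearly onto $V_{Tx}$; it induces the projective cocycle $\mathbb P\mathcal A\colon \mathbb PV\to\mathbb PV$. A *dominated splitting of index $i$* for $\mathcal A$ is a splitting $V=E_1\oplus E_2$ into $\mathcal A$-invariant continuous subbundles with $\dim E_1=i$ such that, for some $N\in\mathbb N$, one has $\|\mathcal A^Nu\|<\frac12\|\mathcal A^Nv\|$ for all $x\in X$ and all unit vectors $u\in E_{1,x}$, $v\in E_{2,x}$. A $T$-periodic point $x$ is *$i$-elliptic* for $\mathcal A$ ($0<i<d$) if the eigenvalues $z_1,\dots,z_d$ of the first return map on $V_x$, counted with multiplicity, can be ordered so that the Lyapunov exponents $\lambda_j=\frac1p\log|z_j|$ ($p$ the period of $x$) satisfy $\lambda_1\le\dots\le\lambda_d$, with $\lambda_{i-1}<\lambda_i$ if $1<i$ and $\lambda_{i+1}<\lambda_{i+2}$ if $i<d-1$,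 and so that $z_i$ and $z_{i+1}$ are non-real and complex conjugate. A point is elliptic if it is $i$-elliptic for some $i$. *The $C^r$-topology.* For $r=0$, the cocycles over $T$ carry the topology of uniform convergence, and no smooth structure is needed. For $r\in\{0,1,2,\dots\}\cup\{\infty\}$ in general, assume that $X$ is a subset of a smooth manifold $M$ and that $V$ is the restriction to $X$ of a smooth vector bundle $\widetilde V$ over $M$ (replacing $M$ by an open neighborhood of $X$ if necessary). The $C^r$-neighborhoods of the identity among cocycles over $\operatorname{Id}_X$ are those induced, by restriction to $X$, by the $C^r$ compact-open topology on $C^r$ sections of $\operatorname{End}(\widetilde V)$. The $C^r$-neighborhoods of a cocycle $\mathcal A$ over $T$ consist of the cocycles $\mathcal A\circ\mathcal R$ with $\mathcal R$ over $\operatorname{Id}_X$ and $C^r$-close to the identity; alternatively one may use the cocycles $\mathcal R\circ\mathcal A$ (the two notions agree when $T$ and $\mathcal A$ are smooth enough), and the result holds for each of the two conventions. The $C^r$-topology on projective cocycles is the one induced by projectivization. **Proposition.** For every linear cocycle $\mathcal A$ over $T$ and every $r\ge0$ one has $(a)\Rightarrow(b)\Rightarrow(c)$, where * (a) $\mathcal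 A$ has dominated splittings of all indices $0<i<d$; * (b) $\mathbb P\mathcal A$ is structurally $C^r$-stable: for every $\epsilon>0$ there is a $C^r$-neighborhood $U_\epsilon$ of $\mathbb P\mathcal A$ among projective cocycles over $T$ such that for each $\mathbb P\mathcal B\in U_\epsilon$ there is a homeomorphism $h$ of $\mathbb PV$ that fibers over $\operatorname{Id}_X$, is $\epsilon$-close to $\operatorname{Id}_{\mathbb PV}$ (the sine of the angle between a line and its image is less than $\epsilon$), and satisfies $h\circ\mathbb P\mathcal A=\mathbb P\mathcal B\circ h$; * (c) $\mathcal A$ has $C^r$-robustly no elliptic point: there is a $C^r$-neighborhood of $\mathcal A$ among linear cocycles over $T$ no element of which has an elliptic periodic point. -/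

import Mathlib

open Bundle Filter Topology
open scoped Manifold ContDiff LinearAlgebra.Projectivization

noncomputable section

namespace CocycleStability

section Cocycles

variable {X : Type*} [MetricSpace X]
  (F : Type*) [NormedAddCommGroup F] [NormedSpace ℝ F]
  (V : X → Type*) [TopologicalSpace (TotalSpace F V)]
  [∀ x, NormedAddCommGroup (V x)] [∀ x, InnerProductSpace ℝ (V x)]

/-- A linear cocycle on the vector bundle `V`, fibering over the homeomorphism `T` of the base:
a continuous map `V → V` that sends each fiber `V x` isomorphically onto the fiber `V (T x)`. -/
structure Cocycle (T : X ≃ₜ X) where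
  /-- The isomorphism from the fiber above `x` to the fiber above `T x`. -/
  fib : ∀ x, V x ≃ₗ[ℝ] V (T x)
  /-- The cocycle is continuous as a map between total spaces. -/
  continuous_fib : Continuous fun p : TotalSpace F V =>
    (⟨T p.proj, fib p.proj p.snd⟩ : TotalSpace F V)

/-- A family of subspaces of the fibers is a (continuous) vector subbundle of constant dimension
`k` if around every point of the base it is spanned by a continuous frame of `k` sections. -/
def IsSubbundle (W : ∀ x, Submodule ℝ (V x)) (k : ℕ) : Prop :=
  ∀ x₀ : X, ∃ U ∈ 𝓝 x₀, ∃ s : Fin k → ∀ x, V x,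
    (∀ j, ContinuousOn (fun x => (⟨x, s j x⟩ : TotalSpace F V)) U) ∧
    ∀ x ∈ U, LinearIndependent ℝ (fun j => s j x) ∧
      Submodule.span ℝ (Set.range fun j => s j x) = W x

/-- The projective bundle of `V`: its points are the lines of the fibers of `V`. The model fiber
`F` is recorded since it determines the topology. -/
structure ProjBundle {X : Type*} (F : Type*) (V : X → Type*)
    [∀ x, NormedAddCommGroup (V x)] [∀ x, InnerProductSpace ℝ (V x)] where
  /-- The base point. -/
  base : X
  /-- A line in the fiber above the base point. -/
  line : ℙ ℝ (V base)

/-- The quotient topology from the complement of the zero section in the total space of `V`. -/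
instance : TopologicalSpace (ProjBundle F V) :=
  TopologicalSpace.coinduced
    (fun p : {p : TotalSpace F V // p.snd ≠ 0} =>
      (⟨p.1.proj, Projectivization.mk ℝ p.1.snd p.2⟩ : ProjBundle F V))
    inferInstance

variable {F V} {T : X ≃ₜ X}

/-- The cocycle as a map of the total space to itself. -/
def Cocycle.map (A : Cocycle F V T) : TotalSpace F V → TotalSpace F V :=
  fun p => ⟨T p.proj, A.fib p.proj p.snd⟩

/-- The projective cocycle induced by a linear cocycle. -/
def Cocycle.proj (A : Cocycle F V T) : ProjBundle F V → ProjBundle F V :=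
  fun p => ⟨T p.base, Projectivization.map (A.fib p.base).toLinearMap
    (A.fib p.base).injective p.line⟩

/-- The cocycle `A` admits a dominated splitting `V = E₁ ⊕ E₂` of index `i = dim E₁`:
the subbundles `E₁`, `E₂` are invariant, and for some `N` the `N`-th iterate of `A` expands the
unit vectors of `E₁` less than half as much as the unit vectors of `E₂` above the same point. -/
def Cocycle.HasDominatedSplitting (A : Cocycle F V T) (i : ℕ) : Prop :=
  ∃ E₁ E₂ : ∀ x, Submodule ℝ (V x),
    IsSubbundle F V E₁ i ∧ IsSubbundle F V E₂ (Module.finrank ℝ F - i) ∧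
    (∀ x, IsCompl (E₁ x) (E₂ x)) ∧
    (∀ x, (E₁ x).map (A.fib x).toLinearMap = E₁ (T x)) ∧
    (∀ x, (E₂ x).map (A.fib x).toLinearMap = E₂ (T x)) ∧
    ∃ N : ℕ, ∀ x, ∀ u ∈ E₁ x, ∀ v ∈ E₂ x, ‖u‖ = 1 → ‖v‖ = 1 →
      ‖(A.map^[N] ⟨x, u⟩).snd‖ < 1 / 2 * ‖(A.map^[N] ⟨x, v⟩).snd‖

/-- The cocycle `A` has dominated splittings of all indices `0 < i < d`. -/
def Cocycle.HasAllDominatedSplittings (A : Cocycle F V T) : Prop :=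
  ∀ i, 0 < i → i < Module.finrank ℝ F → A.HasDominatedSplitting i

/-- `PA` and `PB` are conjugate by a homeomorphism `h` of the projective bundle that fibers over
the identity of the base and is `ε`-close to the identity: the sine of the angle between
a line and its image is always less than `ε`. -/
def Cocycle.ProjConj (ε : ℝ) (A B : Cocycle F V T) : Prop :=
  ∃ h : ProjBundle F V ≃ₜ ProjBundle F V,
    (∀ p, (h p).base = p.base) ∧
    (∀ (x : X) (u v : V x) (hu : u ≠ 0) (hv : v ≠ 0),
      h ⟨x, Projectivization.mk ℝ u hu⟩ = ⟨x, Projectivization.mk ℝ v hv⟩ →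
        Real.sin (InnerProductGeometry.angle u v) < ε) ∧
    ∀ p, h (A.proj p) = B.proj (h p)

/-- Structural stability of the projective cocycle of `A`, where `nhdsA` is the filter of
neighborhoods of `A` among linear cocycles over the same base dynamics (the neighborhoods of `PA`
among projective cocycles are the images of those of `A`). -/
def Cocycle.StructurallyStable (A : Cocycle F V T) (nhdsA : Filter (Cocycle F V T)) : Prop :=
  ∀ ε > 0, ∃ U ∈ nhdsA, ∀ B ∈ U, Cocycle.ProjConj ε A B

/-- The fibers of a vector bundle with finite-dimensional model are finite-dimensional. -/
theorem finite_fiber (F : Type*) [NormedAddCommGroup F] [NormedSpace ℝ F] [FiniteDimensional ℝ F]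
    (V : X → Type*) [TopologicalSpace (TotalSpace F V)]
    [∀ x, NormedAddCommGroup (V x)] [∀ x, InnerProductSpace ℝ (V x)]
    [FiberBundle F V] [VectorBundle ℝ F V] (x : X) : Module.Finite ℝ (V x) :=
  Module.Finite.equiv (((trivializationAt F V x).continuousLinearEquivAt ℝ x
    (mem_baseSet_trivializationAt F V x)).symm.toLinearEquiv)

/-- The `T`-periodic point `x` is `i`-elliptic for the cocycle `A`. Here `p` is the period of `x`,
`L` is the first return map on the fiber above `x`, `z 1, …, z d` are the eigenvalues of `L`
counted with multiplicity, and `lam 1 ≤ … ≤ lam d` are the corresponding Lyapunov exponents. -/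
def Cocycle.IsElliptic [FiniteDimensional ℝ F] [FiberBundle F V] [VectorBundle ℝ F V]
    (A : Cocycle F V T) (i : ℕ) (x : X) : Prop :=
  haveI := finite_fiber F V x
  0 < i ∧ i < Module.finrank ℝ F ∧
  x ∈ Function.periodicPts T ∧
  ∃ L : V x →ₗ[ℝ] V x,
    (∀ u, A.map^[Function.minimalPeriod T x] ⟨x, u⟩ = ⟨x, L u⟩) ∧
    ∃ (z : ℕ → ℂ) (lam : ℕ → ℝ),
      (Finset.Icc 1 (Module.finrank ℝ F)).val.map z
        = (L.charpoly.map (algebraMap ℝ ℂ)).roots ∧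
      (∀ j, lam j = Real.log ‖z j‖ / Function.minimalPeriod T x) ∧
      (∀ j, 1 ≤ j → j < Module.finrank ℝ F → lam j ≤ lam (j + 1)) ∧
      (1 < i → lam (i - 1) < lam i) ∧
      (i + 1 < Module.finrank ℝ F → lam (i + 1) < lam (i + 2)) ∧
      (z i).im ≠ 0 ∧ z (i + 1) = starRingEnd ℂ (z i)

/-- The cocycles in some neighborhood of `A` have no elliptic periodic point. -/
def Cocycle.RobustlyNoElliptic [FiniteDimensional ℝ F] [FiberBundle F V] [VectorBundle ℝ F V]
    (nhdsA : Filter (Cocycle F V T)) : Prop :=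
  ∃ U ∈ nhdsA, ∀ B ∈ U, ∀ (i : ℕ) (x : X), ¬ B.IsElliptic i x

/-- The implications between domination of all indices, structural stability of the projective
cocycle, and robust absence of elliptic points, for a given notion of neighborhood of `A`. -/
def Cocycle.Implications [FiniteDimensional ℝ F] [FiberBundle F V] [VectorBundle ℝ F V]
    (A : Cocycle F V T) (nhdsA : Filter (Cocycle F V T)) : Prop :=
  (A.HasAllDominatedSplittings → A.StructurallyStable nhdsA) ∧
  (A.StructurallyStable nhdsA → Cocycle.RobustlyNoElliptic nhdsA)

/-- The neighborhoods of `A` for the topology of uniform convergence. -/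
def Cocycle.nhdsC0 (A : Cocycle F V T) : Filter (Cocycle F V T) :=
  ⨅ (δ : ℝ) (_ : 0 < δ),
    𝓟 {B | ∀ x (u : V x), ‖B.fib x u - A.fib x u‖ ≤ δ * ‖u‖}

end Cocycles

section Smooth

variable {X : Type*} [MetricSpace X]
  (F : Type*) [NormedAddCommGroup F] [NormedSpace ℝ F]
  (V : X → Type*) [TopologicalSpace (TotalSpace F V)]
  [∀ x, NormedAddCommGroup (V x)] [∀ x, InnerProductSpace ℝ (V x)]
  (E : Type*) [NormedAddCommGroup E] [NormedSpace ℝ E]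
  {M : Type*} [TopologicalSpace M] [ChartedSpace E M]
  (W : M → Type*) [TopologicalSpace (TotalSpace F W)]
  [∀ m, AddCommGroup (W m)] [∀ m, Module ℝ (W m)] [∀ m, TopologicalSpace (W m)]

/-- A realization of the bundle `V` over `X` as a restriction of the bundle `W` over `M`: `X` is
embedded in `M`, and `V` is identified with the restriction of `W` to `X`. -/
structure Realization where
  /-- The embedding of the base. -/
  ι : X → M
  isEmbedding : IsEmbedding ι
  /-- The identification of the fibers. -/
  Φ : ∀ x, V x ≃ₗ[ℝ] W (ι x)
  continuous_Φ : Continuous fun p : TotalSpace F V =>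
    (⟨ι p.proj, Φ p.proj p.snd⟩ : TotalSpace F W)

variable [FiberBundle F W] [VectorBundle ℝ F W]
  [∀ m, IsTopologicalAddGroup (W m)] [∀ m, ContinuousSMul ℝ (W m)]

/-- The neighborhoods of the identity section in the space of `C^r` sections of the bundle
`End W` over `M`, for the `C^r` compact-open topology: finite intersections of the sets of `C^r`
sections whose derivatives of order at most `k`, read in the chart and the trivialization around
`m₀`, are `δ`-close to those of the identity on the compact set `K`, where `k ≤ r` is finite. -/
def nhdsIdSection (r : ℕ∞) : Filter (∀ m, W m →L[ℝ] W m) :=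
  𝓟 {S | ContMDiff 𝓘(ℝ, E) (𝓘(ℝ, E).prod 𝓘(ℝ, F →L[ℝ] F)) r
      (fun m => (⟨m, S m⟩ : TotalSpace (F →L[ℝ] F) fun m => W m →L[ℝ] W m))} ⊓
  ⨅ (m₀ : M) (K : Set M) (k : ℕ) (δ : ℝ) (_ : IsCompact K)
    (_ : K ⊆ (chartAt E m₀).source ∩ (trivializationAt F W m₀).baseSet)
    (_ : (k : ℕ∞) ≤ r) (_ : 0 < δ),
    𝓟 {S | ∀ m ∈ K, ∀ j ≤ k,
      ‖iteratedFDeriv ℝ j (fun y : E =>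
        ContinuousLinearMap.inCoordinates F W F W
          m₀ ((chartAt E m₀).symm y) m₀ ((chartAt E m₀).symm y) (S ((chartAt E m₀).symm y))
        - ContinuousLinearMap.id ℝ F) (chartAt E m₀ m)‖ < δ}

variable {F V W} {T : X ≃ₜ X}

/-- The `C^r` neighborhoods of a cocycle `A`, obtained by composing `A` on the right with
the cocycles over the identity that are `C^r`-close to the identity, that is, with
the restrictions to `X` of `C^r` sections of `End W` that are `C^r`-close to the identity. -/
def Cocycle.nhdsCrRight (ρ : Realization F V W) (r : ℕ∞) (A : Cocycle F V T) :
    Filter (Cocycle F V T) :=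
  (nhdsIdSection F E W r).lift' fun N =>
    {B | ∃ S ∈ N, ∀ x u, B.fib x u = A.fib x ((ρ.Φ x).symm (S (ρ.ι x) (ρ.Φ x u)))}

/-- The `C^r` neighborhoods of a cocycle `A`, obtained by composing `A` on the left with
the cocycles over the identity that are `C^r`-close to the identity. -/
def Cocycle.nhdsCrLeft (ρ : Realization F V W) (r : ℕ∞) (A : Cocycle F V T) :
    Filter (Cocycle F V T) :=
  (nhdsIdSection F E W r).lift' fun N =>
    {B | ∃ S ∈ N, ∀ x u, B.fib x u =
      (ρ.Φ (T x)).symm (S (ρ.ι (T x)) (ρ.Φ (T x) (A.fib x u)))}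

end Smooth

end CocycleStability

end

/-!
# Projective structural stability of linear cocycles

*Dominated splittings give structural stability.* The dominated splittings of indices `0 < i < d`
are encoded by their projections onto the weaker bundle. Domination forces these bundles to be
nested (`DominatedProjection.apply_eq_self_of_lt`), so that the differences of consecutive
projections split `V` into invariant line bundles (`lineSplitting`). The number `N` of iterates in
the definition of domination is absorbed into positive weights, for which the growth rates along
the lines are separated by a gap after a single iterate (`LineSplitting.Adapted`).

Let `B` be a cocycle close to `A`. It is first conjugated, linearly, to a cocycle which preserves
the splitting of `A`. To this end `V` is embedded into a trivial bundle over the compact base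
(`exists_fiberEmbedding`), so that bundle maps become elements of a Banach algebra of continuous
families of endomorphisms. Writing the conjugacy as `id + Q` with `Q` off-diagonal, one has to solve
a small perturbation of the equation `L Q - Q = M`, where `L` is the conjugation by `A`. On each
off-diagonal entry either `L` or its inverse is a contraction for the weights, so `L - 1` is
invertible there, and the equation is solved by a fixed point argument (`exists_block_conjugacy`,
`LineSplitting.Adapted.exists_projConj_of_near`). The result is a rescaling of `A`: on the `i`-th
line bundle it is `A` multiplied by a function `exp γᵢ` close to `1`.

It remains to see that a rescaling is projectively conjugate to `A`. If all vectors of a dominating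
block are multiplied by `exp θ` with `θ ≥ 0`, the conjugacy is a homogeneous map which multiplies
the two components of a vector by factors depending on the base point and on their ratio. These factors are given by a sum
over the past and a sum over the future of the orbit, which converge geometrically, because along an
orbit the ratio of the components decays geometrically in one of the two directions
(`Cocycle.ProjConj.of_blocks`). An arbitrary small rescaling is a composition of such steps and of
inverses of such steps (`LineSplitting.Adapted.exists_projConj_scale`). Only uniform closeness has
been used; since the `C^r` neighborhoods are finer than the uniform ones
(`Cocycle.nhdsCrRight_le_nhdsC0`, `Cocycle.nhdsCrLeft_le_nhdsC0`), this settles all topologies.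

*Structural stability excludes elliptic points.* Suppose that a cocycle near `A` has a periodic
point whose return map has a non-real eigenvalue. A rotation in the corresponding plane by a small
angle makes a power of the eigenvalue real, and the return map then has infinitely many periodic
lines of some period (`frequently_infinite_fixedLines`). Another small perturbation makes all powers
of the return map cyclic, and then there are finitely many periodic lines of each period
(`frequently_finite_fixedLines`). A conjugacy which preserves the fibers preserves the number of
these lines, so the two perturbations cannot both be conjugate to `A`
(`Cocycle.StructurallyStable.robustlyNoElliptic`). That such perturbations of the return map are
realized by cocycles is the property `LocallyPerturbable` of the topology; it is proved with a
cutoff function in the uniform topology and with smooth bump functions in the `C^r` topologies.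
-/

set_option linter.unusedSectionVars false

noncomputable section

namespace CocycleStability

/-! ### Embedding a vector bundle over a compact base into a trivial bundle -/

section Embedding

variable {X : Type*} [MetricSpace X]
  {F : Type*} [NormedAddCommGroup F] [NormedSpace ℝ F]
  {V : X → Type*} [TopologicalSpace (TotalSpace F V)]
  [∀ x, NormedAddCommGroup (V x)] [∀ x, InnerProductSpace ℝ (V x)]
  [FiberBundle F V] [VectorBundle ℝ F V]

theorem continuousAt_trivialization (e : Trivialization F (π F V)) [e.IsLinear ℝ]
    {z₀ : TotalSpace F V} (h : z₀.proj ∈ e.baseSet) :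
    ContinuousAt (fun z : TotalSpace F V => e.continuousLinearMapAt ℝ z.proj z.snd) z₀ := by
  have h1 : ContinuousAt (fun z => (e z).2) z₀ :=
    (e.continuousAt (e.mem_source.2 h)).snd
  refine h1.congr ?_
  have : ∀ᶠ z : TotalSpace F V in 𝓝 z₀, z.proj ∈ e.baseSet :=
    (FiberBundle.continuous_proj F V).continuousAt (e.open_baseSet.mem_nhds h)
  filter_upwards [this] with z hz
  rw [Trivialization.continuousLinearMapAt_apply, Trivialization.coe_linearMapAt_of_mem _ hz]

theorem continuousAt_trivialization_symm (e : Trivialization F (π F V)) [e.IsLinear ℝ]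
    {z₀ : X × F} (h : z₀.1 ∈ e.baseSet) :
    ContinuousAt (fun z : X × F => (⟨z.1, e.symmL ℝ z.1 z.2⟩ : TotalSpace F V)) z₀ := by
  have := e.continuousOn_symm.continuousAt
    ((e.open_baseSet.prod isOpen_univ).mem_nhds (show z₀ ∈ e.baseSet ×ˢ Set.univ from ⟨h, trivial⟩))
  refine this.congr ?_
  have : ∀ᶠ z : X × F in 𝓝 z₀, z.1 ∈ e.baseSet :=
    continuousAt_fst (e.open_baseSet.mem_nhds h)
  filter_upwards [this] with z hz
  rw [Trivialization.symmL_apply _ hz]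

theorem continuousAt_mk_iff {Z : Type*} [TopologicalSpace Z] {b : Z → X} {s : ∀ z, V (b z)}
    {z₀ : Z} :
    ContinuousAt (fun z => (⟨b z, s z⟩ : TotalSpace F V)) z₀ ↔ ContinuousAt b z₀ ∧
      ContinuousAt (fun z =>
        (trivializationAt F V (b z₀)).continuousLinearMapAt ℝ (b z) (s z)) z₀ := by
  rw [FiberBundle.continuousAt_totalSpace]
  refine and_congr_right fun hb => ?_
  refine continuousAt_congr ?_
  have : ∀ᶠ z in 𝓝 z₀, b z ∈ (trivializationAt F V (b z₀)).baseSet :=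
    hb ((trivializationAt F V (b z₀)).open_baseSet.mem_nhds
      (FiberBundle.mem_baseSet_trivializationAt' _))
  filter_upwards [this] with z hz
  rw [Trivialization.continuousLinearMapAt_apply, Trivialization.coe_linearMapAt_of_mem _ hz]

theorem continuous_mk_smul {Z : Type*} [TopologicalSpace Z] {b : Z → X} {s : ∀ z, V (b z)}
    {c : Z → ℝ} (hs : Continuous fun z => (⟨b z, s z⟩ : TotalSpace F V)) (hc : Continuous c) :
    Continuous fun z => (⟨b z, c z • s z⟩ : TotalSpace F V) := by
  refine continuous_iff_continuousAt.2 fun z => ?_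
  have h := continuousAt_mk_iff.1 (continuous_iff_continuousAt.1 hs z)
  refine continuousAt_mk_iff.2 ⟨h.1, ?_⟩
  simp only [map_smul]
  exact hc.continuousAt.smul h.2

theorem continuous_mk_sum {Z ι : Type*} [TopologicalSpace Z] {b : Z → X} (hb : Continuous b)
    (t : Finset ι) {s : ι → ∀ z, V (b z)}
    (hs : ∀ i ∈ t, Continuous fun z => (⟨b z, s i z⟩ : TotalSpace F V)) :
    Continuous fun z => (⟨b z, ∑ i ∈ t, s i z⟩ : TotalSpace F V) := by
  refine continuous_iff_continuousAt.2 fun z => continuousAt_mk_iff.2 ⟨hb.continuousAt, ?_⟩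
  simp only [map_sum]
  exact tendsto_finsetSum _ fun i hi =>
    (continuousAt_mk_iff.1 (continuous_iff_continuousAt.1 (hs i hi) z)).2

variable (F V) in
/-- A fiberwise linear embedding of the bundle `V` into the trivial bundle `X × G`, given with
a continuous left inverse. -/
structure FiberEmbedding (G : Type*) [NormedAddCommGroup G] [NormedSpace ℝ G] where
  /-- The embedding of the fibers. -/
  j : ∀ x, V x →L[ℝ] G
  /-- The projection onto the fibers. -/
  p : ∀ x, G →L[ℝ] V x
  p_j : ∀ x v, p x (j x v) = v
  continuous_j : Continuous fun z : TotalSpace F V => j z.proj z.snd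
  continuous_p : Continuous fun z : X × G => (⟨z.1, p z.1 z.2⟩ : TotalSpace F V)

/-- Local trivializations are glued by means of a partition of unity. -/
theorem exists_fiberEmbedding [CompactSpace X] :
    ∃ t : Finset X, Nonempty (FiberEmbedding F V (t → F)) := by
  obtain ⟨t, ht⟩ := (isCompact_univ (X := X)).elim_nhds_subcover
    (fun x => (trivializationAt F V x).baseSet)
    fun x _ => (trivializationAt F V x).open_baseSet.mem_nhds
      (FiberBundle.mem_baseSet_trivializationAt' x)
  obtain ⟨ρ, hρ⟩ := PartitionOfUnity.exists_isSubordinate (ι := t) isClosed_univ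
    (fun k => (trivializationAt F V k.1).baseSet)
    (fun k => (trivializationAt F V k.1).open_baseSet) (by
      refine ht.2.trans ?_
      intro x hx
      simp only [Set.mem_iUnion] at hx ⊢
      obtain ⟨k, hk, hx⟩ := hx
      exact ⟨⟨k, hk⟩, hx⟩)
  let e : t → Trivialization F (π F V) := fun k => trivializationAt F V k.1
  let σ : X → ℝ := fun x => ∑ k, ρ k x ^ 2
  have hsum : ∀ x, ∑ k, ρ k x = 1 := fun x => by
    rw [← finsum_eq_sum_of_fintype]; exact ρ.sum_eq_one (Set.mem_univ x)
  have hσ : ∀ x, σ x ≠ 0 := fun x h => by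
    have h0 : ∀ k, ρ k x = 0 := fun k => by
      have := (Finset.sum_eq_zero_iff_of_nonneg (fun k _ => sq_nonneg (ρ k x))).1 h k
        (Finset.mem_univ k)
      exact pow_eq_zero_iff two_ne_zero |>.1 this
    have := hsum x
    simp [h0] at this
  have hσc : Continuous σ := continuous_finsetSum _ fun k _ => (ρ k).continuous.pow 2
  have hsupp : ∀ k x, ρ k x ≠ 0 → x ∈ (e k).baseSet := fun k x h =>
    hρ k (subset_tsupport _ h)
  have hout : ∀ k x, x ∉ (e k).baseSet → ∀ᶠ y in 𝓝 x, ρ k y = 0 := fun k x h => by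
    have : x ∉ tsupport (ρ k) := fun h' => h (hρ k h')
    have := notMem_tsupport_iff_eventuallyEq.1 this
    exact this
  refine ⟨t, ⟨{
    j := fun x => ContinuousLinearMap.pi fun k => ρ k x • (e k).continuousLinearMapAt ℝ x
    p := fun x => ∑ k, ((σ x)⁻¹ * ρ k x) • (e k).symmL ℝ x ∘L ContinuousLinearMap.proj k
    p_j := ?_
    continuous_j := ?_
    continuous_p := ?_ }⟩⟩
  · intro x v
    have h1 : ∀ k, (((σ x)⁻¹ * ρ k x) • (e k).symmL ℝ x ∘L
        (ContinuousLinearMap.proj k : (t → F) →L[ℝ] F))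
        ((ContinuousLinearMap.pi fun k => ρ k x • (e k).continuousLinearMapAt ℝ x) v)
        = ((σ x)⁻¹ * ρ k x ^ 2) • v := fun k => by
      simp only [smul_apply, ContinuousLinearMap.comp_apply,
        ContinuousLinearMap.proj_apply, ContinuousLinearMap.pi_apply, map_smul]
      by_cases hk : ρ k x = 0
      · simp [hk]
      · rw [(e k).symmL_continuousLinearMapAt (hsupp k x hk), smul_smul]
        ring_nf
    rw [sum_apply, Finset.sum_congr rfl fun k _ => h1 k, ← Finset.sum_smul,
      ← Finset.mul_sum]
    rw [inv_mul_cancel₀ (hσ x), one_smul]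
  · refine continuous_pi fun k => continuous_iff_continuousAt.2 fun z => ?_
    simp only [ContinuousLinearMap.pi_apply, smul_apply]
    have hp := (FiberBundle.continuous_proj F V).continuousAt (x := z)
    by_cases hz : z.proj ∈ (e k).baseSet
    · exact ((ρ k).continuous.continuousAt.comp hp).smul (continuousAt_trivialization (e k) hz)
    · refine (continuousAt_const (y := (0 : F))).congr ?_
      filter_upwards [hp (hout k _ hz)] with y hy
      have hy : ρ k y.proj = 0 := hy
      simp [hy]
  · have : ∀ z : X × (t → F), (∑ k, ((σ z.1)⁻¹ * ρ k z.1) • (e k).symmL ℝ z.1 ∘L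
        (ContinuousLinearMap.proj k : (t → F) →L[ℝ] F)) z.2 =
        ∑ k, ((σ z.1)⁻¹ * ρ k z.1) • (e k).symmL ℝ z.1 (z.2 k) := fun z => by
      simp
    simp only [this]
    refine continuous_mk_sum continuous_fst _ fun k _ => continuous_iff_continuousAt.2 fun z => ?_
    refine continuousAt_mk_iff.2 ⟨continuousAt_fst, ?_⟩
    simp only [map_smul]
    by_cases hz : z.1 ∈ (e k).baseSet
    · have h2 : ContinuousAt (fun z : X × (t → F) => (z.1, z.2 k)) z := by fun_prop
      have h3 := ContinuousAt.comp (f := fun z : X × (t → F) => (z.1, z.2 k)) (x := z)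
        (continuousAt_trivialization_symm (e k) (z₀ := (z.1, z.2 k)) hz) h2
      have h4 := (continuousAt_mk_iff.1 h3).2
      exact (((hσc.inv₀ hσ).mul (ρ k).continuous).continuousAt.comp continuousAt_fst).smul h4
    · refine (continuousAt_const (y := (0 : F))).congr ?_
      filter_upwards [continuousAt_fst (hout k _ hz)] with y hy
      have hy : ρ k y.1 = 0 := hy
      simp [hy]

namespace FiberEmbedding

variable {G : Type*} [NormedAddCommGroup G] [NormedSpace ℝ G] (J : FiberEmbedding F V G)

theorem j_injective (x : X) : Function.Injective (J.j x) := fun v w h => by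
  rw [← J.p_j x v, h, J.p_j]

/-- Continuity into the total space is read off in the trivial bundle. -/
theorem continuous_mk_iff {Z : Type*} [TopologicalSpace Z] {b : Z → X} {s : ∀ z, V (b z)} :
    Continuous (fun z => (⟨b z, s z⟩ : TotalSpace F V)) ↔
      Continuous b ∧ Continuous fun z => J.j (b z) (s z) := by
  constructor
  · intro h
    exact ⟨(FiberBundle.continuous_proj F V).comp h, J.continuous_j.comp h⟩
  · rintro ⟨h1, h2⟩
    have := J.continuous_p.comp (h1.prodMk h2)
    simpa [Function.comp_def, J.p_j] using this

variable [FiniteDimensional ℝ G]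

/-- A bundle map is continuous if and only if the family of endomorphisms of the trivial bundle
that it defines is. -/
theorem continuous_map_iff {σ : X → X} (hσ : Continuous σ) {Q : ∀ x, V x →L[ℝ] V (σ x)} :
    Continuous (fun z : TotalSpace F V => (⟨σ z.proj, Q z.proj z.snd⟩ : TotalSpace F V)) ↔
      Continuous fun x => J.j (σ x) ∘L Q x ∘L J.p x := by
  constructor
  · intro h
    refine continuous_clm_apply.2 fun g => ?_
    have h1 : Continuous fun x : X => (⟨x, J.p x g⟩ : TotalSpace F V) :=
      J.continuous_p.comp (continuous_id.prodMk continuous_const)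
    exact J.continuous_j.comp (h.comp h1)
  · intro h
    refine (J.continuous_mk_iff (b := fun z : TotalSpace F V => σ z.proj)
      (s := fun z => Q z.proj z.snd)).2 ⟨hσ.comp (FiberBundle.continuous_proj F V), ?_⟩
    have := (h.comp (FiberBundle.continuous_proj F V)).clm_apply J.continuous_j
    simpa [J.p_j] using this

end FiberEmbedding

end Embedding

/-! ### The projective bundle and homogeneous conjugacies -/

section Angle

variable {W : Type*} [NormedAddCommGroup W] [InnerProductSpace ℝ W]

theorem norm_sub_smul_sq (u v : W) (c : ℝ) :
    ‖u - c • v‖ ^ 2 = (Real.sin (InnerProductGeometry.angle u v) * ‖u‖) ^ 2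
      + (c * ‖v‖ - ‖u‖ * Real.cos (InnerProductGeometry.angle u v)) ^ 2 := by
  rw [norm_sub_sq_real, inner_smul_right, norm_smul, mul_pow, Real.norm_eq_abs, sq_abs]
  rw [← InnerProductGeometry.cos_angle_mul_norm_mul_norm u v, mul_pow, Real.sin_sq]
  ring

/-- The sine of the angle is the relative distance from a vector to a line. -/
theorem sin_angle_mul_norm_le (u v : W) (c : ℝ) :
    Real.sin (InnerProductGeometry.angle u v) * ‖u‖ ≤ ‖u - c • v‖ := by
  refine le_of_sq_le_sq ?_ (norm_nonneg _)
  rw [norm_sub_smul_sq]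
  nlinarith [sq_nonneg (c * ‖v‖ - ‖u‖ * Real.cos (InnerProductGeometry.angle u v))]

theorem exists_norm_sub_smul_eq (u : W) {v : W} (hv : v ≠ 0) :
    ∃ c : ℝ, ‖u - c • v‖ = Real.sin (InnerProductGeometry.angle u v) * ‖u‖ ∧
      |c| * ‖v‖ ≤ ‖u‖ := by
  have hv' : ‖v‖ ≠ 0 := norm_ne_zero_iff.2 hv
  refine ⟨‖u‖ * Real.cos (InnerProductGeometry.angle u v) / ‖v‖, ?_, ?_⟩
  · rw [← sq_eq_sq₀ (norm_nonneg _) (mul_nonneg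
      (InnerProductGeometry.sin_angle_nonneg u v) (norm_nonneg _)), norm_sub_smul_sq,
      div_mul_cancel₀ _ hv']
    ring
  · rw [abs_div, abs_norm, div_mul_cancel₀ _ hv', abs_mul, abs_norm]
    exact mul_le_of_le_one_right (norm_nonneg _) (Real.abs_cos_le_one _)

theorem sin_angle_triangle {u v w : W} (hu : u ≠ 0) (hv : v ≠ 0) (hw : w ≠ 0) :
    Real.sin (InnerProductGeometry.angle u w) ≤
      Real.sin (InnerProductGeometry.angle u v) + Real.sin (InnerProductGeometry.angle v w) := by
  obtain ⟨c, hc, hc'⟩ := exists_norm_sub_smul_eq u hv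
  obtain ⟨b, hb, -⟩ := exists_norm_sub_smul_eq v hw
  have hu' : 0 < ‖u‖ := norm_pos_iff.2 hu
  refine le_of_mul_le_mul_right ?_ hu'
  refine (sin_angle_mul_norm_le u w (c * b)).trans ?_
  have : u - (c * b) • w = (u - c • v) + c • (v - b • w) := by
    rw [smul_sub, smul_smul]; abel
  rw [this]
  refine (norm_add_le _ _).trans ?_
  rw [norm_smul, hc, hb, Real.norm_eq_abs, add_mul]
  have := InnerProductGeometry.sin_angle_nonneg v w
  nlinarith

end Angle

section Projective

variable {X : Type*} [MetricSpace X]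
  {F : Type*} [NormedAddCommGroup F] [NormedSpace ℝ F]
  {V : X → Type*} [TopologicalSpace (TotalSpace F V)]
  [∀ x, NormedAddCommGroup (V x)] [∀ x, InnerProductSpace ℝ (V x)]

namespace Cocycle

variable {T : X ≃ₜ X} {A B C : Cocycle F V T} {ε ε' : ℝ}

theorem ProjConj.mono (h : ProjConj ε A B) (hε : ε ≤ ε') : ProjConj ε' A B := by
  obtain ⟨h, h1, h2, h3⟩ := h
  exact ⟨h, h1, fun x u v hu hv e => (h2 x u v hu hv e).trans_le hε, h3⟩

theorem ProjConj.symm (h : ProjConj ε A B) : ProjConj ε B A := by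
  obtain ⟨h, h1, h2, h3⟩ := h
  refine ⟨h.symm, fun p => ?_, fun x u v hu hv e => ?_, fun p => ?_⟩
  · rw [← h1 (h.symm p), h.apply_symm_apply]
  · rw [InnerProductGeometry.angle_comm]
    refine h2 x v u hv hu ?_
    rw [← e, h.apply_symm_apply]
  · apply h.injective
    rw [h.apply_symm_apply, h3, h.apply_symm_apply]

theorem ProjConj.trans (h : ProjConj ε A B) (h' : ProjConj ε' B C) :
    ProjConj (ε + ε') A C := by
  obtain ⟨h, h1, h2, h3⟩ := h
  obtain ⟨k, k1, k2, k3⟩ := h'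
  refine ⟨h.trans k, fun p => ?_, fun x u w hu hw e => ?_, fun p => ?_⟩
  · rw [Homeomorph.trans_apply, k1, h1]
  · rw [Homeomorph.trans_apply] at e
    have hb := h1 ⟨x, Projectivization.mk ℝ u hu⟩
    generalize hq : h ⟨x, Projectivization.mk ℝ u hu⟩ = q at e hb
    obtain ⟨y, l⟩ := q
    obtain rfl : y = x := hb
    induction l with
    | h v hv =>
      exact (sin_angle_triangle hu hv hw).trans_lt (add_lt_add (h2 _ u v hu hv hq)
        (k2 _ v w hv hw e))
  · rw [Homeomorph.trans_apply, Homeomorph.trans_apply, h3, k3]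

end Cocycle

variable [FiberBundle F V] [VectorBundle ℝ F V] [IsContinuousRiemannianBundle F V]

theorem continuous_norm_mk {Z : Type*} [TopologicalSpace Z] {b : Z → X} {s : ∀ z, V (b z)}
    (h : Continuous fun z => (⟨b z, s z⟩ : TotalSpace F V)) : Continuous fun z => ‖s z‖ := by
  have h1 := (h.inner_bundle h).sqrt
  refine h1.congr fun z => ?_
  rw [real_inner_self_eq_norm_sq, Real.sqrt_sq (norm_nonneg _)]

namespace FiberEmbedding

variable {G : Type*} [NormedAddCommGroup G] [NormedSpace ℝ G] [FiniteDimensional ℝ G]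
  [CompactSpace X] (J : FiberEmbedding F V G)

theorem exists_norm_p_le : ∃ C > 0, ∀ x g, ‖J.p x g‖ ≤ C * ‖g‖ := by
  have hc : Continuous fun z : X × G => ‖J.p z.1 z.2‖ := continuous_norm_mk J.continuous_p
  have := FiniteDimensional.proper ℝ G
  obtain ⟨C, hC⟩ := ((isCompact_univ (X := X)).prod (isCompact_sphere (0 : G) 1)).bddAbove_image
    hc.continuousOn
  refine ⟨max C 1, by positivity, fun x g => ?_⟩
  by_cases hg : g = 0
  · simp [hg]
  have hg' : 0 < ‖g‖ := norm_pos_iff.2 hg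
  have := hC ⟨(x, ‖g‖⁻¹ • g), ⟨trivial, by simp [norm_smul, hg'.ne']⟩, rfl⟩
  simp only [map_smul, norm_smul, norm_inv, norm_norm] at this
  rw [inv_mul_le_iff₀ hg'] at this
  rw [mul_comm]
  exact this.trans (mul_le_mul_of_nonneg_left (le_max_left _ _) hg'.le)

/-- On the compact set of unit vectors in the images of the embeddings, the norm of `J.p` is bounded
below, because `J.p` is injective there. -/
theorem exists_norm_j_le : ∃ C > 0, ∀ x v, ‖J.j x v‖ ≤ C * ‖v‖ := by
  have hc : Continuous fun z : X × G => ‖J.p z.1 z.2‖ := continuous_norm_mk J.continuous_p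
  have := FiniteDimensional.proper ℝ G
  let K : Set (X × G) := (Set.univ ×ˢ Metric.sphere (0 : G) 1) ∩ {z | J.j z.1 (J.p z.1 z.2) = z.2}
  have hK : IsCompact K := ((isCompact_univ (X := X)).prod (isCompact_sphere (0 : G) 1)).inter_right
    (isClosed_eq (J.continuous_j.comp J.continuous_p) continuous_snd)
  have hpos : ∀ z ∈ K, 0 < ‖J.p z.1 z.2‖ := fun z hz => norm_pos_iff.2 fun h => by
    have h2 : J.j z.1 (J.p z.1 z.2) = z.2 := hz.2
    have h1 : ‖z.2‖ = 1 := by simpa using hz.1.2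
    rw [h, map_zero] at h2
    simp [← h2] at h1
  obtain ⟨m, hm, hm'⟩ : ∃ m > 0, ∀ z ∈ K, m ≤ ‖J.p z.1 z.2‖ := by
    rcases K.eq_empty_or_nonempty with h | h
    · exact ⟨1, one_pos, by simp [h]⟩
    · obtain ⟨z, hz, hmin⟩ := hK.exists_isMinOn h hc.continuousOn
      exact ⟨_, hpos z hz, fun y hy => hmin hy⟩
  refine ⟨m⁻¹, by positivity, fun x v => ?_⟩
  by_cases hv : J.j x v = 0
  · rw [hv, norm_zero]; positivity
  have hg' : 0 < ‖J.j x v‖ := norm_pos_iff.2 hv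
  have := hm' (x, ‖J.j x v‖⁻¹ • J.j x v) ⟨⟨trivial, by simp [norm_smul, hg'.ne']⟩, by
    simp [J.p_j]⟩
  simp only [map_smul, norm_smul, norm_inv, norm_norm, J.p_j] at this
  rw [le_inv_mul_iff₀ hg'] at this
  rw [le_inv_mul_iff₀ hm]
  linarith

end FiberEmbedding

/-- A continuous bundle map over a compact base is uniformly bounded. -/
theorem exists_norm_bundleMap_le [CompactSpace X] [FiniteDimensional ℝ F] {σ : X → X}
    (hσ : Continuous σ) {P : ∀ x, V x →L[ℝ] V (σ x)}
    (hP : Continuous fun z : TotalSpace F V => (⟨σ z.proj, P z.proj z.snd⟩ : TotalSpace F V)) :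
    ∃ C > 0, ∀ x v, ‖P x v‖ ≤ C * ‖v‖ := by
  obtain ⟨t, ⟨J⟩⟩ := exists_fiberEmbedding (F := F) (V := V)
  obtain ⟨Cp, hCp, hp⟩ := J.exists_norm_p_le
  obtain ⟨Cj, hCj, hj⟩ := J.exists_norm_j_le
  have hc : Continuous fun x => J.j (σ x) ∘L P x ∘L J.p x :=
    (J.continuous_map_iff hσ).1 hP
  obtain ⟨M, hM⟩ := isCompact_univ.bddAbove_image hc.norm.continuousOn
  refine ⟨Cp * ((|M| + 1) * Cj), by positivity, fun x v => ?_⟩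
  have e : P x v = J.p (σ x) ((J.j (σ x) ∘L P x ∘L J.p x) (J.j x v)) := by
    simp [J.p_j]
  have hMx : ‖J.j (σ x) ∘L P x ∘L J.p x‖ ≤ |M| + 1 :=
    (hM ⟨x, trivial, rfl⟩).trans ((le_abs_self M).trans (le_add_of_nonneg_right zero_le_one))
  rw [e]
  calc _ ≤ Cp * ((|M| + 1) * (Cj * ‖v‖)) :=
        (hp _ _).trans (mul_le_mul_of_nonneg_left ((ContinuousLinearMap.le_opNorm _ _).trans
          (mul_le_mul hMx (hj x v) (norm_nonneg _) (by positivity))) hCp.le)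
    _ = _ := by ring

variable (F V) in
/-- The line spanned by a nonzero vector. -/
def toProjBundle (p : {p : TotalSpace F V // p.snd ≠ 0}) : ProjBundle F V :=
  ⟨p.1.proj, Projectivization.mk ℝ p.1.snd p.2⟩

theorem continuous_toProjBundle : Continuous (toProjBundle F V) := continuous_coinduced_rng

theorem continuous_projBundle_iff {Z : Type*} [TopologicalSpace Z] {f : ProjBundle F V → Z} :
    Continuous f ↔ Continuous (f ∘ toProjBundle F V) := continuous_coinduced_dom

/-- The projective bundle is the continuous image of the unit sphere bundle, which is compact as
the base is compact and the fibers have finite dimension. -/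
theorem compactSpace_projBundle [CompactSpace X] [FiniteDimensional ℝ F] :
    CompactSpace (ProjBundle F V) := by
  obtain ⟨t, ⟨J⟩⟩ := exists_fiberEmbedding (F := F) (V := V)
  obtain ⟨C, hC, hj⟩ := J.exists_norm_j_le
  have := FiniteDimensional.proper ℝ (t → F)
  have h1 : IsCompact ((fun z : X × (t → F) => (⟨z.1, J.p z.1 z.2⟩ : TotalSpace F V)) ''
      (Set.univ ×ˢ Metric.closedBall 0 C)) :=
    ((isCompact_univ (X := X)).prod (isCompact_closedBall _ _)).image J.continuous_p
  have hn : Continuous fun z : TotalSpace F V => ‖z.snd‖ :=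
    continuous_norm_mk (b := fun z : TotalSpace F V => z.proj) (s := fun z => z.snd) continuous_id
  have h2 := h1.inter_right (isClosed_eq hn (continuous_const (y := (1 : ℝ))))
  set S := ((fun z : X × (t → F) => (⟨z.1, J.p z.1 z.2⟩ : TotalSpace F V)) ''
      (Set.univ ×ˢ Metric.closedBall 0 C)) ∩ {z | ‖z.snd‖ = 1} with hS
  have hmem : ∀ z : TotalSpace F V, ‖z.snd‖ = 1 → z ∈ S := fun z hz => by
    refine ⟨⟨(z.proj, J.j z.proj z.snd), ⟨trivial, ?_⟩, ?_⟩, hz⟩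
    · simpa [hz] using hj z.proj z.snd
    · simp [J.p_j]
  have hne : ∀ z : TotalSpace F V, ‖z.snd‖ = 1 → z.snd ≠ 0 := fun z hz h => by
    simp [h] at hz
  have : CompactSpace S := isCompact_iff_compactSpace.1 h2
  let f : S → ProjBundle F V := fun z => toProjBundle F V ⟨z.1, hne z.1 z.2.2⟩
  have hf : Continuous f := continuous_toProjBundle.comp (by fun_prop)
  have hsurj : Function.Surjective f := by
    rintro ⟨x, l⟩
    induction l with
    | h v hv =>
      have hv' : ‖v‖ ≠ 0 := norm_ne_zero_iff.2 hv
      refine ⟨⟨⟨x, ‖v‖⁻¹ • v⟩, hmem _ (by simp [norm_smul, hv'])⟩, ?_⟩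
      simp only [f, toProjBundle, ProjBundle.mk.injEq, heq_eq_eq, true_and]
      rw [Projectivization.mk_eq_mk_iff']
      exact ⟨_, rfl⟩
  exact ⟨by rw [← hsurj.range_eq]; exact isCompact_range hf⟩

/-- The projective bundle is Hausdorff: lines are separated by the orthogonal projections
onto them. -/
theorem t2Space_projBundle [CompactSpace X] [FiniteDimensional ℝ F] :
    T2Space (ProjBundle F V) := by
  obtain ⟨t, ⟨J⟩⟩ := exists_fiberEmbedding (F := F) (V := V)
  let f : ProjBundle F V → X × ((t → F) → (t → F)) := fun q => (q.base, fun w =>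
    Projectivization.lift (fun v : {v : V q.base // v ≠ 0} =>
      (inner ℝ v.1 (J.p q.base w) / ‖v.1‖ ^ 2) • J.j q.base v.1) (by
        rintro ⟨a, ha⟩ ⟨b, hb⟩ s rfl
        have hs : s ≠ 0 := fun h => ha (by simp [h])
        have hb' : ‖b‖ ≠ 0 := norm_ne_zero_iff.2 hb
        simp only [inner_smul_left, norm_smul, map_smul, smul_smul, conj_trivial, mul_pow,
          Real.norm_eq_abs, sq_abs]
        congr 1
        field_simp) q.line)
  have hf : Continuous f := by
    rw [continuous_projBundle_iff]
    refine Continuous.prodMk ((FiberBundle.continuous_proj F V).comp continuous_subtype_val) ?_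
    refine continuous_pi fun w => ?_
    have hv : Continuous fun z : {p : TotalSpace F V // p.snd ≠ 0} =>
      (⟨z.1.proj, z.1.snd⟩ : TotalSpace F V) := continuous_subtype_val
    have hw : Continuous fun z : {p : TotalSpace F V // p.snd ≠ 0} =>
      (⟨z.1.proj, J.p z.1.proj w⟩ : TotalSpace F V) := J.continuous_p.comp
        (((FiberBundle.continuous_proj F V).comp continuous_subtype_val).prodMk continuous_const)
    exact ((hv.inner_bundle hw).div ((continuous_norm_mk hv).pow 2) fun z =>
      pow_ne_zero _ (norm_ne_zero_iff.2 z.2)).smul (J.continuous_j.comp continuous_subtype_val)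
  refine T2Space.of_injective_continuous (f := f) ?_ hf
  rintro ⟨x, l⟩ ⟨y, l'⟩ h
  obtain rfl : x = y := congrArg Prod.fst h
  congr 1
  induction l with
  | h v hv =>
    induction l' with
    | h v' hv' =>
      have h2 := congrFun (congrArg Prod.snd h) (J.j x v)
      simp only [f, Projectivization.lift_mk, J.p_j, real_inner_self_eq_norm_sq] at h2
      rw [div_self (pow_ne_zero _ (norm_ne_zero_iff.2 hv)), one_smul, ← map_smul] at h2
      rw [Projectivization.mk_eq_mk_iff']
      exact ⟨_, (J.j_injective x h2).symm⟩

variable {T : X ≃ₜ X}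

/-- A fiberwise bijective homogeneous map of the bundle close to the identity which
intertwines two linear cocycles up to scalars induces a conjugacy of the projective cocycles;
the inverse is automatically continuous as the projective bundle is compact. -/
theorem Cocycle.ProjConj.of_homogeneous [CompactSpace X] [FiniteDimensional ℝ F]
    {A B : Cocycle F V T} {ε ε' : ℝ} (hε : ε' < ε) (H : ∀ x, V x → V x)
    (hcont : Continuous fun z : {p : TotalSpace F V // p.snd ≠ 0} =>
      (⟨z.1.proj, H z.1.proj z.1.snd⟩ : TotalSpace F V))
    (hsmul : ∀ x (c : ℝ) v, c ≠ 0 → H x (c • v) = c • H x v)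
    (hzero : ∀ x, H x 0 = 0)
    (hbij : ∀ x, Function.Bijective (H x))
    (hconj : ∀ x v, v ≠ 0 → ∃ c : ℝ, H (T x) (A.fib x v) = c • B.fib x (H x v))
    (hclose : ∀ x v, ‖H x v - v‖ ≤ ε' * ‖v‖) : ProjConj ε A B := by
  have hne : ∀ x v, v ≠ 0 → H x v ≠ 0 := fun x v hv h =>
    hv ((hbij x).1 (by rw [h, hzero]))
  let h : ProjBundle F V → ProjBundle F V := fun q => ⟨q.base,
    Projectivization.lift (fun v : {v : V q.base // v ≠ 0} =>
      Projectivization.mk ℝ (H q.base v.1) (hne _ _ v.2)) (by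
        rintro ⟨a, ha⟩ ⟨b, hb⟩ s rfl
        have hs : s ≠ 0 := fun h => ha (by simp [h])
        rw [Projectivization.mk_eq_mk_iff']
        exact ⟨s, (hsmul _ s b hs).symm⟩) q.line⟩
  have h_mk : ∀ x v hv, h ⟨x, Projectivization.mk ℝ v hv⟩ =
    ⟨x, Projectivization.mk ℝ (H x v) (hne x v hv)⟩ := fun x v hv => rfl
  have hc : Continuous h := by
    rw [continuous_projBundle_iff]
    exact continuous_toProjBundle.comp (hcont.subtype_mk fun z => hne _ _ z.2)
  have hinj : Function.Injective h := by
    rintro ⟨x, l⟩ ⟨y, l'⟩ e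
    obtain rfl : x = y := congrArg ProjBundle.base e
    congr 1
    induction l with
    | h v hv =>
      induction l' with
      | h v' hv' =>
        rw [h_mk, h_mk] at e
        simp only [ProjBundle.mk.injEq, heq_eq_eq, true_and] at e
        rw [Projectivization.mk_eq_mk_iff'] at e ⊢
        obtain ⟨a, ha⟩ := e
        have ha' : a ≠ 0 := fun h0 => hne x v hv (by rw [← ha, h0, zero_smul])
        rw [← hsmul _ _ _ ha'] at ha
        exact ⟨a, (hbij x).1 ha⟩
  have hsurj : Function.Surjective h := by
    rintro ⟨x, l⟩
    induction l with
    | h v hv =>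
      obtain ⟨u, rfl⟩ := (hbij x).2 v
      exact ⟨⟨x, Projectivization.mk ℝ u fun h0 => hv (by rw [h0, hzero])⟩, rfl⟩
  have := compactSpace_projBundle (F := F) (V := V)
  have := t2Space_projBundle (F := F) (V := V)
  refine ⟨Continuous.homeoOfEquivCompactToT2 (f := Equiv.ofBijective h ⟨hinj, hsurj⟩) hc,
    fun p => rfl, ?_, ?_⟩
  · intro x u v hu hv e
    replace e : h ⟨x, Projectivization.mk ℝ u hu⟩ = ⟨x, Projectivization.mk ℝ v hv⟩ := e
    rw [h_mk] at e
    simp only [ProjBundle.mk.injEq, heq_eq_eq, true_and] at e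
    obtain ⟨a, ha⟩ := (Projectivization.mk_eq_mk_iff' _ _ _ _ _).1 e
    have h1 := sin_angle_mul_norm_le u v a
    rw [ha, norm_sub_rev] at h1
    have hu' : 0 < ‖u‖ := norm_pos_iff.2 hu
    exact (le_of_mul_le_mul_right (h1.trans (hclose x u)) hu').trans_lt hε
  · rintro ⟨x, l⟩
    induction l with
    | h v hv =>
      obtain ⟨c, hc⟩ := hconj x v hv
      have hA : A.fib x v ≠ 0 := (A.fib x).map_ne_zero_iff.2 hv
      have hB : B.fib x (H x v) ≠ 0 := (B.fib x).map_ne_zero_iff.2 (hne x v hv)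
      have e : Projectivization.mk ℝ (H (T x) (A.fib x v)) (hne _ _ hA) =
          Projectivization.mk ℝ (B.fib x (H x v)) hB :=
        (Projectivization.mk_eq_mk_iff' _ _ _ _ _).2 ⟨c, hc.symm⟩
      exact congrArg (ProjBundle.mk (T x)) e

end Projective

/-! ### Inverses of linear cocycles -/

section Inverse

variable {X : Type*} [MetricSpace X]
  {F : Type*} [NormedAddCommGroup F] [NormedSpace ℝ F] [FiniteDimensional ℝ F]
  {V : X → Type*} [TopologicalSpace (TotalSpace F V)]
  [∀ x, NormedAddCommGroup (V x)] [∀ x, InnerProductSpace ℝ (V x)]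
  [FiberBundle F V] [VectorBundle ℝ F V]

/-- The inverse of a continuous family of linear isomorphisms onto the model fiber is
continuous. -/
theorem continuousAt_inverse_frame {x₀ : X} (t : ∀ x, V x →ₗ[ℝ] F) (s : ∀ x, F →ₗ[ℝ] V x)
    (hst : ∀ᶠ x in 𝓝 x₀, ∀ v, s x (t x v) = v) (hts : ∀ᶠ x in 𝓝 x₀, ∀ w, t x (s x w) = w)
    (ht : ∀ v : V x₀, ContinuousAt (fun z : TotalSpace F V => t z.proj z.snd) ⟨x₀, v⟩) (w : F) :
    ContinuousAt (fun z : X × F => (⟨z.1, s z.1 z.2⟩ : TotalSpace F V)) (x₀, w) := by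
  set e := trivializationAt F V x₀ with he
  have hx₀ : x₀ ∈ e.baseSet := FiberBundle.mem_baseSet_trivializationAt' x₀
  have hbase : ∀ᶠ x in 𝓝 x₀, x ∈ e.baseSet := e.open_baseSet.mem_nhds hx₀
  let M : X → (F →L[ℝ] F) := fun x =>
    LinearMap.toContinuousLinearMap (t x ∘ₗ (e.symmL ℝ x).toLinearMap)
  let N : X → (F →L[ℝ] F) := fun x =>
    LinearMap.toContinuousLinearMap ((e.continuousLinearMapAt ℝ x).toLinearMap ∘ₗ s x)
  have hMN : ∀ᶠ x in 𝓝 x₀, M x * N x = 1 ∧ N x * M x = 1 := by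
    filter_upwards [hst, hts, hbase] with x h1 h2 h3
    constructor
    · ext w
      simp [M, N, -Trivialization.continuousLinearMapAt_apply, -Trivialization.symmL_apply,
        e.symmL_continuousLinearMapAt h3, h2]
    · ext w
      simp [M, N, -Trivialization.continuousLinearMapAt_apply, -Trivialization.symmL_apply,
        e.continuousLinearMapAt_symmL h3, h1]
  have hM : ContinuousAt M x₀ := by
    refine continuousAt_clm_apply.2 fun w => ?_
    have h1 : ContinuousAt (fun x : X => (⟨x, e.symmL ℝ x w⟩ : TotalSpace F V)) x₀ :=
      ContinuousAt.comp (f := fun x : X => (x, w)) (continuousAt_trivialization_symm e hx₀)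
        (by fun_prop)
    exact ContinuousAt.comp (f := fun x : X => (⟨x, e.symmL ℝ x w⟩ : TotalSpace F V)) (ht _) h1
  have hN : ContinuousAt N x₀ := by
    obtain ⟨h1, h2⟩ := hMN.self_of_nhds
    have h3 : ContinuousAt Ring.inverse (M x₀) :=
      NormedRing.inverse_continuousAt ⟨M x₀, N x₀, h1, h2⟩
    refine (ContinuousAt.comp (f := M) h3 hM).congr ?_
    filter_upwards [hMN] with x hx
    exact Ring.inverse_unit ⟨M x, N x, hx.1, hx.2⟩
  refine continuousAt_mk_iff.2 ⟨continuousAt_fst, ?_⟩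
  exact ContinuousAt.clm_apply (f := fun z : X × F => N z.1)
    (ContinuousAt.comp (f := Prod.fst) (x := (x₀, w)) hN continuousAt_fst) continuousAt_snd

namespace Cocycle

variable {T : X ≃ₜ X} (A : Cocycle F V T)

theorem bijective_map : Function.Bijective A.map := by
  constructor
  · rintro ⟨x, v⟩ ⟨y, w⟩ h
    obtain rfl : x = y := T.injective (congrArg TotalSpace.proj h)
    simp only [Cocycle.map, TotalSpace.mk.injEq, heq_eq_eq, true_and] at h
    rw [(A.fib x).injective h]
  · rintro ⟨y, w⟩
    obtain ⟨x, rfl⟩ := T.surjective y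
    exact ⟨⟨x, (A.fib x).symm w⟩, by simp [Cocycle.map]⟩

/-- A linear cocycle as a homeomorphism of the total space. -/
def homeo : TotalSpace F V ≃ₜ TotalSpace F V where
  toEquiv := Equiv.ofBijective A.map A.bijective_map
  continuous_toFun := A.continuous_fib
  continuous_invFun := by
    refine continuous_iff_continuousAt.2 fun z₀ => ?_
    set e := trivializationAt F V z₀.proj with he
    have hz₀ : z₀.proj ∈ e.baseSet := FiberBundle.mem_baseSet_trivializationAt' _
    set x₀ := T.symm z₀.proj with hx₀
    have hTx₀ : T x₀ ∈ e.baseSet := by rwa [hx₀, T.apply_symm_apply]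
    have hbase : ∀ᶠ x in 𝓝 x₀, T x ∈ e.baseSet :=
      T.continuous.continuousAt (e.open_baseSet.mem_nhds hTx₀)
    have key := continuousAt_inverse_frame (x₀ := x₀)
      (fun x => (e.continuousLinearMapAt ℝ (T x)).toLinearMap ∘ₗ (A.fib x).toLinearMap)
      (fun x => (A.fib x).symm.toLinearMap ∘ₗ (e.symmL ℝ (T x)).toLinearMap)
      (by
        filter_upwards [hbase] with x hx v
        simp [-Trivialization.continuousLinearMapAt_apply, -Trivialization.symmL_apply,
          e.symmL_continuousLinearMapAt hx])
      (by
        filter_upwards [hbase] with x hx v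
        simp [-Trivialization.continuousLinearMapAt_apply, -Trivialization.symmL_apply,
          e.continuousLinearMapAt_symmL hx])
      (fun v => ContinuousAt.comp (f := A.map) (x := ⟨x₀, v⟩)
        (continuousAt_trivialization e (z₀ := A.map ⟨x₀, v⟩) hTx₀) A.continuous_fib.continuousAt)
      (e.continuousLinearMapAt ℝ z₀.proj z₀.snd)
    have h1 : ContinuousAt (fun z : TotalSpace F V =>
        (T.symm z.proj, e.continuousLinearMapAt ℝ z.proj z.snd)) z₀ :=
      (T.symm.continuous.comp (FiberBundle.continuous_proj F V)).continuousAt.prodMk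
        (continuousAt_trivialization e hz₀)
    refine (ContinuousAt.comp (f := fun z : TotalSpace F V =>
        (T.symm z.proj, e.continuousLinearMapAt ℝ z.proj z.snd)) (x := z₀) key h1).congr ?_
    have hb : ∀ᶠ z : TotalSpace F V in 𝓝 z₀, z.proj ∈ e.baseSet :=
      (FiberBundle.continuous_proj F V).continuousAt (e.open_baseSet.mem_nhds hz₀)
    filter_upwards [hb] with z hz
    refine ((Equiv.ofBijective A.map A.bijective_map).symm_apply_eq.2 ?_).symm
    obtain ⟨y, v⟩ := z
    obtain ⟨x, rfl⟩ := T.surjective y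
    simp only [Function.comp_apply, LinearMap.comp_apply, LinearEquiv.coe_coe,
      Equiv.ofBijective_apply, Cocycle.map, LinearEquiv.apply_symm_apply,
      ContinuousLinearMap.coe_coe]
    rw [T.symm_apply_apply, e.symmL_continuousLinearMapAt hz]

@[simp] theorem homeo_apply (z : TotalSpace F V) : A.homeo z = A.map z := rfl

theorem homeo_symm_mk (x : X) (v : V (T x)) :
    A.homeo.symm ⟨T x, v⟩ = ⟨x, (A.fib x).symm v⟩ := by
  rw [Homeomorph.symm_apply_eq]
  simp [Cocycle.map]

end Cocycle

end Inverse

/-! ### Conjugating a block rescaling of a dominated cocycle -/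

section Series

variable {Z : Type*} [TopologicalSpace Z]

/-- Two nonnegative functions whose ratio `b / a` contracts by the factor `κ` along the orbits
of `g`, and a bounded nonnegative weight `θ`. -/
structure Contracts (g : Z → Z) (a b θ : Z → ℝ) (κ δ : ℝ) : Prop where
  continuous_g : Continuous g
  continuous_a : Continuous a
  continuous_b : Continuous b
  continuous_θ : Continuous θ
  a_nonneg : ∀ z, 0 ≤ a z
  b_nonneg : ∀ z, 0 ≤ b z
  θ_nonneg : ∀ z, 0 ≤ θ z
  θ_le : ∀ z, θ z ≤ δ
  κ_nonneg : 0 ≤ κ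
  κ_lt : κ < 1
  a_ne : ∀ z, a z ≠ 0 → a (g z) ≠ 0
  ratio : ∀ z, b (g z) * a z ≤ κ * b z * a (g z)

/-- The sum of `θ b / (a + b)` along the forward orbit of a point: a solution of the
cohomological equation where `a` does not vanish. -/
def orbitSum (g : Z → Z) (a b θ : Z → ℝ) (z : Z) : ℝ :=
  ∑' n : ℕ, θ (g^[n] z) * (b (g^[n] z) / (a (g^[n] z) + b (g^[n] z)))

namespace Contracts

variable {g : Z → Z} {a b θ : Z → ℝ} {κ δ : ℝ} (h : Contracts g a b θ κ δ)
include h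

theorem δ_nonneg (z : Z) : 0 ≤ δ := (h.θ_nonneg z).trans (h.θ_le z)

theorem a_iterate_ne {z : Z} (hz : a z ≠ 0) (n : ℕ) : a (g^[n] z) ≠ 0 := by
  induction n with
  | zero => exact hz
  | succ n ih => rw [Function.iterate_succ_apply']; exact h.a_ne _ ih

theorem ratio_iterate {z : Z} (hz : a z ≠ 0) (n : ℕ) :
    b (g^[n] z) / a (g^[n] z) ≤ κ ^ n * (b z / a z) := by
  induction n with
  | zero => simp
  | succ n ih =>
    have h1 := (h.a_nonneg _).lt_of_ne' (h.a_iterate_ne hz n)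
    have h2 := (h.a_nonneg _).lt_of_ne' (h.a_iterate_ne hz (n + 1))
    rw [Function.iterate_succ_apply'] at h2 ⊢
    have : b (g (g^[n] z)) / a (g (g^[n] z)) ≤ κ * (b (g^[n] z) / a (g^[n] z)) := by
      rw [← mul_div_assoc, div_le_div_iff₀ h2 h1]
      exact h.ratio _
    refine this.trans ?_
    rw [pow_succ', mul_assoc]
    exact mul_le_mul_of_nonneg_left ih h.κ_nonneg

theorem term_nonneg (z : Z) : 0 ≤ θ z * (b z / (a z + b z)) :=
  mul_nonneg (h.θ_nonneg _) (div_nonneg (h.b_nonneg _) (add_nonneg (h.a_nonneg _) (h.b_nonneg _)))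

theorem term_le {z : Z} (hz : a z ≠ 0) (n : ℕ) :
    θ (g^[n] z) * (b (g^[n] z) / (a (g^[n] z) + b (g^[n] z))) ≤ δ * (κ ^ n * (b z / a z)) := by
  refine mul_le_mul (h.θ_le _) ((div_le_div_of_nonneg_left (h.b_nonneg _)
    ((h.a_nonneg _).lt_of_ne' (h.a_iterate_ne hz n))
    (le_add_of_nonneg_right (h.b_nonneg _))).trans (h.ratio_iterate hz n))
    (div_nonneg (h.b_nonneg _) (add_nonneg (h.a_nonneg _) (h.b_nonneg _))) (h.δ_nonneg z)

theorem summable_geometric (c : ℝ) : Summable fun n : ℕ => δ * (κ ^ n * c) :=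
  ((summable_geometric_of_lt_one h.κ_nonneg h.κ_lt).mul_right c).mul_left δ

theorem summable {z : Z} (hz : a z ≠ 0) :
    Summable fun n : ℕ => θ (g^[n] z) * (b (g^[n] z) / (a (g^[n] z) + b (g^[n] z))) :=
  Summable.of_nonneg_of_le (fun _ => h.term_nonneg _) (h.term_le hz) (h.summable_geometric _)

theorem orbitSum_nonneg (z : Z) : 0 ≤ orbitSum g a b θ z := tsum_nonneg fun _ => h.term_nonneg _

theorem orbitSum_mul_le {z : Z} (hz : a z ≠ 0) :
    orbitSum g a b θ z * a z ≤ δ / (1 - κ) * b z := by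
  have h1 : orbitSum g a b θ z ≤ δ * ((1 - κ)⁻¹ * (b z / a z)) := by
    have := (h.summable hz).tsum_le_tsum (h.term_le hz) (h.summable_geometric _)
    rwa [tsum_mul_left, tsum_mul_right, tsum_geometric_of_lt_one h.κ_nonneg h.κ_lt] at this
  refine (mul_le_mul_of_nonneg_right h1 (h.a_nonneg z)).trans (le_of_eq ?_)
  field_simp

theorem orbitSum_eq_add {z : Z} (hz : a z ≠ 0) :
    orbitSum g a b θ z = θ z * (b z / (a z + b z)) + orbitSum g a b θ (g z) := by
  rw [orbitSum, (h.summable hz).tsum_eq_zero_add]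
  rfl

theorem continuousAt_orbitSum {z₀ : Z} (hz₀ : a z₀ ≠ 0) :
    ContinuousAt (orbitSum g a b θ) z₀ := by
  have ha : ∀ z, a z ≠ 0 → 0 < a z := fun z hz => (h.a_nonneg z).lt_of_ne' hz
  set M := b z₀ / a z₀ + 1 with hM
  let U : Set Z := {z | a z ≠ 0} ∩ {z | b z < M * a z}
  have hU : IsOpen U := (isOpen_ne_fun h.continuous_a continuous_const).inter
    (isOpen_lt h.continuous_b (continuous_const.mul h.continuous_a))
  have hzU : z₀ ∈ U := ⟨hz₀, by
    have := ha z₀ hz₀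
    change b z₀ < M * a z₀
    rw [hM, add_mul, div_mul_cancel₀ _ hz₀]
    linarith⟩
  refine ContinuousOn.continuousAt (s := U) ?_ (hU.mem_nhds hzU)
  refine continuousOn_tsum (u := fun n => δ * (κ ^ n * M)) (fun n => ?_) (h.summable_geometric M) ?_
  · have hg := h.continuous_g.iterate n
    have h1 := h.continuous_a.comp hg
    have h2 := h.continuous_b.comp hg
    refine (h.continuous_θ.comp hg).continuousOn.mul
      (h2.continuousOn.div (h1.add h2).continuousOn fun z hz => ?_)
    exact (add_pos_of_pos_of_nonneg (ha _ (h.a_iterate_ne hz.1 n)) (h.b_nonneg _)).ne'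
  · intro n z hz
    rw [Real.norm_of_nonneg (h.term_nonneg _)]
    refine (h.term_le hz.1 n).trans (mul_le_mul_of_nonneg_left (mul_le_mul_of_nonneg_left ?_
      (pow_nonneg h.κ_nonneg n)) (h.δ_nonneg z))
    exact (div_lt_iff₀ (ha z hz.1)).2 hz.2 |>.le

omit h in
theorem orbitSum_congr {m : Z → Z} (hm : Function.Commute g m) (hθ : ∀ z, θ (m z) = θ z)
    (hab : ∀ z, b (m z) / (a (m z) + b (m z)) = b z / (a z + b z)) (z : Z) :
    orbitSum g a b θ (m z) = orbitSum g a b θ z := by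
  refine tsum_congr fun n => ?_
  have : g^[n] (m z) = m (g^[n] z) := (hm.iterate_left n) z
  rw [this, hθ, hab]

theorem orbitSum_mono {m : Z → Z} (hm : Function.Commute g m) (hθ : ∀ z, θ (m z) = θ z)
    {z : Z} (hz : a z ≠ 0) (hmz : a (m z) ≠ 0)
    (hab : ∀ z, a z ≠ 0 → b z / (a z + b z) ≤ b (m z) / (a (m z) + b (m z))) :
    orbitSum g a b θ z ≤ orbitSum g a b θ (m z) := by
  refine (h.summable hz).tsum_le_tsum (fun n => ?_) (h.summable hmz)
  have : g^[n] (m z) = m (g^[n] z) := (hm.iterate_left n) z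
  rw [this, hθ]
  exact mul_le_mul_of_nonneg_left (hab _ (h.a_iterate_ne hz n)) (h.θ_nonneg _)

end Contracts

end Series

section Blocks

variable {X : Type*} [MetricSpace X]
  {F : Type*} [NormedAddCommGroup F] [NormedSpace ℝ F]
  {V : X → Type*} [TopologicalSpace (TotalSpace F V)]
  [∀ x, NormedAddCommGroup (V x)] [∀ x, InnerProductSpace ℝ (V x)]

variable (F V) in
/-- A splitting of the bundle into two blocks, given by the projections `P` and `Q`, together with
functions `a` and `b` which measure the size of the components of a vector in the two blocks. -/
structure Blocks where
  /-- The projection onto the first block. -/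
  P : ∀ x, V x →L[ℝ] V x
  /-- The projection onto the second block. -/
  Q : ∀ x, V x →L[ℝ] V x
  /-- The size of the first component. -/
  a : TotalSpace F V → ℝ
  /-- The size of the second component. -/
  b : TotalSpace F V → ℝ
  add : ∀ x v, P x v + Q x v = v
  P_Q : ∀ x v, P x (Q x v) = 0
  Q_P : ∀ x v, Q x (P x v) = 0
  continuous_P : Continuous fun z : TotalSpace F V => (⟨z.proj, P z.proj z.snd⟩ : TotalSpace F V)
  continuous_Q : Continuous fun z : TotalSpace F V => (⟨z.proj, Q z.proj z.snd⟩ : TotalSpace F V)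
  continuous_a : Continuous a
  continuous_b : Continuous b
  a_nonneg : ∀ z, 0 ≤ a z
  b_nonneg : ∀ z, 0 ≤ b z
  a_comb : ∀ x v (p q : ℝ), a ⟨x, p • P x v + q • Q x v⟩ = |p| * a ⟨x, v⟩
  b_comb : ∀ x v (p q : ℝ), b ⟨x, p • P x v + q • Q x v⟩ = |q| * b ⟨x, v⟩
  P_eq_zero : ∀ z, a z = 0 → P z.proj z.snd = 0
  Q_eq_zero : ∀ z, b z = 0 → Q z.proj z.snd = 0

namespace Blocks

variable (S : Blocks F V)

theorem P_P (x : X) (v : V x) : S.P x (S.P x v) = S.P x v := by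
  conv_rhs => rw [← S.add x v, map_add, S.P_Q, add_zero]

theorem Q_Q (x : X) (v : V x) : S.Q x (S.Q x v) = S.Q x v := by
  conv_rhs => rw [← S.add x v, map_add, S.Q_P, zero_add]

/-- The bundle map which multiplies the first block by `p` and the second one by `q`. -/
def comb (p q : ℝ) (z : TotalSpace F V) : TotalSpace F V :=
  ⟨z.proj, p • S.P z.proj z.snd + q • S.Q z.proj z.snd⟩

theorem P_comb (x : X) (v : V x) (p q : ℝ) : S.P x (p • S.P x v + q • S.Q x v) = p • S.P x v := by
  simp [S.P_P, S.P_Q]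

theorem Q_comb (x : X) (v : V x) (p q : ℝ) : S.Q x (p • S.P x v + q • S.Q x v) = q • S.Q x v := by
  simp [S.Q_P, S.Q_Q]

theorem a_eq_zero_iff (z : TotalSpace F V) : S.a z = 0 ↔ S.P z.proj z.snd = 0 := by
  refine ⟨S.P_eq_zero z, fun h => ?_⟩
  have h1 := S.a_comb z.proj z.snd 0 1
  have h2 := S.add z.proj z.snd
  rw [h, zero_add] at h2
  rw [h2] at h1
  simpa using h1

theorem b_eq_zero_iff (z : TotalSpace F V) : S.b z = 0 ↔ S.Q z.proj z.snd = 0 := by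
  refine ⟨S.Q_eq_zero z, fun h => ?_⟩
  have h1 := S.b_comb z.proj z.snd 1 0
  have h2 := S.add z.proj z.snd
  rw [h, add_zero] at h2
  rw [h2] at h1
  simpa using h1

variable {T : X ≃ₜ X} {A : Cocycle F V T}

theorem map_Q (hA : ∀ x v, A.fib x (S.P x v) = S.P (T x) (A.fib x v)) (x : X) (v : V x) :
    A.fib x (S.Q x v) = S.Q (T x) (A.fib x v) := by
  have h1 := congrArg (A.fib x) (S.add x v)
  rw [map_add, hA] at h1
  have h2 := S.add (T x) (A.fib x v)
  exact add_left_cancel (h1.trans h2.symm)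

theorem map_comb (hA : ∀ x v, A.fib x (S.P x v) = S.P (T x) (A.fib x v)) (p q : ℝ) :
    Function.Commute A.map (S.comb p q) := by
  rintro ⟨x, v⟩
  refine congrArg (TotalSpace.mk (F := F) (T x)) ?_
  change A.fib x (p • S.P x v + q • S.Q x v) = p • S.P (T x) (A.fib x v) + q • S.Q (T x) (A.fib x v)
  rw [map_add, map_smul, map_smul, hA, S.map_Q hA]

end Blocks

variable [FiniteDimensional ℝ F] [FiberBundle F V] [VectorBundle ℝ F V]

namespace Blocks

variable (S : Blocks F V) {T : X ≃ₜ X} {A : Cocycle F V T}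

theorem homeo_symm_comb (hA : ∀ x v, A.fib x (S.P x v) = S.P (T x) (A.fib x v)) (p q : ℝ) :
    Function.Commute A.homeo.symm (S.comb p q) := by
  intro z
  rw [Homeomorph.symm_apply_eq, Cocycle.homeo_apply, S.map_comb hA p q, ← Cocycle.homeo_apply,
    A.homeo.apply_symm_apply]

variable {θ : X → ℝ} {κ δ : ℝ}

theorem contracts_forward (hA : ∀ x v, A.fib x (S.P x v) = S.P (T x) (A.fib x v))
    (hθ : Continuous θ) (hθ0 : ∀ x, 0 ≤ θ x) (hθδ : ∀ x, θ x ≤ δ) (hκ0 : 0 ≤ κ) (hκ : κ < 1)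
    (hdom : ∀ z, S.a (A.map z) * S.b z ≤ κ * S.a z * S.b (A.map z)) :
    Contracts A.map S.b S.a (fun z => θ z.proj) κ δ where
  continuous_g := A.homeo.continuous
  continuous_a := S.continuous_b
  continuous_b := S.continuous_a
  continuous_θ := hθ.comp (FiberBundle.continuous_proj F V)
  a_nonneg := S.b_nonneg
  b_nonneg := S.a_nonneg
  θ_nonneg z := hθ0 _
  θ_le z := hθδ _
  κ_nonneg := hκ0
  κ_lt := hκ
  a_ne z hz h := by
    rw [Ne, S.b_eq_zero_iff] at hz
    rw [S.b_eq_zero_iff] at h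
    replace h : S.Q (T z.proj) (A.fib z.proj z.snd) = 0 := h
    rw [← S.map_Q hA] at h
    exact hz ((A.fib _).map_eq_zero_iff.1 h)
  ratio := hdom

theorem contracts_backward (hA : ∀ x v, A.fib x (S.P x v) = S.P (T x) (A.fib x v))
    (hθ : Continuous θ) (hθ0 : ∀ x, 0 ≤ θ x) (hθδ : ∀ x, θ x ≤ δ) (hκ0 : 0 ≤ κ) (hκ : κ < 1)
    (hdom : ∀ z, S.a (A.map z) * S.b z ≤ κ * S.a z * S.b (A.map z)) :
    Contracts A.homeo.symm S.a S.b (fun z => θ z.proj) κ δ where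
  continuous_g := A.homeo.symm.continuous
  continuous_a := S.continuous_a
  continuous_b := S.continuous_b
  continuous_θ := hθ.comp (FiberBundle.continuous_proj F V)
  a_nonneg := S.a_nonneg
  b_nonneg := S.b_nonneg
  θ_nonneg z := hθ0 _
  θ_le z := hθδ _
  κ_nonneg := hκ0
  κ_lt := hκ
  a_ne z hz h := by
    refine hz ?_
    have e : A.map (A.homeo.symm z) = z := A.homeo.apply_symm_apply z
    rw [S.a_eq_zero_iff] at h
    rw [← e, S.a_eq_zero_iff]
    change S.P (T _) (A.fib _ _) = 0
    rw [← hA, h, map_zero]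
  ratio z := by
    have e : A.map (A.homeo.symm z) = z := A.homeo.apply_symm_apply z
    have := hdom (A.homeo.symm z)
    rw [e] at this
    linarith

end Blocks

/-- A strictly increasing function of the form `s ↦ s * exp (Φ s)` with `Φ` monotone takes the
value `1`. -/
theorem exists_mul_exp_eq_one {Φ : ℝ → ℝ} (hc : ContinuousOn Φ (Set.Ioi 0))
    (hm : MonotoneOn Φ (Set.Ioi 0)) : ∃ s > 0, s * Real.exp (Φ s) = 1 := by
  have h1 : (1 : ℝ) ∈ Set.Ioi (0 : ℝ) := Set.mem_Ioi.2 one_pos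
  set lo := min 1 (Real.exp (-Φ 1)) with hlo
  set hi := max 1 (Real.exp (-Φ 1)) with hhi
  have hlo0 : 0 < lo := lt_min one_pos (Real.exp_pos _)
  have hle : lo ≤ hi := (min_le_left _ _).trans (le_max_left _ _)
  have hsub : Set.Icc lo hi ⊆ Set.Ioi 0 := fun s hs => hlo0.trans_le hs.1
  have hf : ContinuousOn (fun s => s * Real.exp (Φ s)) (Set.Icc lo hi) :=
    continuousOn_id.mul (Real.continuous_exp.comp_continuousOn (hc.mono hsub))
  have hcancel : Real.exp (-Φ 1) * Real.exp (Φ 1) = 1 := by rw [← Real.exp_add]; simp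
  have hflo : lo * Real.exp (Φ lo) ≤ 1 := by
    rw [← hcancel]
    exact mul_le_mul (min_le_right _ _) (Real.exp_le_exp.2 (hm hlo0 h1 (min_le_left _ _)))
      (Real.exp_pos _).le (Real.exp_pos _).le
  have hfhi : 1 ≤ hi * Real.exp (Φ hi) := by
    rw [← hcancel]
    exact mul_le_mul (le_max_right _ _) (Real.exp_le_exp.2 (hm h1 (hlo0.trans_le hle)
      (le_max_left _ _))) (Real.exp_pos _).le (hlo0.trans_le hle).le
  obtain ⟨s, hs, hs'⟩ := intermediate_value_Icc hle hf ⟨hflo, hfhi⟩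
  exact ⟨s, hsub hs, hs'⟩

theorem eq_one_of_mul_exp_eq {Φ : ℝ → ℝ} (hm : MonotoneOn Φ (Set.Ioi 0)) {s : ℝ} (hs : 0 < s)
    (h : s * Real.exp (Φ s) = Real.exp (Φ 1)) : s = 1 := by
  have h1 : (1 : ℝ) ∈ Set.Ioi (0 : ℝ) := Set.mem_Ioi.2 one_pos
  rcases lt_trichotomy s 1 with hlt | rfl | hlt
  · have := Real.exp_le_exp.2 (hm hs h1 hlt.le)
    nlinarith [Real.exp_pos (Φ s), Real.exp_pos (Φ 1)]
  · rfl
  · have := Real.exp_le_exp.2 (hm h1 hs hlt.le)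
    nlinarith [Real.exp_pos (Φ s), Real.exp_pos (Φ 1)]

variable [CompactSpace X] [IsContinuousRiemannianBundle F V]
  {T : X ≃ₜ X} {A A' : Cocycle F V T} {θ : X → ℝ} {κ δ C ε : ℝ}

/-- Multiplying the dominating block of a dominated splitting by a factor `exp θ ≥ 1` does not
change the projective cocycle up to conjugacy. In each fiber the conjugacy multiplies the first
block by `exp (-ψ⁺)` and the second one by `exp ψ⁻`, where `ψ⁺` and `-ψ⁻` are sums
of `θ b / (a + b)` along the past and of `θ a / (a + b)` along the future. Thus `ψ = ψ⁺ + ψ⁻` solves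
`ψ ∘ A = ψ + θ`, and as `θ ≥ 0`, `ψ` is monotone in the ratio of the components, which makes
the map bijective. -/
theorem Cocycle.ProjConj.of_blocks (S : Blocks F V)
    (hA : ∀ x v, A.fib x (S.P x v) = S.P (T x) (A.fib x v))
    (hA' : ∀ x v, A'.fib x v = A.fib x (S.P x v) + Real.exp (θ x) • A.fib x (S.Q x v))
    (hθ : Continuous θ) (hθ0 : ∀ x, 0 ≤ θ x) (hθδ : ∀ x, θ x ≤ δ) (hκ0 : 0 ≤ κ) (hκ : κ < 1)
    (hdom : ∀ z, S.a (A.map z) * S.b z ≤ κ * S.a z * S.b (A.map z))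
    (hδ : 0 ≤ δ) (hC0 : 0 ≤ C)
    (hP : ∀ z, ‖S.P z.proj z.snd‖ ≤ C * S.a z) (hQ : ∀ z, ‖S.Q z.proj z.snd‖ ≤ C * S.b z)
    (hab : ∀ z, S.a z + S.b z ≤ C * ‖z.snd‖)
    (hε : C * (δ / (1 - κ)) * C < ε) : ProjConj ε A A' := by
  obtain ⟨t, ⟨J⟩⟩ := exists_fiberEmbedding (F := F) (V := V)
  have hf := S.contracts_forward hA hθ hθ0 hθδ hκ0 hκ hdom
  have hb := S.contracts_backward hA hθ hθ0 hθδ hκ0 hκ hdom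
  -- the sums over the past and over the future
  let past : TotalSpace F V → ℝ := fun z =>
    orbitSum A.homeo.symm S.a S.b (fun z => θ z.proj) (A.homeo.symm z)
  let fut : TotalSpace F V → ℝ := orbitSum A.map S.b S.a (fun z => θ z.proj)
  have past_nonneg : ∀ z, 0 ≤ past z := fun z => hb.orbitSum_nonneg _
  have fut_nonneg : ∀ z, 0 ≤ fut z := fun z => hf.orbitSum_nonneg _
  have past_cont : ∀ z, S.a z ≠ 0 → ContinuousAt past z := fun z hz =>
    ContinuousAt.comp (f := A.homeo.symm) (hb.continuousAt_orbitSum (hb.a_ne z hz))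
      A.homeo.symm.continuous.continuousAt
  have fut_cont : ∀ z, S.b z ≠ 0 → ContinuousAt fut z := fun z hz => hf.continuousAt_orbitSum hz
  have hK : 0 ≤ δ / (1 - κ) := div_nonneg hδ (sub_nonneg.2 hκ.le)
  have past_mul : ∀ z, past z * S.a z ≤ δ / (1 - κ) * S.b z := fun z => by
    by_cases hz : S.a z = 0
    · rw [hz, mul_zero]; exact mul_nonneg hK (S.b_nonneg z)
    have h1 := hb.orbitSum_mul_le (hb.a_ne z hz)
    have h2 := hb.ratio z
    have h3 : 0 < S.a (A.homeo.symm z) := (S.a_nonneg _).lt_of_ne' (hb.a_ne z hz)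
    refine le_of_mul_le_mul_right ?_ h3
    calc past z * S.a z * S.a (A.homeo.symm z) = (past z * S.a (A.homeo.symm z)) * S.a z := by ring
      _ ≤ (δ / (1 - κ) * S.b (A.homeo.symm z)) * S.a z :=
        mul_le_mul_of_nonneg_right h1 (S.a_nonneg z)
      _ = δ / (1 - κ) * (S.b (A.homeo.symm z) * S.a z) := by ring
      _ ≤ δ / (1 - κ) * (κ * S.b z * S.a (A.homeo.symm z)) := mul_le_mul_of_nonneg_left h2 hK
      _ ≤ δ / (1 - κ) * (1 * S.b z * S.a (A.homeo.symm z)) := by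
        have := S.b_nonneg z
        gcongr
      _ = δ / (1 - κ) * S.b z * S.a (A.homeo.symm z) := by ring
  have fut_mul : ∀ z, fut z * S.b z ≤ δ / (1 - κ) * S.a z := fun z => by
    by_cases hz : S.b z = 0
    · rw [hz, mul_zero]; exact mul_nonneg hK (S.a_nonneg z)
    · exact hf.orbitSum_mul_le hz
  -- invariance under scaling of the vector
  have scale_hom : ∀ c : ℝ, c ≠ 0 → ∀ z, past (S.comb c c z) = past z ∧
      fut (S.comb c c z) = fut z := fun c hc z => by
    have hc' : 0 < |c| := abs_pos.2 hc
    constructor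
    · simp only [past]
      rw [S.homeo_symm_comb hA]
      refine Contracts.orbitSum_congr (S.homeo_symm_comb hA c c) (fun z => rfl) (fun z => ?_) _
      simp only [Blocks.comb, S.a_comb, S.b_comb]
      rw [← mul_add, mul_div_mul_left _ _ hc'.ne']
    · refine Contracts.orbitSum_congr (S.map_comb hA c c) (fun z => rfl) (fun z => ?_) _
      simp only [Blocks.comb, S.a_comb, S.b_comb]
      rw [← mul_add, mul_div_mul_left _ _ hc'.ne']
  have comb_one : ∀ z : TotalSpace F V, S.comb 1 1 z = z := fun z => by
    simp [Blocks.comb, S.add]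
  have comb_comb : ∀ (z : TotalSpace F V) (p q r s : ℝ),
      S.comb p q (S.comb r s z) = S.comb (p * r) (q * s) z := fun z p q r s => by
    obtain ⟨x, v⟩ := z
    refine congrArg (TotalSpace.mk (F := F) x) ?_
    change p • S.P x (r • S.P x v + s • S.Q x v) + q • S.Q x (r • S.P x v + s • S.Q x v) =
      (p * r) • S.P x v + (q * s) • S.Q x v
    rw [S.P_comb, S.Q_comb, smul_smul, smul_smul]
  -- monotonicity along the rays
  have mono : ∀ z, S.a z ≠ 0 → S.b z ≠ 0 →
      MonotoneOn (fun s => past (S.comb 1 s z) - fut (S.comb 1 s z)) (Set.Ioi 0) := by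
    intro z ha hb' s hs s' hs' hle
    have hs : 0 < s := hs
    have hs' : 0 < s' := hs'
    set w := S.comb 1 s z with hw
    have hw' : S.comb 1 s' z = S.comb 1 (s' / s) w := by
      rw [hw, comb_comb, one_mul, div_mul_cancel₀ _ hs.ne']
    have hr : 1 ≤ s' / s := (one_le_div hs).2 hle
    have hr0 : 0 < s' / s := one_pos.trans_le hr
    set r := s' / s
    have haw : S.a w ≠ 0 := by
      rw [hw]; simp only [Blocks.comb, S.a_comb]; simpa using ha
    have hbw : S.b w ≠ 0 := by
      rw [hw]; simp only [Blocks.comb, S.b_comb]; simpa using ⟨hs.ne', hb'⟩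
    have haw' : S.a (S.comb 1 r w) ≠ 0 := by
      simp only [Blocks.comb, S.a_comb]; simpa using haw
    have hbw' : S.b (S.comb 1 r w) ≠ 0 := by
      simp only [Blocks.comb, S.b_comb]; simpa using ⟨hr0.ne', hbw⟩
    change past w - fut w ≤ past (S.comb 1 s' z) - fut (S.comb 1 s' z)
    rw [hw']
    refine sub_le_sub ?_ ?_
    · simp only [past]
      rw [S.homeo_symm_comb hA 1 r]
      refine hb.orbitSum_mono (S.homeo_symm_comb hA 1 r) (fun z => rfl) (hb.a_ne _ haw) ?_ ?_
      · rw [← S.homeo_symm_comb hA 1 r]; exact hb.a_ne _ haw'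
      · intro y hy
        simp only [Blocks.comb, S.a_comb, S.b_comb, abs_one, one_mul, abs_of_pos hr0]
        have h1 := (S.a_nonneg y).lt_of_ne' hy
        have h2 := S.b_nonneg y
        rw [div_le_div_iff₀ (by positivity) (by positivity)]
        nlinarith [mul_nonneg h1.le h2]
    · have e : w = S.comb 1 r⁻¹ (S.comb 1 r w) := by
        rw [comb_comb, inv_mul_cancel₀ hr0.ne', one_mul, comb_one]
      conv_rhs => rw [e]
      refine hf.orbitSum_mono (S.map_comb hA 1 r⁻¹) (fun z => rfl) hbw' (by rwa [← e]) ?_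
      intro y hy
      have hr1 : r⁻¹ ≤ 1 := inv_le_one_of_one_le₀ hr
      have hr2 : 0 < r⁻¹ := inv_pos.2 hr0
      simp only [Blocks.comb, S.a_comb, S.b_comb, abs_one, one_mul, abs_of_pos hr2]
      have h1 := (S.b_nonneg y).lt_of_ne' hy
      have h2 := S.a_nonneg y
      rw [div_le_div_iff₀ (by positivity) (by positivity)]
      nlinarith [mul_nonneg h1.le h2]
  have ray_cont : ∀ z, S.a z ≠ 0 → S.b z ≠ 0 →
      ContinuousOn (fun s => past (S.comb 1 s z) - fut (S.comb 1 s z)) (Set.Ioi 0) := by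
    intro z ha hb' s hs
    have hs : 0 < s := hs
    have hcomb : Continuous fun s : ℝ => S.comb 1 s z := by
      refine J.continuous_mk_iff.2 ⟨continuous_const, ?_⟩
      simp only [map_add, map_smul]
      fun_prop
    refine ContinuousAt.continuousWithinAt (ContinuousAt.sub ?_ ?_)
    · refine ContinuousAt.comp (f := fun s : ℝ => S.comb 1 s z) (past_cont _ ?_)
        hcomb.continuousAt
      simp only [Blocks.comb, S.a_comb]; simpa using ha
    · refine ContinuousAt.comp (f := fun s : ℝ => S.comb 1 s z) (fut_cont _ ?_)
        hcomb.continuousAt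
      simp only [Blocks.comb, S.b_comb]; simpa using ⟨hs.ne', hb'⟩
  let H : ∀ x, V x → V x := fun x v =>
    Real.exp (-past ⟨x, v⟩) • S.P x v + Real.exp (-fut ⟨x, v⟩) • S.Q x v
  have hHc : Continuous fun z : TotalSpace F V => (⟨z.proj, H z.proj z.snd⟩ : TotalSpace F V) := by
    refine J.continuous_mk_iff.2 ⟨FiberBundle.continuous_proj F V, ?_⟩
    simp only [H, map_add, map_smul]
    refine Continuous.add ?_ ?_
    · have hcP : Continuous fun z : TotalSpace F V => J.j z.proj (S.P z.proj z.snd) :=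
        J.continuous_j.comp S.continuous_P
      refine continuous_iff_continuousAt.2 fun z => ?_
      -- At a zero of `a` the sum over the past may diverge, so that its value means nothing; but
      -- there the component `S.P` vanishes, and the factor before it is at most one everywhere.
      by_cases hz : S.a z = 0
      · have hz' := S.P_eq_zero z hz
        rw [ContinuousAt, hz', map_zero, smul_zero]
        have h0 := hcP.continuousAt (x := z)
        rw [ContinuousAt, hz', map_zero] at h0
        refine squeeze_zero_norm (fun y => ?_) (tendsto_zero_iff_norm_tendsto_zero.1 h0)
        rw [norm_smul, Real.norm_of_nonneg (Real.exp_pos _).le]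
        exact mul_le_of_le_one_left (norm_nonneg _)
          (Real.exp_le_one_iff.2 (neg_nonpos.2 (past_nonneg _)))
      · exact (Real.continuous_exp.continuousAt.comp (past_cont z hz).neg).smul hcP.continuousAt
    · have hcQ : Continuous fun z : TotalSpace F V => J.j z.proj (S.Q z.proj z.snd) :=
        J.continuous_j.comp S.continuous_Q
      refine continuous_iff_continuousAt.2 fun z => ?_
      by_cases hz : S.b z = 0
      · have hz' := S.Q_eq_zero z hz
        rw [ContinuousAt, hz', map_zero, smul_zero]
        have h0 := hcQ.continuousAt (x := z)
        rw [ContinuousAt, hz', map_zero] at h0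
        refine squeeze_zero_norm (fun y => ?_) (tendsto_zero_iff_norm_tendsto_zero.1 h0)
        rw [norm_smul, Real.norm_of_nonneg (Real.exp_pos _).le]
        exact mul_le_of_le_one_left (norm_nonneg _)
          (Real.exp_le_one_iff.2 (neg_nonpos.2 (fut_nonneg _)))
      · exact (Real.continuous_exp.continuousAt.comp (fut_cont z hz).neg).smul hcQ.continuousAt
  have hHs : ∀ x (c : ℝ) v, c ≠ 0 → H x (c • v) = c • H x v := by
    intro x c v hc
    have e : (⟨x, c • v⟩ : TotalSpace F V) = S.comb c c ⟨x, v⟩ := by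
      simp only [Blocks.comb, ← smul_add, S.add]
    simp only [H]
    rw [e, (scale_hom c hc _).1, (scale_hom c hc _).2, map_smul, map_smul, smul_add,
      smul_comm c, smul_comm c]
  have hPH : ∀ x v, S.P x (H x v) = Real.exp (-past ⟨x, v⟩) • S.P x v := fun x v => S.P_comb _ _ _ _
  have hQH : ∀ x v, S.Q x (H x v) = Real.exp (-fut ⟨x, v⟩) • S.Q x v := fun x v => S.Q_comb _ _ _ _
  have hext : ∀ x (v w : V x), S.P x v = S.P x w → S.Q x v = S.Q x w → v = w := fun x v w h1 h2 => by
    rw [← S.add x v, h1, h2, S.add]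
  have fut_zero : ∀ z, S.a z = 0 → S.b z ≠ 0 → fut z = 0 := fun z h h' => by
    have h1 := fut_mul z
    rw [h, mul_zero] at h1
    have h2 := (S.b_nonneg z).lt_of_ne' h'
    exact le_antisymm (nonpos_of_mul_nonpos_left h1 h2) (fut_nonneg z)
  have past_zero : ∀ z, S.b z = 0 → S.a z ≠ 0 → past z = 0 := fun z h h' => by
    have h1 := past_mul z
    rw [h, mul_zero] at h1
    have h2 := (S.a_nonneg z).lt_of_ne' h'
    exact le_antisymm (nonpos_of_mul_nonpos_left h1 h2) (past_nonneg z)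
  have hH_a : ∀ x v, S.a ⟨x, v⟩ = 0 → H x v = v := fun x v h => by
    have hp : S.P x v = 0 := S.P_eq_zero _ h
    refine hext x _ _ ?_ ?_
    · rw [hPH, hp, smul_zero]
    · rw [hQH]
      by_cases hb' : S.b ⟨x, v⟩ = 0
      · have hq : S.Q x v = 0 := S.Q_eq_zero _ hb'
        rw [hq, smul_zero]
      · rw [fut_zero _ h hb']; simp
  have hH_b : ∀ x v, S.b ⟨x, v⟩ = 0 → H x v = v := fun x v h => by
    have hq : S.Q x v = 0 := S.Q_eq_zero _ h
    refine hext x _ _ ?_ ?_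
    · rw [hPH]
      by_cases ha' : S.a ⟨x, v⟩ = 0
      · have hp : S.P x v = 0 := S.P_eq_zero _ ha'
        rw [hp, smul_zero]
      · rw [past_zero _ h ha']; simp
    · rw [hQH, hq, smul_zero]
  have aH : ∀ x v, S.a ⟨x, H x v⟩ = Real.exp (-past ⟨x, v⟩) * S.a ⟨x, v⟩ := fun x v => by
    simp only [H, S.a_comb, abs_of_pos (Real.exp_pos _)]
  have bH : ∀ x v, S.b ⟨x, H x v⟩ = Real.exp (-fut ⟨x, v⟩) * S.b ⟨x, v⟩ := fun x v => by
    simp only [H, S.b_comb, abs_of_pos (Real.exp_pos _)]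
  -- `H` maps a quadrant spanned by the two components of a vector to itself, and moves the ratio of
  -- the components by a strictly increasing function.
  have hinj : ∀ x, Function.Injective (H x) := by
    intro x v v' h
    have ha : S.a ⟨x, v⟩ = 0 ↔ S.a ⟨x, v'⟩ = 0 := by
      have := aH x v
      rw [h, aH] at this
      constructor
      · intro h0
        rw [h0, mul_zero] at this
        exact (mul_eq_zero.1 this).resolve_left (Real.exp_pos _).ne'
      · intro h0
        rw [h0, mul_zero] at this
        exact (mul_eq_zero.1 this.symm).resolve_left (Real.exp_pos _).ne'
    have hb' : S.b ⟨x, v⟩ = 0 ↔ S.b ⟨x, v'⟩ = 0 := by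
      have := bH x v
      rw [h, bH] at this
      constructor
      · intro h0
        rw [h0, mul_zero] at this
        exact (mul_eq_zero.1 this).resolve_left (Real.exp_pos _).ne'
      · intro h0
        rw [h0, mul_zero] at this
        exact (mul_eq_zero.1 this.symm).resolve_left (Real.exp_pos _).ne'
    by_cases hav : S.a ⟨x, v⟩ = 0
    · rwa [hH_a x v hav, hH_a x v' (ha.1 hav)] at h
    by_cases hbv : S.b ⟨x, v⟩ = 0
    · rwa [hH_b x v hbv, hH_b x v' (hb'.1 hbv)] at h
    -- `v'` is obtained from `v` by scaling the two blocks
    set p := Real.exp (past ⟨x, v'⟩ - past ⟨x, v⟩) with hp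
    set q := Real.exp (fut ⟨x, v'⟩ - fut ⟨x, v⟩) with hq
    have hp0 : 0 < p := Real.exp_pos _
    have hq0 : 0 < q := Real.exp_pos _
    have hv' : v' = p • S.P x v + q • S.Q x v := by
      refine hext x _ _ ?_ ?_
      · have h1 := congrArg (S.P x) h
        rw [hPH, hPH] at h1
        rw [S.P_comb, hp, sub_eq_add_neg, Real.exp_add, mul_smul, h1, smul_smul, ← Real.exp_add]
        simp
      · have h1 := congrArg (S.Q x) h
        rw [hQH, hQH] at h1
        rw [S.Q_comb, hq, sub_eq_add_neg, Real.exp_add, mul_smul, h1, smul_smul, ← Real.exp_add]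
        simp
    have hz' : (⟨x, v'⟩ : TotalSpace F V) = S.comb p p (S.comb 1 (q / p) ⟨x, v⟩) := by
      rw [comb_comb, mul_div_cancel₀ _ hp0.ne', mul_one, hv']
      rfl
    have hs : q / p = 1 := by
      refine eq_one_of_mul_exp_eq (mono ⟨x, v⟩ hav hbv) (div_pos hq0 hp0) ?_
      have e1 := (scale_hom p hp0.ne' (S.comb 1 (q / p) ⟨x, v⟩)).1
      have e2 := (scale_hom p hp0.ne' (S.comb 1 (q / p) ⟨x, v⟩)).2
      rw [← hz'] at e1 e2
      rw [← e1, ← e2, comb_one, hp, hq, ← Real.exp_sub, ← Real.exp_add]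
      congr 1
      ring
    have hpq : q = p := by
      field_simp at hs
      exact hs
    have hp1 : p = 1 := by
      have e1 := (scale_hom p hp0.ne' ⟨x, v⟩).1
      rw [hz', hs, comb_one, e1] at hp
      simpa using hp
    rw [hv', hpq, hp1, one_smul, one_smul, S.add]
  have hsurj : ∀ x, Function.Surjective (H x) := by
    intro x w
    by_cases haw : S.a ⟨x, w⟩ = 0
    · exact ⟨w, hH_a x w haw⟩
    by_cases hbw : S.b ⟨x, w⟩ = 0
    · exact ⟨w, hH_b x w hbw⟩
    obtain ⟨s, hs, hs'⟩ := exists_mul_exp_eq_one (ray_cont ⟨x, w⟩ haw hbw) (mono ⟨x, w⟩ haw hbw)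
    set u : V x := (1 : ℝ) • S.P x w + s • S.Q x w with hu
    have hcu : S.comb 1 s ⟨x, w⟩ = ⟨x, u⟩ := rfl
    rw [hcu] at hs'
    refine ⟨Real.exp (past ⟨x, u⟩) • u, ?_⟩
    rw [hHs _ _ _ (Real.exp_pos _).ne']
    refine hext x _ _ ?_ ?_
    · rw [map_smul, hPH, smul_smul, ← Real.exp_add, hu, S.P_comb]
      simp
    · have hQu : S.Q x u = s • S.Q x w := S.Q_comb _ _ _ _
      rw [map_smul, hQH, smul_smul, ← Real.exp_add, hQu, smul_smul, ← sub_eq_add_neg, mul_comm,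
        hs', one_smul]
  refine Cocycle.ProjConj.of_homogeneous hε H (hHc.comp continuous_subtype_val) hHs
    (fun x => by simp [H]) (fun x => ⟨hinj x, hsurj x⟩) ?_ ?_
  · intro x v hv
    set z : TotalSpace F V := ⟨x, v⟩ with hz
    set χ := S.a z / (S.b z + S.a z) with hχ
    set χ' := S.b z / (S.a z + S.b z) with hχ'
    have hAz : A.map z = ⟨T x, A.fib x v⟩ := rfl
    have hsymm : A.homeo.symm (A.map z) = z := A.homeo.symm_apply_apply z
    have hpast : S.a z ≠ 0 → past (A.map z) = θ x * χ' + past z := fun h => by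
      have := hb.orbitSum_eq_add h
      simp only [past]
      rw [hsymm, this]
    have hfut : S.b z ≠ 0 → fut z = θ x * χ + fut (A.map z) := fun h => hf.orbitSum_eq_add h
    have hsum : S.a z ≠ 0 ∨ S.b z ≠ 0 := by
      by_contra! h0
      apply hv
      rw [← S.add x v, S.P_eq_zero z h0.1, S.Q_eq_zero z h0.2, add_zero]
    have hχχ : χ + χ' = 1 := by
      have h1 := S.a_nonneg z
      have h2 := S.b_nonneg z
      have : S.a z + S.b z ≠ 0 := by
        rcases hsum with h | h
        · exact (add_pos_of_pos_of_nonneg (h1.lt_of_ne' h) h2).ne'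
        · exact (add_pos_of_nonneg_of_pos h1 (h2.lt_of_ne' h)).ne'
      rw [hχ, hχ', add_comm (S.b z), ← add_div, div_self this]
    refine ⟨Real.exp (-(θ x * χ')), hext _ _ _ ?_ ?_⟩
    · rw [hPH, map_smul, hA', ← hA, map_add, map_smul, ← hA, ← hA, hPH, hQH]
      simp only [map_smul, S.P_P, S.P_Q, map_zero, smul_zero, add_zero]
      rw [smul_smul, ← Real.exp_add, ← hAz]
      by_cases ha : S.a z = 0
      · have hp0 : S.P x v = 0 := S.P_eq_zero z ha
        rw [hp0]; simp
      · rw [hpast ha]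
        congr 2
        ring
    · rw [hQH, map_smul, hA', ← S.map_Q hA, map_add, map_smul, ← S.map_Q hA, ← S.map_Q hA, hPH, hQH]
      simp only [map_smul, S.Q_Q, S.Q_P, map_zero, smul_zero, zero_add]
      rw [smul_smul, smul_smul, ← Real.exp_add, ← Real.exp_add, ← hAz]
      by_cases hb' : S.b z = 0
      · have hp0 : S.Q x v = 0 := S.Q_eq_zero z hb'
        rw [hp0]; simp
      · have h1 := hfut hb'
        congr 2
        rw [← hz, h1]
        have : χ = 1 - χ' := by linarith
        rw [this]
        ring
  · intro x v
    have e : H x v - v = (Real.exp (-past ⟨x, v⟩) - 1) • S.P x v +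
        (Real.exp (-fut ⟨x, v⟩) - 1) • S.Q x v := by
      simp only [H, sub_smul, one_smul]
      nth_rewrite 5 [← S.add x v]
      abel
    have hexp : ∀ r : ℝ, 0 ≤ r → ‖Real.exp (-r) - 1‖ ≤ r := fun r hr => by
      rw [Real.norm_eq_abs, abs_sub_comm, abs_of_nonneg (sub_nonneg.2 (Real.exp_le_one_iff.2
        (neg_nonpos.2 hr)))]
      linarith [Real.add_one_le_exp (-r)]
    set z : TotalSpace F V := ⟨x, v⟩ with hz
    have h1 : ‖S.P x v‖ ≤ C * S.a z := hP z
    have h2 : ‖S.Q x v‖ ≤ C * S.b z := hQ z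
    have h3 : S.a z + S.b z ≤ C * ‖v‖ := hab z
    rw [e]
    calc _ ≤ past z * (C * S.a z) + fut z * (C * S.b z) := by
          refine (norm_add_le _ _).trans (add_le_add ?_ ?_)
          · rw [norm_smul]
            exact mul_le_mul (hexp _ (past_nonneg z)) h1 (norm_nonneg _) (past_nonneg z)
          · rw [norm_smul]
            exact mul_le_mul (hexp _ (fut_nonneg z)) h2 (norm_nonneg _) (fut_nonneg z)
      _ = C * (past z * S.a z + fut z * S.b z) := by ring
      _ ≤ C * (δ / (1 - κ) * S.b z + δ / (1 - κ) * S.a z) :=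
          mul_le_mul_of_nonneg_left (add_le_add (past_mul z) (fut_mul z)) hC0
      _ = C * (δ / (1 - κ)) * (S.a z + S.b z) := by ring
      _ ≤ C * (δ / (1 - κ)) * (C * ‖v‖) := mul_le_mul_of_nonneg_left h3 (mul_nonneg hC0 hK)
      _ = _ := by ring

end Blocks

/-! ### Rescaling a cocycle along a splitting into line bundles -/

section Lines

variable {X : Type*} [MetricSpace X]
  {F : Type*} [NormedAddCommGroup F] [NormedSpace ℝ F]
  {V : X → Type*} [TopologicalSpace (TotalSpace F V)]
  [∀ x, NormedAddCommGroup (V x)] [∀ x, InnerProductSpace ℝ (V x)]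

namespace Cocycle

variable {T : X ≃ₜ X}

theorem ext_fib {A B : Cocycle F V T} (h : ∀ x v, A.fib x v = B.fib x v) : A = B := by
  obtain ⟨f, hf⟩ := A
  obtain ⟨g, hg⟩ := B
  have : f = g := funext fun x => LinearEquiv.ext (h x)
  subst this
  rfl

/-- The composition of a cocycle with a bundle automorphism over the identity, on the right. -/
def precomp (A : Cocycle F V T) (R : ∀ x, V x ≃ₗ[ℝ] V x)
    (hR : Continuous fun z : TotalSpace F V => (⟨z.proj, R z.proj z.snd⟩ : TotalSpace F V)) :
    Cocycle F V T where
  fib x := (R x).trans (A.fib x)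
  continuous_fib := A.continuous_fib.comp hR

end Cocycle

variable (F V) in
/-- A splitting of the bundle into `d` continuous line bundles, given by the projections. -/
structure LineSplitting (d : ℕ) where
  /-- The projection onto the `i`-th line bundle. -/
  pr : Fin d → ∀ x, V x →L[ℝ] V x
  pr_pr_self : ∀ i x v, pr i x (pr i x v) = pr i x v
  pr_pr_ne : ∀ i j, i ≠ j → ∀ x v, pr i x (pr j x v) = 0
  sum_pr : ∀ x v, ∑ i, pr i x v = v
  exists_ne : ∀ i x, ∃ v, pr i x v ≠ 0
  rank_one : ∀ i x v w, pr i x w ≠ 0 → ∃ c : ℝ, pr i x v = c • pr i x w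
  continuous_pr : ∀ i, Continuous fun z : TotalSpace F V =>
    (⟨z.proj, pr i z.proj z.snd⟩ : TotalSpace F V)

namespace LineSplitting

variable {d : ℕ} (S : LineSplitting F V d)

theorem pr_pr (i j : Fin d) (x : X) (v : V x) :
    S.pr i x (S.pr j x v) = if i = j then S.pr j x v else 0 := by
  split_ifs with h
  · subst h; exact S.pr_pr_self i x v
  · exact S.pr_pr_ne i j h x v

theorem pr_sum_smul (i : Fin d) (x : X) (c : Fin d → ℝ) (v : V x) :
    S.pr i x (∑ j, c j • S.pr j x v) = c i • S.pr i x v := by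
  simp [map_sum, S.pr_pr]

theorem ext_pr {x : X} {v w : V x} (h : ∀ i, S.pr i x v = S.pr i x w) : v = w := by
  rw [← S.sum_pr x v, ← S.sum_pr x w]
  exact Finset.sum_congr rfl fun i _ => h i

/-- The linear automorphism of a fiber which multiplies the `i`-th line by `exp (γ i x)`. -/
def diag (γ : Fin d → X → ℝ) (x : X) : V x ≃ₗ[ℝ] V x :=
  LinearEquiv.ofLinearMap (∑ i, Real.exp (γ i x) • (S.pr i x).toLinearMap)
    (∑ i, Real.exp (-γ i x) • (S.pr i x).toLinearMap)
    (by
      refine LinearMap.ext fun v => S.ext_pr fun i => ?_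
      simp only [LinearMap.comp_apply, LinearMap.sum_apply, LinearMap.smul_apply,
        ContinuousLinearMap.coe_coe, LinearMap.id_apply]
      rw [S.pr_sum_smul i x (fun i => Real.exp (γ i x)),
        S.pr_sum_smul i x (fun i => Real.exp (-γ i x)), smul_smul, ← Real.exp_add]
      simp)
    (by
      refine LinearMap.ext fun v => S.ext_pr fun i => ?_
      simp only [LinearMap.comp_apply, LinearMap.sum_apply, LinearMap.smul_apply,
        ContinuousLinearMap.coe_coe, LinearMap.id_apply]
      rw [S.pr_sum_smul i x (fun i => Real.exp (-γ i x)),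
        S.pr_sum_smul i x (fun i => Real.exp (γ i x)), smul_smul, ← Real.exp_add]
      simp)

theorem diag_apply (γ : Fin d → X → ℝ) (x : X) (v : V x) :
    S.diag γ x v = ∑ i, Real.exp (γ i x) • S.pr i x v := by
  simp [diag]

theorem pr_diag (γ : Fin d → X → ℝ) (i : Fin d) (x : X) (v : V x) :
    S.pr i x (S.diag γ x v) = Real.exp (γ i x) • S.pr i x v := by
  rw [diag_apply, S.pr_sum_smul i x (fun i => Real.exp (γ i x))]

variable [FiberBundle F V] [VectorBundle ℝ F V]

theorem continuous_diag {γ : Fin d → X → ℝ} (hγ : ∀ i, Continuous (γ i)) :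
    Continuous fun z : TotalSpace F V => (⟨z.proj, S.diag γ z.proj z.snd⟩ : TotalSpace F V) := by
  simp only [diag_apply]
  refine continuous_mk_sum (FiberBundle.continuous_proj F V) _ fun i _ =>
    continuous_mk_smul (S.continuous_pr i) ?_
  exact Real.continuous_exp.comp ((hγ i).comp (FiberBundle.continuous_proj F V))

variable {T : X ≃ₜ X}

/-- The cocycle obtained from `A` by multiplying it by `exp (γ i x)` on the `i`-th line. -/
def scale (A : Cocycle F V T) {γ : Fin d → X → ℝ} (hγ : ∀ i, Continuous (γ i)) : Cocycle F V T :=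
  A.precomp (S.diag γ) (S.continuous_diag hγ)

theorem scale_fib (A : Cocycle F V T) {γ : Fin d → X → ℝ} (hγ : ∀ i, Continuous (γ i)) (x : X)
    (v : V x) : (S.scale A hγ).fib x v = A.fib x (S.diag γ x v) := rfl

/-- Weights `w` for the lengths of vectors in the lines of an invariant splitting, such that
the cocycle multiplies the weighted lengths by `exp (α i x)`, with `α j - α i ≥ c` for `i < j`. -/
structure Adapted (A : Cocycle F V T) (w α : Fin d → X → ℝ) (c : ℝ) : Prop where
  commute : ∀ i x v, A.fib x (S.pr i x v) = S.pr i (T x) (A.fib x v)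
  w_pos : ∀ i x, 0 < w i x
  continuous_w : ∀ i, Continuous (w i)
  length : ∀ i x v,
    w i (T x) * ‖S.pr i (T x) (A.fib x v)‖ = Real.exp (α i x) * (w i x * ‖S.pr i x v‖)
  gap : ∀ i j, i < j → ∀ x, α i x + c ≤ α j x

theorem Adapted.scale {A : Cocycle F V T} {w α : Fin d → X → ℝ} {c : ℝ} (h : S.Adapted A w α c)
    {γ : Fin d → X → ℝ} (hγ : ∀ i, Continuous (γ i)) {c' : ℝ}
    (hc : ∀ i j, i < j → ∀ x, α i x + γ i x + c' ≤ α j x + γ j x) :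
    S.Adapted (S.scale A hγ) w (fun i x => α i x + γ i x) c' where
  commute i x v := by
    rw [scale_fib, scale_fib, ← h.commute, S.pr_diag, diag_apply]
    congr 1
    rw [Finset.sum_eq_single i]
    · rw [S.pr_pr_self]
    · intro j _ hj
      rw [S.pr_pr_ne j i hj, smul_zero]
    · simp
  w_pos := h.w_pos
  continuous_w := h.continuous_w
  length i x v := by
    rw [scale_fib, h.length, S.pr_diag, norm_smul, Real.norm_of_nonneg (Real.exp_pos _).le,
      Real.exp_add]
    ring
  gap := hc

variable [IsContinuousRiemannianBundle F V]

theorem continuous_norm_pr (i : Fin d) :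
    Continuous fun z : TotalSpace F V => ‖S.pr i z.proj z.snd‖ :=
  continuous_norm_mk (S.continuous_pr i)

/-- The two blocks formed by the lines of index less than `k` and at least `k`. -/
def blocks {w : Fin d → X → ℝ} (hw : ∀ i, Continuous (w i)) (hw0 : ∀ i x, 0 < w i x) (k : ℕ) :
    Blocks F V where
  P x := ∑ i with i.val < k, S.pr i x
  Q x := ∑ i with ¬ i.val < k, S.pr i x
  a z := ∑ i with i.val < k, w i z.proj * ‖S.pr i z.proj z.snd‖
  b z := ∑ i with ¬ i.val < k, w i z.proj * ‖S.pr i z.proj z.snd‖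
  add x v := by
    simp only [sum_apply]
    rw [Finset.sum_filter_add_sum_filter_not, S.sum_pr]
  P_Q x v := by
    simp only [sum_apply, map_sum]
    refine Finset.sum_eq_zero fun i hi => Finset.sum_eq_zero fun j hj => S.pr_pr_ne _ _ ?_ _ _
    rintro rfl
    exact (Finset.mem_filter.1 hi).2 (Finset.mem_filter.1 hj).2
  Q_P x v := by
    simp only [sum_apply, map_sum]
    refine Finset.sum_eq_zero fun i hi => Finset.sum_eq_zero fun j hj => S.pr_pr_ne _ _ ?_ _ _
    rintro rfl
    exact (Finset.mem_filter.1 hj).2 (Finset.mem_filter.1 hi).2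
  continuous_P := by
    simp only [sum_apply]
    exact continuous_mk_sum (FiberBundle.continuous_proj F V) _ fun i _ => S.continuous_pr i
  continuous_Q := by
    simp only [sum_apply]
    exact continuous_mk_sum (FiberBundle.continuous_proj F V) _ fun i _ => S.continuous_pr i
  continuous_a := continuous_finsetSum _ fun i _ =>
    ((hw i).comp (FiberBundle.continuous_proj F V)).mul (S.continuous_norm_pr i)
  continuous_b := continuous_finsetSum _ fun i _ =>
    ((hw i).comp (FiberBundle.continuous_proj F V)).mul (S.continuous_norm_pr i)
  a_nonneg z := Finset.sum_nonneg fun i _ => mul_nonneg (hw0 i _).le (norm_nonneg _)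
  b_nonneg z := Finset.sum_nonneg fun i _ => mul_nonneg (hw0 i _).le (norm_nonneg _)
  a_comb x v p q := by
    rw [Finset.mul_sum]
    refine Finset.sum_congr rfl fun i hi => ?_
    have h : S.pr i x (p • (∑ i with i.val < k, S.pr i x) v +
        q • (∑ i with ¬ i.val < k, S.pr i x) v) = p • S.pr i x v := by
      have hi' := (Finset.mem_filter.1 hi).2
      simp only [sum_apply, map_add, map_smul, map_sum, S.pr_pr]
      simp [hi']
    change w i x * ‖S.pr i x _‖ = _
    rw [h, norm_smul, Real.norm_eq_abs]
    ring
  b_comb x v p q := by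
    rw [Finset.mul_sum]
    refine Finset.sum_congr rfl fun i hi => ?_
    have h : S.pr i x (p • (∑ i with i.val < k, S.pr i x) v +
        q • (∑ i with ¬ i.val < k, S.pr i x) v) = q • S.pr i x v := by
      have hi' := (Finset.mem_filter.1 hi).2
      simp only [sum_apply, map_add, map_smul, map_sum, S.pr_pr]
      have hi'' : k ≤ i.val := not_lt.1 hi'
      simp [hi'']
    change w i x * ‖S.pr i x _‖ = _
    rw [h, norm_smul, Real.norm_eq_abs]
    ring
  P_eq_zero z hz := by
    rw [sum_apply]
    refine Finset.sum_eq_zero fun i hi => ?_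
    have := (Finset.sum_eq_zero_iff_of_nonneg
      (fun i _ => mul_nonneg (hw0 i _).le (norm_nonneg _))).1 hz i hi
    exact norm_eq_zero.1 ((mul_eq_zero.1 this).resolve_left (hw0 i _).ne')
  Q_eq_zero z hz := by
    rw [sum_apply]
    refine Finset.sum_eq_zero fun i hi => ?_
    have := (Finset.sum_eq_zero_iff_of_nonneg
      (fun i _ => mul_nonneg (hw0 i _).le (norm_nonneg _))).1 hz i hi
    exact norm_eq_zero.1 ((mul_eq_zero.1 this).resolve_left (hw0 i _).ne')

variable {S} in
theorem Adapted.blocks_dominated {A : Cocycle F V T} {w α : Fin d → X → ℝ} {c : ℝ}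
    (h : S.Adapted A w α c) (k : ℕ) (z : TotalSpace F V) :
    let B := S.blocks h.continuous_w h.w_pos k
    B.a (A.map z) * B.b z ≤ Real.exp (-c) * B.a z * B.b (A.map z) := by
  obtain ⟨x, v⟩ := z
  change (∑ i with i.val < k, w i (T x) * ‖S.pr i (T x) (A.fib x v)‖) *
      (∑ j with ¬ j.val < k, w j x * ‖S.pr j x v‖) ≤
    Real.exp (-c) * (∑ i with i.val < k, w i x * ‖S.pr i x v‖) *
      (∑ j with ¬ j.val < k, w j (T x) * ‖S.pr j (T x) (A.fib x v)‖)
  simp only [h.length]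
  rw [Finset.sum_mul_sum, mul_assoc, Finset.sum_mul_sum, Finset.mul_sum]
  refine Finset.sum_le_sum fun i hi => ?_
  rw [Finset.mul_sum]
  refine Finset.sum_le_sum fun j hj => ?_
  have hij : i < j := (Finset.mem_filter.1 hi).2.trans_le (not_lt.1 (Finset.mem_filter.1 hj).2)
  have h1 : 0 ≤ w i x * ‖S.pr i x v‖ := mul_nonneg (h.w_pos i x).le (norm_nonneg _)
  have h2 : 0 ≤ w j x * ‖S.pr j x v‖ := mul_nonneg (h.w_pos j x).le (norm_nonneg _)
  have h3 : Real.exp (α i x) ≤ Real.exp (-c) * Real.exp (α j x) := by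
    rw [← Real.exp_add, Real.exp_le_exp]
    linarith [h.gap i j hij x]
  calc _ = Real.exp (α i x) * ((w i x * ‖S.pr i x v‖) * (w j x * ‖S.pr j x v‖)) := by ring
    _ ≤ (Real.exp (-c) * Real.exp (α j x)) * ((w i x * ‖S.pr i x v‖) * (w j x * ‖S.pr j x v‖)) :=
      mul_le_mul_of_nonneg_right h3 (mul_nonneg h1 h2)
    _ = _ := by ring

variable [FiniteDimensional ℝ F] [CompactSpace X]

theorem exists_norm_pr_le : ∃ C > 0, ∀ i x v, ‖S.pr i x v‖ ≤ C * ‖v‖ := by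
  choose c hc hpr using fun i => exists_norm_bundleMap_le continuous_id (S.continuous_pr i)
  refine ⟨∑ i, c i + 1, add_pos_of_nonneg_of_pos (Finset.sum_nonneg fun i _ => (hc i).le) one_pos,
    fun i x v => (hpr i x v).trans (mul_le_mul_of_nonneg_right ?_ (norm_nonneg v))⟩
  linarith [Finset.single_le_sum (f := c) (fun i _ => (hc i).le) (Finset.mem_univ i)]

/-- Uniform comparison between the weighted lengths and the norm. -/
theorem exists_blocks_bound {w : Fin d → X → ℝ} (hw : ∀ i, Continuous (w i))
    (hw0 : ∀ i x, 0 < w i x) : ∃ C > 0, ∀ k : ℕ, ∀ z,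
      ‖(S.blocks hw hw0 k).P z.proj z.snd‖ ≤ C * (S.blocks hw hw0 k).a z ∧
      ‖(S.blocks hw hw0 k).Q z.proj z.snd‖ ≤ C * (S.blocks hw hw0 k).b z ∧
      (S.blocks hw hw0 k).a z + (S.blocks hw hw0 k).b z ≤ C * ‖z.snd‖ := by
  obtain ⟨C₀, hC₀, hpr⟩ := S.exists_norm_pr_le
  have h1 : ∀ i, ∃ M, ∀ x, w i x ≤ M := fun i => by
    obtain ⟨M, hM⟩ := isCompact_univ.bddAbove_image (hw i).continuousOn
    exact ⟨M, fun x => hM ⟨x, trivial, rfl⟩⟩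
  have h2 : ∀ i, ∃ M, ∀ x, (w i x)⁻¹ ≤ M := fun i => by
    obtain ⟨M, hM⟩ := isCompact_univ.bddAbove_image
      ((hw i).inv₀ fun x => (hw0 i x).ne').continuousOn
    exact ⟨M, fun x => hM ⟨x, trivial, rfl⟩⟩
  choose M hM using h1
  choose N hN using h2
  have hN' : ∀ i x, (w i x)⁻¹ ≤ ∑ i, |N i| := fun i x =>
    (hN i x).trans ((le_abs_self _).trans (Finset.single_le_sum (f := fun i => |N i|)
      (fun i _ => abs_nonneg _) (Finset.mem_univ i)))
  have hM0 : 0 ≤ ∑ i, |M i| := Finset.sum_nonneg fun i _ => abs_nonneg _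
  have hN0 : 0 ≤ ∑ i, |N i| := Finset.sum_nonneg fun i _ => abs_nonneg _
  have key : ∀ (s : Finset (Fin d)) x (v : V x),
      ‖(∑ i ∈ s, S.pr i x) v‖ ≤ (∑ i, |N i|) * ∑ i ∈ s, w i x * ‖S.pr i x v‖ := fun s x v => by
    rw [sum_apply, Finset.mul_sum]
    refine (norm_sum_le _ _).trans (Finset.sum_le_sum fun i _ => ?_)
    rw [← mul_assoc]
    refine le_mul_of_one_le_left (norm_nonneg _) ?_
    calc (1 : ℝ) = (w i x)⁻¹ * w i x := (inv_mul_cancel₀ (hw0 i x).ne').symm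
      _ ≤ _ := mul_le_mul_of_nonneg_right (hN' i x) (hw0 i x).le
  have hS : ∀ x (v : V x), ∑ i, w i x * ‖S.pr i x v‖ ≤ (∑ i, |M i|) * C₀ * ‖v‖ := fun x v => by
    rw [mul_assoc, Finset.sum_mul]
    refine Finset.sum_le_sum fun i _ => ?_
    exact mul_le_mul ((hM i x).trans (le_abs_self _)) (hpr i x v) (norm_nonneg _) (abs_nonneg _)
  refine ⟨∑ i, |N i| + (∑ i, |M i|) * C₀ + 1, by positivity, fun k z => ⟨?_, ?_, ?_⟩⟩
  · refine (key _ z.proj z.snd).trans (mul_le_mul_of_nonneg_right ?_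
      ((S.blocks hw hw0 k).a_nonneg z))
    have : 0 ≤ (∑ i, |M i|) * C₀ := by positivity
    linarith
  · refine (key _ z.proj z.snd).trans (mul_le_mul_of_nonneg_right ?_
      ((S.blocks hw hw0 k).b_nonneg z))
    have : 0 ≤ (∑ i, |M i|) * C₀ := by positivity
    linarith
  · have e : (S.blocks hw hw0 k).a z + (S.blocks hw hw0 k).b z =
        ∑ i, w i z.proj * ‖S.pr i z.proj z.snd‖ :=
      Finset.sum_filter_add_sum_filter_not Finset.univ (fun i : Fin d => i.val < k)
        fun i => w i z.proj * ‖S.pr i z.proj z.snd‖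
    rw [e]
    refine (hS z.proj z.snd).trans (mul_le_mul_of_nonneg_right ?_ (norm_nonneg _))
    linarith

theorem _root_.CocycleStability.Cocycle.ProjConj.refl (A : Cocycle F V T) {ε : ℝ} (hε : 0 < ε) :
    Cocycle.ProjConj ε A A :=
  Cocycle.ProjConj.of_homogeneous hε (fun _ v => v) continuous_subtype_val (fun _ _ _ _ => rfl)
    (fun _ => rfl) (fun _ => Function.bijective_id) (fun x v _ => ⟨1, (one_smul _ _).symm⟩)
    (fun x v => by simp)

variable {S} in
/-- Adding nonnegative functions to the exponents of the tails `i ≥ k`, one `k` after the other,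
gives conjugate projective cocycles. -/
theorem Adapted.projConj_tails {A : Cocycle F V T} {w α : Fin d → X → ℝ} {c : ℝ} (hc : 0 < c)
    (h : S.Adapted A w α c) {C : ℝ} (hC : 0 < C)
    (hbound : ∀ k : ℕ, ∀ z,
      ‖(S.blocks h.continuous_w h.w_pos k).P z.proj z.snd‖ ≤
        C * (S.blocks h.continuous_w h.w_pos k).a z ∧
      ‖(S.blocks h.continuous_w h.w_pos k).Q z.proj z.snd‖ ≤
        C * (S.blocks h.continuous_w h.w_pos k).b z ∧
      (S.blocks h.continuous_w h.w_pos k).a z + (S.blocks h.continuous_w h.w_pos k).b z ≤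
        C * ‖z.snd‖)
    {θ : ℕ → X → ℝ} (hθ : ∀ k, Continuous (θ k)) {δ ε : ℝ} (hδ : 0 ≤ δ) (hε : 0 < ε)
    (hθ0 : ∀ k x, 0 ≤ θ k x) (hθδ : ∀ k x, θ k x ≤ δ)
    (hε' : C * (δ / (1 - Real.exp (-c))) * C < ε) (m : ℕ)
    (hγ : ∀ i : Fin d, Continuous fun x => ∑ k ∈ Finset.range m, if k ≤ i.val then θ k x else 0) :
    Cocycle.ProjConj ((m + 1 : ℕ) * ε) A (S.scale A hγ) := by
  induction m with
  | zero =>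
    have : S.scale A hγ = A := Cocycle.ext_fib fun x v => by
      rw [scale_fib, diag_apply]
      simp [S.sum_pr]
    rw [this]
    exact Cocycle.ProjConj.refl A (by simpa using hε)
  | succ m ih =>
    have hγ' : ∀ i : Fin d,
        Continuous fun x => ∑ k ∈ Finset.range m, if k ≤ i.val then θ k x else 0 :=
      fun i => continuous_finsetSum _ fun k _ => by
        split_ifs
        · exact hθ k
        · exact continuous_const
    have h1 := ih hγ'
    have had := h.scale S hγ' (c' := c) (fun i j hij x => by
      have h2 : ∑ k ∈ Finset.range m, (if k ≤ i.val then θ k x else 0) ≤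
          ∑ k ∈ Finset.range m, if k ≤ j.val then θ k x else 0 := by
        refine Finset.sum_le_sum fun k _ => ?_
        have hij' : i.val < j.val := hij
        split_ifs with h3 h4
        · exact le_rfl
        · omega
        · exact hθ0 k x
        · exact le_rfl
      linarith [h.gap i j hij x])
    have h2 : Cocycle.ProjConj ε (S.scale A hγ') (S.scale A hγ) := by
      refine Cocycle.ProjConj.of_blocks (S.blocks h.continuous_w h.w_pos m) (θ := θ m) (δ := δ)
        (κ := Real.exp (-c)) (C := C) ?_ ?_ (hθ m) (hθ0 m) (hθδ m) (Real.exp_pos _).le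
        (Real.exp_lt_one_iff.2 (neg_lt_zero.2 hc)) (had.blocks_dominated m) hδ hC.le
        (fun z => (hbound m z).1) (fun z => (hbound m z).2.1) (fun z => (hbound m z).2.2) hε'
      · intro x v
        simp only [blocks, sum_apply, map_sum, had.commute]
      · intro x v
        simp only [scale_fib]
        rw [← map_smul, ← map_add]
        congr 1
        refine S.ext_pr fun i => ?_
        rw [← map_smul, ← map_add, S.pr_diag, S.pr_diag, Finset.sum_range_succ, Real.exp_add,
          mul_smul]
        congr 1
        simp only [blocks, sum_apply, map_add, map_smul, map_sum, S.pr_pr]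
        by_cases hi : m ≤ i.val
        · have hi' : ¬ i.val < m := not_lt.2 hi
          simp [hi]
        · have hi' : i.val < m := not_le.1 hi
          simp [hi, hi']
    refine (h1.trans h2).mono (le_of_eq ?_)
    push_cast
    ring

variable {S} in
/-- Small rescalings of the lines of an adapted splitting do not change the projective cocycle up
to a conjugacy close to the identity. -/
theorem Adapted.exists_projConj_scale {A : Cocycle F V T} {w α : Fin d → X → ℝ} {c : ℝ}
    (hc : 0 < c) (h : S.Adapted A w α c) {ε : ℝ} (hε : 0 < ε) :
    ∃ δ > 0, ∀ γ : Fin d → X → ℝ, ∀ hγ : ∀ i, Continuous (γ i), (∀ i x, |γ i x| ≤ δ) →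
      Cocycle.ProjConj ε A (S.scale A hγ) := by
  obtain ⟨C, hC, hbound⟩ := S.exists_blocks_bound h.continuous_w h.w_pos
  have hκ : 0 < 1 - Real.exp (-(c / 2)) :=
    sub_pos.2 (Real.exp_lt_one_iff.2 (neg_lt_zero.2 (half_pos hc)))
  set ε' := ε / (2 * (d + 1)) with hε'
  have hε'0 : 0 < ε' := by positivity
  obtain ⟨δ, hδ0, hδ1, hδ2⟩ : ∃ δ > 0, 2 * δ * d ≤ c / 2 ∧
      C * (4 * δ / (1 - Real.exp (-(c / 2)))) * C < ε' := by
    refine ⟨min (c / (4 * (d + 1))) (ε' * (1 - Real.exp (-(c / 2))) / (8 * C * C)),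
      lt_min (by positivity) (by positivity), ?_, ?_⟩
    · have h1 := min_le_left (c / (4 * (d + 1))) (ε' * (1 - Real.exp (-(c / 2))) / (8 * C * C))
      calc _ ≤ 2 * (c / (4 * (d + 1))) * d := by gcongr
        _ = c / 2 * (d / (d + 1)) := by field_simp; ring
        _ ≤ c / 2 * 1 := by
          refine mul_le_mul_of_nonneg_left ?_ (by positivity)
          rw [div_le_one (by positivity)]
          linarith
        _ = _ := mul_one _
    · have h1 := min_le_right (c / (4 * (d + 1))) (ε' * (1 - Real.exp (-(c / 2))) / (8 * C * C))
      calc _ ≤ C * (4 * (ε' * (1 - Real.exp (-(c / 2))) / (8 * C * C)) /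
            (1 - Real.exp (-(c / 2)))) * C := by gcongr
        _ = ε' / 2 := by field_simp; ring
        _ < ε' := half_lt_self hε'0
  refine ⟨δ, hδ0, fun γ hγ hγδ => ?_⟩
  -- the reference cocycle has slightly smaller gaps, which are then increased
  let ref : Fin d → X → ℝ := fun i _ => -(2 * δ * (i.val + 1))
  have href : ∀ i, Continuous (ref i) := fun i => continuous_const
  have had : S.Adapted (S.scale A href) w (fun i x => α i x + ref i x) (c / 2) :=
    h.scale S href fun i j hij x => by
      have h1 := h.gap i j hij x
      have h2 : (j.val : ℝ) - i.val ≤ d := by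
        have : (j.val : ℝ) ≤ d := by exact_mod_cast j.2.le
        have : (0 : ℝ) ≤ i.val := by positivity
        linarith
      have h3 : 2 * δ * ((j.val : ℝ) - i.val) ≤ 2 * δ * d :=
        mul_le_mul_of_nonneg_left h2 (by positivity)
      simp only [ref]
      linarith
  have key : ∀ g : ℕ → X → ℝ, (∀ k, Continuous (g k)) → (∀ k x, |g k x| ≤ δ) →
      ∀ hg : ∀ i : Fin d, Continuous (g i.val),
      Cocycle.ProjConj ((d + 1 : ℕ) * ε') (S.scale A href) (S.scale A hg) := by
    intro g hgc hgδ hg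
    -- the increments which lead from `ref` to `g`; the gaps of `ref` make them nonnegative
    let θ : ℕ → X → ℝ := fun k x => Nat.rec (g 0 x + 2 * δ) (fun k _ => g (k + 1) x - g k x + 2 * δ) k
    have hθ : ∀ k, Continuous (θ k) := fun k => by
      cases k with
      | zero => exact (hgc 0).add continuous_const
      | succ k => exact ((hgc (k + 1)).sub (hgc k)).add continuous_const
    have hθb : ∀ k x, 0 ≤ θ k x ∧ θ k x ≤ 4 * δ := fun k x => by
      cases k with
      | zero =>
        have := abs_le.1 (hgδ 0 x)
        change 0 ≤ g 0 x + 2 * δ ∧ g 0 x + 2 * δ ≤ 4 * δ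
        constructor <;> linarith
      | succ k =>
        have h1 := abs_le.1 (hgδ k x)
        have h2 := abs_le.1 (hgδ (k + 1) x)
        change 0 ≤ g (k + 1) x - g k x + 2 * δ ∧ g (k + 1) x - g k x + 2 * δ ≤ 4 * δ
        constructor <;> linarith
    have hsum : ∀ (i : ℕ) x, ∑ k ∈ Finset.range (i + 1), θ k x = g i x + 2 * δ * (i + 1) := by
      intro i x
      induction i with
      | zero => simp [θ]
      | succ i ih =>
        rw [Finset.sum_range_succ, ih]
        simp only [θ]
        push_cast
        ring
    have hγ' : ∀ i : Fin d, Continuous fun x =>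
        ∑ k ∈ Finset.range d, if k ≤ i.val then θ k x else 0 :=
      fun i => continuous_finsetSum _ fun k _ => by
        split_ifs
        · exact hθ k
        · exact continuous_const
    have h1 := had.projConj_tails (half_pos hc) hC hbound hθ (δ := 4 * δ) (by positivity) hε'0
      (fun k x => (hθb k x).1) (fun k x => (hθb k x).2) hδ2 d hγ'
    have e : S.scale (S.scale A href) hγ' = S.scale A hg := Cocycle.ext_fib fun x v => by
      rw [scale_fib, scale_fib, scale_fib]
      congr 1
      refine S.ext_pr fun i => ?_
      rw [S.pr_diag, S.pr_diag, S.pr_diag, smul_smul, ← Real.exp_add]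
      congr 2
      rw [← Finset.sum_filter]
      have : (Finset.range d).filter (fun k => k ≤ i.val) = Finset.range (i.val + 1) := by
        ext k
        simp only [Finset.mem_filter, Finset.mem_range]
        have := i.2
        omega
      rw [this, hsum]
      simp only [ref]
      ring
    rwa [e] at h1
  have h0 := key (fun _ _ => 0) (fun _ => continuous_const) (fun _ _ => by simpa using hδ0.le)
    (fun _ => continuous_const)
  have e0 : S.scale A (γ := fun _ _ => 0) (fun _ => continuous_const) = A :=
    Cocycle.ext_fib fun x v => by
      rw [scale_fib, diag_apply]
      simp [S.sum_pr]
  rw [e0] at h0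
  have hcase : ∀ k, Continuous fun x => if hk : k < d then γ ⟨k, hk⟩ x else 0 := fun k => by
    split_ifs with hk
    · exact hγ _
    · exact continuous_const
  have h1 := key (fun k x => if hk : k < d then γ ⟨k, hk⟩ x else 0) hcase
    (fun k x => by
      split_ifs with hk
      · exact hγδ _ x
      · simpa using hδ0.le) (fun i => hcase i)
  have e1 : S.scale A (γ := fun i : Fin d => fun x => if hk : i.val < d then γ ⟨i.val, hk⟩ x else 0)
      (fun i => hcase i) = S.scale A hγ := Cocycle.ext_fib fun x v => by
    rw [scale_fib, scale_fib]
    congr 1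
    refine S.ext_pr fun i => ?_
    rw [S.pr_diag, S.pr_diag]
    simp
  rw [e1] at h1
  refine (h0.symm.trans h1).mono (le_of_eq ?_)
  rw [hε']
  push_cast
  field_simp
  ring

end LineSplitting

end Lines

/-! ### Block diagonalization of perturbations in a Banach algebra -/

section BanachAlgebra

theorem isUnit_one_sub_of_norm_pow_lt {R : Type*} [NormedRing R] [CompleteSpace R] {U : R} {n : ℕ}
    (h : ‖U ^ n‖ < 1) : IsUnit (1 - U) := by
  have h1 : IsUnit (1 - U ^ n) := ⟨Units.oneSub _ h, rfl⟩
  rw [← mul_neg_geom_sum U n] at h1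
  have hc : Commute (1 - U) (∑ i ∈ Finset.range n, U ^ i) := by
    rw [commute_iff_eq, mul_neg_geom_sum, geom_sum_mul_neg]
  exact (hc.isUnit_mul_iff.1 h1).1

variable {R : Type*} [NormedRing R] [NormedAlgebra ℝ R] [CompleteSpace R]

/-- A fixed point equation whose right hand side is proportional to the small parameter `P`. -/
theorem exists_small_fixedPoint (e : R) (K L D : R →L[ℝ] R) {ε : ℝ} (hε : 0 < ε) :
    ∃ η > 0, ∀ P : R, ‖P‖ ≤ η → ∃ Q : R, ‖Q‖ ≤ ε ∧
      Q = K (P * (e + Q) - L Q * D (P * (e + Q))) := by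
  set M := ‖K‖ * ((1 + ‖L‖ * ‖D‖) * (‖e‖ + 2)) + 1 with hM
  have hM0 : 0 < M := by positivity
  refine ⟨min (1 / 2) (min 1 ε) / M, by positivity, fun P hP => ?_⟩
  have hη1 : min (1 / 2) (min 1 ε) / M * M = min (1 / 2) (min 1 ε) := div_mul_cancel₀ _ hM0.ne'
  set η := min (1 / 2) (min 1 ε) / M with hη
  have hη0 : 0 ≤ η := by positivity
  set r := min 1 ε with hr
  have hr0 : 0 < r := lt_min one_pos hε
  have hr1 : r ≤ 1 := min_le_left _ _
  set f : R → R := fun Q => K (P * (e + Q) - L Q * D (P * (e + Q))) with hf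
  have hsmall : ∀ Q, ‖Q‖ ≤ r → ‖P * (e + Q)‖ ≤ η * (‖e‖ + 1) := fun Q hQ =>
    (norm_mul_le _ _).trans (mul_le_mul hP ((norm_add_le _ _).trans (by linarith)) (norm_nonneg _)
      hη0)
  have hmaps : Set.MapsTo f (Metric.closedBall 0 r) (Metric.closedBall 0 r) := by
    intro Q hQ
    rw [mem_closedBall_zero_iff] at hQ ⊢
    have h1 := hsmall Q hQ
    calc ‖f Q‖ ≤ ‖K‖ * (η * (‖e‖ + 1) + (‖L‖ * 1) * (‖D‖ * (η * (‖e‖ + 1)))) := by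
          refine (K.le_opNorm _).trans (mul_le_mul_of_nonneg_left ?_ (norm_nonneg _))
          refine (norm_sub_le _ _).trans (add_le_add h1 ((norm_mul_le _ _).trans ?_))
          refine mul_le_mul ((L.le_opNorm _).trans (mul_le_mul_of_nonneg_left (hQ.trans hr1)
            (norm_nonneg _))) ((D.le_opNorm _).trans (mul_le_mul_of_nonneg_left h1
            (norm_nonneg _))) (norm_nonneg _) (by positivity)
      _ = η * (‖K‖ * ((1 + ‖L‖ * ‖D‖) * (‖e‖ + 1))) := by ring
      _ ≤ η * M := by
        refine mul_le_mul_of_nonneg_left ?_ hη0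
        have : ‖K‖ * ((1 + ‖L‖ * ‖D‖) * (‖e‖ + 1)) ≤ ‖K‖ * ((1 + ‖L‖ * ‖D‖) * (‖e‖ + 2)) := by
          gcongr; norm_num
        linarith
      _ ≤ r := by rw [hη1]; exact min_le_right _ _
  have hlip : ∀ Q ∈ Metric.closedBall (0 : R) r, ∀ Q' ∈ Metric.closedBall (0 : R) r,
      ‖f Q - f Q'‖ ≤ 1 / 2 * ‖Q - Q'‖ := by
    intro Q hQ Q' hQ'
    rw [mem_closedBall_zero_iff] at hQ hQ'
    have h1 := hsmall Q hQ
    have h2 : ‖P * (Q - Q')‖ ≤ η * ‖Q - Q'‖ :=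
      (norm_mul_le _ _).trans (mul_le_mul_of_nonneg_right hP (norm_nonneg _))
    have e1 : f Q - f Q' = K (P * (Q - Q') - (L (Q - Q') * D (P * (e + Q)) +
        L Q' * D (P * (Q - Q')))) := by
      simp only [hf]
      rw [← map_sub]
      congr 1
      have : P * (e + Q) = P * (e + Q') + P * (Q - Q') := by rw [← mul_add]; congr 1; abel
      simp only [this, map_sub, map_add]
      noncomm_ring
    rw [e1]
    calc _ ≤ ‖K‖ * (η * ‖Q - Q'‖ + ((‖L‖ * ‖Q - Q'‖) * (‖D‖ * (η * (‖e‖ + 1))) +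
          (‖L‖ * 1) * (‖D‖ * (η * ‖Q - Q'‖)))) := by
          refine (K.le_opNorm _).trans (mul_le_mul_of_nonneg_left ?_ (norm_nonneg _))
          refine (norm_sub_le _ _).trans (add_le_add h2 ((norm_add_le _ _).trans (add_le_add ?_ ?_)))
          · exact (norm_mul_le _ _).trans (mul_le_mul (L.le_opNorm _) ((D.le_opNorm _).trans
              (mul_le_mul_of_nonneg_left h1 (norm_nonneg _))) (norm_nonneg _) (by positivity))
          · exact (norm_mul_le _ _).trans (mul_le_mul ((L.le_opNorm _).trans
              (mul_le_mul_of_nonneg_left (hQ'.trans hr1) (norm_nonneg _))) ((D.le_opNorm _).trans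
              (mul_le_mul_of_nonneg_left h2 (norm_nonneg _))) (norm_nonneg _) (by positivity))
      _ = η * (‖K‖ * (1 + ‖L‖ * ‖D‖ * (‖e‖ + 2))) * ‖Q - Q'‖ := by ring
      _ ≤ η * M * ‖Q - Q'‖ := by
        refine mul_le_mul_of_nonneg_right (mul_le_mul_of_nonneg_left ?_ hη0) (norm_nonneg _)
        have : ‖K‖ * (1 + ‖L‖ * ‖D‖ * (‖e‖ + 2)) ≤ ‖K‖ * ((1 + ‖L‖ * ‖D‖) * (‖e‖ + 2)) := by
          refine mul_le_mul_of_nonneg_left ?_ (norm_nonneg _)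
          nlinarith [norm_nonneg e]
        linarith
      _ ≤ 1 / 2 * ‖Q - Q'‖ := by
        refine mul_le_mul_of_nonneg_right ?_ (norm_nonneg _)
        rw [hη1]; exact min_le_left _ _
  have hcontr : ContractingWith (1 / 2 : NNReal) (hmaps.restrict f _ _) := by
    refine ⟨by norm_num, LipschitzWith.of_dist_le_mul fun Q Q' => ?_⟩
    have := hlip Q.1 Q.2 Q'.1 Q'.2
    rw [← dist_eq_norm, ← dist_eq_norm] at this
    change dist (f Q.1) (f Q'.1) ≤ ((1 / 2 : NNReal) : ℝ) * dist Q.1 Q'.1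
    simpa using this
  obtain ⟨Q, hQ, hQf, -⟩ := ContractingWith.exists_fixedPoint' (x := 0)
    (Metric.isClosed_closedBall.isComplete) hmaps hcontr
    (Metric.mem_closedBall_self hr0.le) (edist_ne_top _ _)
  rw [mem_closedBall_zero_iff] at hQ
  exact ⟨Q, hQ.trans (min_le_right _ _), hQf.symm⟩

variable {d : ℕ} {ϖ : Fin d → R}

/-- An operator which commutes with the compressions to the entries defined by orthogonal
idempotents, and which is contracting below the diagonal and has a contracting inverse above it,
has no off-diagonal fixed points: `L - 1` is invertible there. -/
theorem exists_offdiag_inverse (hϖ : ∀ i, ϖ i * ϖ i = ϖ i) (hϖ' : ∀ i j, i ≠ j → ϖ i * ϖ j = 0)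
    {L L' : R →L[ℝ] R} (hL : ∀ i j M, L (ϖ i * M * ϖ j) = ϖ i * L M * ϖ j)
    (hL' : ∀ i j M, L' (ϖ i * M * ϖ j) = ϖ i * L' M * ϖ j)
    (hLL' : ∀ i j M, L (L' (ϖ i * M * ϖ j)) = ϖ i * M * ϖ j)
    (hlow : ∀ i j, j < i → ∃ n : ℕ,
      ‖((ContinuousLinearMap.mulLeftRight ℝ R (ϖ i) (ϖ j)).comp L) ^ n‖ < 1)
    (hup : ∀ i j, i < j → ∃ n : ℕ,
      ‖((ContinuousLinearMap.mulLeftRight ℝ R (ϖ i) (ϖ j)).comp L') ^ n‖ < 1) :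
    ∃ K : R →L[ℝ] R, ∀ M, L (K M) - K M = ∑ i, ∑ j, (if i = j then 0 else ϖ i * M * ϖ j) ∧
      (∀ i, ϖ i * K M * ϖ i = 0) ∧ (∑ i, ϖ i) * K M * (∑ i, ϖ i) = K M := by
  have hcomp : ∀ i j (M : R), ϖ i * (ϖ i * M * ϖ j) * ϖ j = ϖ i * M * ϖ j := fun i j M => by
    calc _ = (ϖ i * ϖ i) * M * (ϖ j * ϖ j) := by noncomm_ring
      _ = _ := by rw [hϖ, hϖ]
  -- the inverse on each entry
  have key : ∀ i j, i ≠ j → ∃ K : R →L[ℝ] R, ∀ M, ϖ i * K M * ϖ j = K M ∧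
      L (K M) - K M = ϖ i * M * ϖ j := by
    intro i j hij
    rcases lt_or_gt_of_ne hij with h | h
    · obtain ⟨n, hn⟩ := hup i j h
      set U := (ContinuousLinearMap.mulLeftRight ℝ R (ϖ i) (ϖ j)).comp L' with hU
      have hUa : ∀ M, U M = ϖ i * L' M * ϖ j := fun M => rfl
      obtain ⟨u, hu⟩ := isUnit_one_sub_of_norm_pow_lt hn
      refine ⟨(u⁻¹ : (R →L[ℝ] R)ˣ).1 * U * ContinuousLinearMap.mulLeftRight ℝ R (ϖ i) (ϖ j),
        fun M => ?_⟩
      set m := ϖ i * M * ϖ j with hm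
      set q := ((u⁻¹ : (R →L[ℝ] R)ˣ).1 * U * ContinuousLinearMap.mulLeftRight ℝ R (ϖ i) (ϖ j)) M
        with hq
      have h1 : q - U q = U m := by
        have : u.1 q = (u.1 * (u⁻¹ : (R →L[ℝ] R)ˣ).1) (U m) := rfl
        rw [u.mul_inv, hu] at this
        exact this
      have h2 : q = U (q + m) := by rw [map_add, ← h1]; abel
      have h3 : ϖ i * q * ϖ j = q := by rw [h2, hUa, hcomp]
      refine ⟨h3, ?_⟩
      have h4 : ϖ i * (q + m) * ϖ j = q + m := by
        rw [mul_add, add_mul, h3, hm, hcomp]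
      have h5 : q = L' (q + m) := by
        conv_lhs => rw [h2, hUa, ← hL', h4]
      have h6 : L q = q + m := by
        conv_lhs => rw [h5, ← h4, hLL', h4]
      rw [h6]; abel
    · obtain ⟨n, hn⟩ := hlow i j h
      set U := (ContinuousLinearMap.mulLeftRight ℝ R (ϖ i) (ϖ j)).comp L with hU
      have hUa : ∀ M, U M = ϖ i * L M * ϖ j := fun M => rfl
      obtain ⟨u, hu⟩ := isUnit_one_sub_of_norm_pow_lt hn
      refine ⟨-((u⁻¹ : (R →L[ℝ] R)ˣ).1 * ContinuousLinearMap.mulLeftRight ℝ R (ϖ i) (ϖ j)),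
        fun M => ?_⟩
      set m := ϖ i * M * ϖ j with hm
      set q := (-((u⁻¹ : (R →L[ℝ] R)ˣ).1 * ContinuousLinearMap.mulLeftRight ℝ R (ϖ i) (ϖ j))) M
        with hq
      have h1 : q - U q = -m := by
        have : u.1 q = -(u.1 * (u⁻¹ : (R →L[ℝ] R)ˣ).1) m := by
          rw [hq]
          exact map_neg u.1 _
        rw [u.mul_inv, hu] at this
        exact this
      have h2 : q = U q - m := by rw [sub_eq_add_neg, ← h1]; abel
      have h3 : ϖ i * q * ϖ j = q := by
        conv_lhs => rw [h2, mul_sub, sub_mul, hUa, hm, hcomp, hcomp, ← hUa, ← hm, ← h2]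
      refine ⟨h3, ?_⟩
      have h6 : L q = U q := by
        conv_lhs => rw [← h3, hL]
        rfl
      rw [h6, ← neg_sub, h1, neg_neg]
  have hkey : ∀ i j, ∃ K : R →L[ℝ] R, ∀ M, ϖ i * K M * ϖ j = K M ∧
      L (K M) - K M = (if i = j then 0 else ϖ i * M * ϖ j) ∧ (i = j → K M = 0) := by
    intro i j
    by_cases hij : i = j
    · exact ⟨0, fun M => by simp [hij]⟩
    · obtain ⟨K, hK⟩ := key i j hij
      exact ⟨K, fun M => ⟨(hK M).1, by simpa [hij] using (hK M).2, fun h => absurd h hij⟩⟩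
  choose K hK using hkey
  refine ⟨∑ i, ∑ j, K i j, fun M => ⟨?_, fun i => ?_, ?_⟩⟩
  · simp only [sum_apply, map_sum]
    rw [← Finset.sum_sub_distrib]
    refine Finset.sum_congr rfl fun i _ => ?_
    rw [← Finset.sum_sub_distrib]
    exact Finset.sum_congr rfl fun j _ => (hK i j M).2.1
  · simp only [sum_apply, Finset.mul_sum, Finset.sum_mul]
    refine Finset.sum_eq_zero fun k _ => Finset.sum_eq_zero fun l _ => ?_
    rw [← (hK k l M).1]
    by_cases hik : i = k
    · by_cases hil : l = i
      · rw [(hK k l M).2.2 (by rw [← hik, hil])]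
        simp
      · rw [mul_assoc (ϖ k), mul_assoc, mul_assoc, mul_assoc, hϖ' l i hil]
        simp
    · rw [← mul_assoc, ← mul_assoc, hϖ' i k hik]
      simp
  · have hk : ∀ k, (∑ i, ϖ i) * ϖ k = ϖ k := fun k => by
      rw [Finset.sum_mul, Finset.sum_eq_single k (fun i _ hi => hϖ' i k hi) (by simp), hϖ]
    have hk' : ∀ k, ϖ k * (∑ i, ϖ i) = ϖ k := fun k => by
      rw [Finset.mul_sum, Finset.sum_eq_single k (fun i _ hi => hϖ' k i hi.symm) (by simp), hϖ]
    generalize (∑ i, ϖ i) = s at hk hk'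
    simp only [sum_apply, Finset.mul_sum, Finset.sum_mul]
    refine Finset.sum_congr rfl fun k _ => Finset.sum_congr rfl fun l _ => ?_
    rw [← (hK k l M).1, ← mul_assoc, ← mul_assoc, hk, mul_assoc, hk']

end BanachAlgebra

/-! ### Cocycles near one with an adapted splitting are conjugate to its rescalings -/

section Abstract

variable {R : Type*} [NormedRing R] [NormedAlgebra ℝ R] [CompleteSpace R]
variable {d : ℕ} {ϖ : Fin d → R}

/-- The algebra behind the conjugacy of a perturbation `b` of a block diagonal cocycle `a` with a
block diagonal one: `τ` is the composition with the base dynamics, and `a'` the inverse of `a` on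
the image of `∑ i, ϖ i`. The conjugacy `∑ i, ϖ i + Q` is a fixed point, where `K` inverts `L - 1`
on the off-diagonal elements. -/
theorem exists_block_conjugacy (hϖ : ∀ i, ϖ i * ϖ i = ϖ i) (hϖ' : ∀ i j, i ≠ j → ϖ i * ϖ j = 0)
    {K L : R →L[ℝ] R} (τ : R →+* R) {a a' : R} (hLa : ∀ M, L M = a' * τ M * a)
    (hL : ∀ i j M, L (ϖ i * M * ϖ j) = ϖ i * L M * ϖ j)
    (hK : ∀ M, L (K M) - K M = ∑ i, ∑ j, (if i = j then 0 else ϖ i * M * ϖ j) ∧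
      (∀ i, ϖ i * K M * ϖ i = 0) ∧ (∑ i, ϖ i) * K M * (∑ i, ϖ i) = K M)
    (h1 : a' * a = ∑ i, ϖ i) (h2 : a * a' = τ (∑ i, ϖ i))
    (h3 : a' * τ (∑ i, ϖ i) = a') (h4 : τ (∑ i, ϖ i) * a = a) {ε : ℝ} (hε : 0 < ε) :
    ∃ η > 0, ∀ b, τ (∑ i, ϖ i) * b = b → ‖a' * (b - a)‖ ≤ η →
      ∃ Q M, ‖Q‖ ≤ ε ∧ ‖M‖ ≤ ε ∧
        τ (∑ i, ϖ i + Q) * a * (∑ i, ϖ i + ∑ i, ϖ i * M * ϖ i) = b * (∑ i, ϖ i + Q) := by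
  set e := ∑ i, ϖ i with he
  have hee : e * e = e := by
    rw [he, Finset.sum_mul_sum]
    refine Finset.sum_congr rfl fun i _ => ?_
    rw [Finset.sum_eq_single i (fun j _ hj => hϖ' i j hj.symm) (by simp), hϖ]
  have heϖ : ∀ i, e * ϖ i = ϖ i := fun i => by
    rw [he, Finset.sum_mul, Finset.sum_eq_single i (fun j _ hj => hϖ' j i hj) (by simp), hϖ]
  have hϖe : ∀ i, ϖ i * e = ϖ i := fun i => by
    rw [he, Finset.mul_sum, Finset.sum_eq_single i (fun j _ hj => hϖ' i j hj.symm) (by simp), hϖ]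
  have hae : a * e = a := by rw [← h1, ← mul_assoc, h2, h4]
  have hea' : e * a' = a' := by rw [← h1, mul_assoc, h2, h3]
  set D : R →L[ℝ] R := ∑ i, ContinuousLinearMap.mulLeftRight ℝ R (ϖ i) (ϖ i) with hD
  have hD_apply : ∀ M, D M = ∑ i, ϖ i * M * ϖ i := fun M => by
    simp [hD, sum_apply]
  obtain ⟨η, hη, key⟩ := exists_small_fixedPoint e K L D hε
  refine ⟨min η (ε / (‖e‖ + ε)), lt_min hη (by positivity), fun b hb' hsmall => ?_⟩
  obtain ⟨Q, hQ, hQK⟩ := key (a' * (b - a)) (hsmall.trans (min_le_left _ _))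
  set P := a' * (b - a) with hP
  set M := P * (e + Q) with hM
  obtain ⟨k1, k2, k3⟩ := hK (M - L Q * D M)
  rw [← hQK] at k1 k2 k3
  have hQe : Q * e = Q := by rw [← k3, mul_assoc, hee]
  have heQ : e * Q = Q := by rw [← k3, ← mul_assoc, ← mul_assoc, hee]
  refine ⟨Q, M, hQ, ?_, ?_⟩
  · calc ‖M‖ ≤ ε / (‖e‖ + ε) * (‖e‖ + ε) :=
        (norm_mul_le _ _).trans (mul_le_mul (hsmall.trans (min_le_right _ _))
          ((norm_add_le _ _).trans (add_le_add le_rfl hQ)) (norm_nonneg _) (by positivity))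
      _ = ε := div_mul_cancel₀ _ (by positivity)
  rw [← hD_apply]
  have hLQe : L Q * e = L Q := by rw [hLa, mul_assoc, hae]
  have heLQ : e * L Q = L Q := by rw [hLa, ← mul_assoc, ← mul_assoc, hea']
  have heD : e * D M = D M := by
    rw [hD_apply, Finset.mul_sum]
    exact Finset.sum_congr rfl fun i _ => by rw [← mul_assoc, ← mul_assoc, heϖ]
  have hDe : D M * e = D M := by
    rw [hD_apply, Finset.sum_mul]
    exact Finset.sum_congr rfl fun i _ => by rw [mul_assoc, hϖe]
  have heM : e * M = M := by rw [hM, hP, ← mul_assoc, ← mul_assoc, hea']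
  have hMe : M * e = M := by rw [hM, mul_assoc, add_mul, hee, hQe]
  -- the products of off-diagonal and diagonal elements are off-diagonal
  have hoff : ∀ i, ϖ i * (L Q * D M) * ϖ i = 0 := fun i => by
    have hDϖ : D M * ϖ i = ϖ i * (M * ϖ i) := by
      rw [hD_apply, Finset.sum_mul, Finset.sum_eq_single i, mul_assoc, mul_assoc, hϖ]
      · intro j _ hj
        rw [mul_assoc, hϖ' j i hj, mul_zero]
      · simp
    calc _ = ϖ i * L Q * (D M * ϖ i) := by noncomm_ring
      _ = ϖ i * L Q * ϖ i * (M * ϖ i) := by rw [hDϖ]; noncomm_ring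
      _ = 0 := by rw [← hL, k2, map_zero, zero_mul]
  have hsum : ∑ i, ∑ j, (if i = j then 0 else ϖ i * (M - L Q * D M) * ϖ j) =
      M - L Q * D M - D M := by
    have e1 : ∀ i j, (if i = j then 0 else ϖ i * (M - L Q * D M) * ϖ j) =
        ϖ i * (M - L Q * D M) * ϖ j - if i = j then ϖ i * M * ϖ i else 0 := fun i j => by
      split_ifs with hij
      · subst hij
        rw [mul_sub, sub_mul, hoff, sub_zero, sub_self]
      · rw [sub_zero]
    simp only [e1, Finset.sum_sub_distrib, Finset.sum_ite_eq, Finset.mem_univ, if_true]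
    rw [← hD_apply]
    congr 1
    have : ∑ i, ∑ j, ϖ i * (M - L Q * D M) * ϖ j = e * (M - L Q * D M) * e := by
      rw [he, Finset.sum_mul, Finset.sum_mul]
      exact Finset.sum_congr rfl fun i _ => by rw [Finset.mul_sum]
    rw [this, mul_sub, heM, ← mul_assoc, heLQ, sub_mul, hMe, mul_assoc, hDe]
  rw [hsum] at k1
  have hmain : (e + L Q) * (e + D M) = (e + P) * (e + Q) := by
    have e1 : (e + L Q) * (e + D M) = e + D M + (L Q + L Q * D M) := by
      rw [add_mul, mul_add, mul_add, hee, heD, hLQe]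
    have e2 : (e + P) * (e + Q) = e + Q + M := by
      rw [add_mul, mul_add, hee, heQ]
    have e3 : L Q = M - L Q * D M - D M + Q := by rw [← k1]; abel
    rw [e1, e2]
    nth_rewrite 1 [e3]
    abel
  have hZ : e + L Q = a' * τ (e + Q) * a := by
    rw [map_add, mul_add, add_mul, h3, h1, hLa]
  have hb2 : a * (e + P) = b := by
    rw [mul_add, hae, hP, ← mul_assoc, h2, mul_sub, hb', h4]
    abel
  calc τ (e + Q) * a * (e + D M) = a * a' * τ (e + Q) * a * (e + D M) := by
        rw [h2, ← map_mul, mul_add e e Q, hee, heQ]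
    _ = a * ((e + L Q) * (e + D M)) := by rw [hZ]; noncomm_ring
    _ = b * (e + Q) := by rw [hmain, ← mul_assoc, hb2]

/-- An operator which contracts some gauge comparable to the norm on its image has a power of norm
less than one. Here `Φ M κ` says that the gauge of `M` is at most `κ`. -/
theorem exists_norm_pow_lt_one {Y : Type*} [NormedAddCommGroup Y] [NormedSpace ℝ Y] (U : Y →L[ℝ] Y)
    (Φ : Y → ℝ → Prop) {C ρ : ℝ} (hC : 0 ≤ C) (hρ : 0 ≤ ρ) (hρ1 : ρ < 1)
    (h0 : ∀ M, Φ (U M) (C * ‖M‖)) (hs : ∀ M κ, 0 ≤ κ → Φ M κ → Φ (U M) (ρ * κ))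
    (he : ∀ M κ, 0 ≤ κ → Φ M κ → ‖M‖ ≤ C * κ) : ∃ n : ℕ, ‖U ^ n‖ < 1 := by
  have key : ∀ n : ℕ, ∀ M, Φ ((U ^ (n + 1)) M) (ρ ^ n * (C * ‖M‖)) := by
    intro n
    induction n with
    | zero => intro M; simpa using h0 M
    | succ n ih =>
      intro M
      have := hs _ _ (by positivity) (ih M)
      rw [pow_succ' U, pow_succ' ρ, mul_assoc]
      exact this
  have hlim : Tendsto (fun n : ℕ => C * C * ρ ^ n) atTop (𝓝 (C * C * 0)) :=
    (tendsto_pow_atTop_nhds_zero_of_lt_one hρ hρ1).const_mul _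
  rw [mul_zero] at hlim
  obtain ⟨n, hn⟩ := (hlim.eventually_lt_const one_pos).exists
  refine ⟨n + 1, lt_of_le_of_lt (ContinuousLinearMap.opNorm_le_bound _ (by positivity)
    fun M => ?_) hn⟩
  refine (he _ _ (by positivity) (key n M)).trans (le_of_eq (by ring))

end Abstract

section Endo

variable (X : Type*) [MetricSpace X] [CompactSpace X]
  (G : Type*) [NormedAddCommGroup G] [NormedSpace ℝ G]

/-- The Banach algebra of the continuous families of endomorphisms of `G` parametrized by `X`.
It is made a type of its own to keep instance search short. -/
def EndoFamily : Type _ := C(X, G →L[ℝ] G)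

namespace EndoFamily

instance : NormedRing (EndoFamily X G) := inferInstanceAs (NormedRing C(X, G →L[ℝ] G))

instance : NormedAlgebra ℝ (EndoFamily X G) := inferInstanceAs (NormedAlgebra ℝ C(X, G →L[ℝ] G))

variable {X G}

/-- A continuous family of endomorphisms. -/
def mk (f : X → G →L[ℝ] G) (hf : Continuous f) : EndoFamily X G := (⟨f, hf⟩ : C(X, G →L[ℝ] G))

/-- The endomorphism above a point. -/
def app (M : EndoFamily X G) (x : X) : G →L[ℝ] G := (show C(X, G →L[ℝ] G) from M) x

theorem continuous_app (M : EndoFamily X G) : Continuous M.app :=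
  (show C(X, G →L[ℝ] G) from M).continuous

theorem ext_app {M N : EndoFamily X G} (h : ∀ x g, M.app x g = N.app x g) : M = N :=
  ContinuousMap.ext fun x => ContinuousLinearMap.ext (h x)

@[simp] theorem app_mul (M N : EndoFamily X G) (x : X) (g : G) :
    (M * N).app x g = M.app x (N.app x g) := rfl

@[simp] theorem app_add (M N : EndoFamily X G) (x : X) (g : G) :
    (M + N).app x g = M.app x g + N.app x g := rfl

@[simp] theorem app_sub (M N : EndoFamily X G) (x : X) (g : G) :
    (M - N).app x g = M.app x g - N.app x g := rfl

@[simp] theorem app_zero (x : X) (g : G) : (0 : EndoFamily X G).app x g = 0 := rfl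

theorem app_sum {ι : Type*} (s : Finset ι) (M : ι → EndoFamily X G) (x : X) (g : G) :
    (∑ i ∈ s, M i).app x g = ∑ i ∈ s, (M i).app x g := by
  classical
  induction s using Finset.induction_on with
  | empty => rfl
  | insert i s hi ih => rw [Finset.sum_insert hi, Finset.sum_insert hi, app_add, ih]

theorem norm_app_le (M : EndoFamily X G) (x : X) : ‖M.app x‖ ≤ ‖M‖ :=
  ContinuousMap.norm_coe_le_norm (show C(X, G →L[ℝ] G) from M) x

theorem norm_app_apply_le (M : EndoFamily X G) (x : X) (g : G) : ‖M.app x g‖ ≤ ‖M‖ * ‖g‖ :=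
  ((M.app x).le_opNorm g).trans (mul_le_mul_of_nonneg_right (M.norm_app_le x) (norm_nonneg _))

theorem norm_le_of_app (M : EndoFamily X G) {C : ℝ} (hC : 0 ≤ C)
    (h : ∀ x g, ‖M.app x g‖ ≤ C * ‖g‖) : ‖M‖ ≤ C :=
  (ContinuousMap.norm_le (show C(X, G →L[ℝ] G) from M) hC).2 fun x =>
    ContinuousLinearMap.opNorm_le_bound _ hC (h x)

instance [FiniteDimensional ℝ G] : CompleteSpace (EndoFamily X G) :=
  haveI := FiniteDimensional.complete ℝ (G →L[ℝ] G)
  inferInstanceAs (CompleteSpace C(X, G →L[ℝ] G))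

/-- The composition with a homeomorphism of the base. -/
def comp (G : Type*) [NormedAddCommGroup G] [NormedSpace ℝ G] (T : X ≃ₜ X) :
    EndoFamily X G →+* EndoFamily X G where
  toFun M := mk (fun x => M.app (T x)) (M.continuous_app.comp T.continuous)
  map_one' := rfl
  map_mul' _ _ := rfl
  map_zero' := rfl
  map_add' _ _ := rfl

@[simp] theorem app_comp (T : X ≃ₜ X) (M : EndoFamily X G) (x : X) :
    (comp G T M).app x = M.app (T x) := rfl

theorem norm_comp_le (T : X ≃ₜ X) (M : EndoFamily X G) : ‖comp G T M‖ ≤ ‖M‖ :=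
  norm_le_of_app _ (norm_nonneg _) fun x g => M.norm_app_apply_le (T x) g

/-- The operator `M ↦ a' (M ∘ T) a`. -/
def transfer (T : X ≃ₜ X) (a a' : EndoFamily X G) : EndoFamily X G →L[ℝ] EndoFamily X G :=
  LinearMap.mkContinuous
    { toFun := fun M => a' * comp G T M * a
      map_add' := fun M N => by rw [map_add, mul_add, add_mul]
      map_smul' := fun c M => by
        have : comp G T (c • M) = c • comp G T M := rfl
        rw [this, mul_smul_comm, smul_mul_assoc, RingHom.id_apply] } (‖a'‖ * ‖a‖) (fun M => by
      refine (norm_mul_le _ _).trans ?_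
      calc _ ≤ (‖a'‖ * ‖M‖) * ‖a‖ := mul_le_mul_of_nonneg_right ((norm_mul_le _ _).trans
            (mul_le_mul_of_nonneg_left (norm_comp_le T M) (norm_nonneg _))) (norm_nonneg _)
        _ = _ := by ring)

theorem transfer_apply (T : X ≃ₜ X) (a a' M : EndoFamily X G) :
    transfer T a a' M = a' * comp G T M * a := rfl

end EndoFamily

end Endo

section Geometric

variable {X : Type*} [MetricSpace X] [CompactSpace X]
  {F : Type*} [NormedAddCommGroup F] [NormedSpace ℝ F] [FiniteDimensional ℝ F]
  {V : X → Type*} [TopologicalSpace (TotalSpace F V)]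
  [∀ x, NormedAddCommGroup (V x)] [∀ x, InnerProductSpace ℝ (V x)]
  [FiberBundle F V] [VectorBundle ℝ F V]
  {G : Type*} [NormedAddCommGroup G] [NormedSpace ℝ G] [FiniteDimensional ℝ G]
  {T : X ≃ₜ X}

/-- The fiber maps of a cocycle as continuous linear equivalences. -/
def Cocycle.fibL (A : Cocycle F V T) (x : X) : V x ≃L[ℝ] V (T x) :=
  haveI := finite_fiber F V x
  (A.fib x).toContinuousLinearEquiv

namespace FiberEmbedding

variable (J : FiberEmbedding F V G)

/-- The endomorphisms of the trivial bundle defined by a cocycle. -/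
def lift (A : Cocycle F V T) : EndoFamily X G :=
  .mk (fun x => J.j (T x) ∘L (A.fibL x).toContinuousLinearMap ∘L J.p x) <| (J.continuous_map_iff (σ := T) T.continuous).1 A.continuous_fib

theorem lift_apply (A : Cocycle F V T) (x : X) (g : G) :
    (J.lift A).app x g = J.j (T x) (A.fib x (J.p x g)) := rfl

/-- The endomorphisms of the trivial bundle defined by the inverse of a cocycle. -/
def liftInv (A : Cocycle F V T) : EndoFamily X G :=
  .mk (fun x => J.j x ∘L (A.fibL x).symm.toContinuousLinearMap ∘L J.p (T x)) <| by
    refine continuous_clm_apply.2 fun g => ?_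
    have h1 : Continuous fun x : X => (⟨T x, J.p (T x) g⟩ : TotalSpace F V) :=
      J.continuous_p.comp (T.continuous.prodMk continuous_const)
    have h2 := J.continuous_j.comp (A.homeo.symm.continuous.comp h1)
    refine h2.congr fun x => ?_
    change J.j (A.homeo.symm ⟨T x, J.p (T x) g⟩).proj (A.homeo.symm ⟨T x, J.p (T x) g⟩).snd = _
    rw [A.homeo_symm_mk]
    rfl

theorem liftInv_apply (A : Cocycle F V T) (x : X) (g : G) :
    (J.liftInv A).app x g = J.j x ((A.fib x).symm (J.p (T x) g)) := rfl

variable {d : ℕ} (S : LineSplitting F V d)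

/-- The endomorphisms of the trivial bundle defined by the projections of a splitting. -/
def liftPr (i : Fin d) : EndoFamily X G :=
  .mk (fun x => J.j x ∘L S.pr i x ∘L J.p x) <| (J.continuous_map_iff (σ := id) continuous_id).1 (S.continuous_pr i)

theorem liftPr_apply (i : Fin d) (x : X) (g : G) :
    (J.liftPr S i).app x g = J.j x (S.pr i x (J.p x g)) := rfl

theorem liftPr_mul_self (i : Fin d) : J.liftPr S i * J.liftPr S i = J.liftPr S i := by
  refine EndoFamily.ext_app fun x g => ?_
  simp [liftPr_apply, J.p_j, S.pr_pr_self]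

theorem liftPr_mul_ne (i j : Fin d) (h : i ≠ j) : J.liftPr S i * J.liftPr S j = 0 := by
  refine EndoFamily.ext_app fun x g => ?_
  simp [liftPr_apply, J.p_j, S.pr_pr_ne i j h]

theorem sum_liftPr_apply (x : X) (g : G) : (∑ i, J.liftPr S i).app x g = J.j x (J.p x g) := by
  rw [EndoFamily.app_sum]
  simp only [liftPr_apply]
  rw [← map_sum, S.sum_pr]

end FiberEmbedding

variable [IsContinuousRiemannianBundle F V]
variable {d : ℕ} {S : LineSplitting F V d} (J : FiberEmbedding F V G)

/-- The weighted length of a component is comparable with the norm. -/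
theorem LineSplitting.exists_weight_bound {w : Fin d → X → ℝ} (hw : ∀ i, Continuous (w i))
    (hw0 : ∀ i x, 0 < w i x) : ∃ C > 0, ∀ i x g,
      w i x * ‖S.pr i x (J.p x g)‖ ≤ C * ‖g‖ ∧
      ‖(J.liftPr S i).app x g‖ ≤ C * (w i x * ‖S.pr i x (J.p x g)‖) := by
  obtain ⟨C₀, hC₀, hpr⟩ := S.exists_norm_pr_le
  obtain ⟨Cp, hCp, hp⟩ := J.exists_norm_p_le
  obtain ⟨Cj, hCj, hj⟩ := J.exists_norm_j_le
  have h1 : ∀ i, ∃ M, ∀ x, w i x ≤ M := fun i => by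
    obtain ⟨M, hM⟩ := isCompact_univ.bddAbove_image (hw i).continuousOn
    exact ⟨M, fun x => hM ⟨x, trivial, rfl⟩⟩
  have h2 : ∀ i, ∃ M, ∀ x, (w i x)⁻¹ ≤ M := fun i => by
    obtain ⟨M, hM⟩ := isCompact_univ.bddAbove_image
      ((hw i).inv₀ fun x => (hw0 i x).ne').continuousOn
    exact ⟨M, fun x => hM ⟨x, trivial, rfl⟩⟩
  choose M hM using h1
  choose N hN using h2
  have hM' : ∀ i x, w i x ≤ ∑ i, |M i| := fun i x =>
    (hM i x).trans ((le_abs_self _).trans (Finset.single_le_sum (f := fun i => |M i|)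
      (fun i _ => abs_nonneg _) (Finset.mem_univ i)))
  have hN' : ∀ i x, (w i x)⁻¹ ≤ ∑ i, |N i| := fun i x =>
    (hN i x).trans ((le_abs_self _).trans (Finset.single_le_sum (f := fun i => |N i|)
      (fun i _ => abs_nonneg _) (Finset.mem_univ i)))
  have hM0 : 0 ≤ ∑ i, |M i| := Finset.sum_nonneg fun i _ => abs_nonneg _
  have hN0 : 0 ≤ ∑ i, |N i| := Finset.sum_nonneg fun i _ => abs_nonneg _
  set C := (∑ i, |M i|) * (C₀ * Cp) + Cj * ∑ i, |N i| + 1 with hC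
  refine ⟨C, by positivity, fun i x g => ⟨?_, ?_⟩⟩
  · calc _ ≤ (∑ i, |M i|) * (C₀ * (Cp * ‖g‖)) := by
          refine mul_le_mul (hM' i x) ((hpr i x _).trans
            (mul_le_mul_of_nonneg_left (hp x g) hC₀.le)) (norm_nonneg _) hM0
      _ = (∑ i, |M i|) * (C₀ * Cp) * ‖g‖ := by ring
      _ ≤ C * ‖g‖ := by
        refine mul_le_mul_of_nonneg_right ?_ (norm_nonneg _)
        have : 0 ≤ Cj * ∑ i, |N i| := by positivity
        linarith
  · have h3 : ‖S.pr i x (J.p x g)‖ ≤ (∑ i, |N i|) * (w i x * ‖S.pr i x (J.p x g)‖) := by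
      rw [← mul_assoc]
      refine le_mul_of_one_le_left (norm_nonneg _) ?_
      calc (1 : ℝ) = (w i x)⁻¹ * w i x := (inv_mul_cancel₀ (hw0 i x).ne').symm
        _ ≤ _ := mul_le_mul_of_nonneg_right (hN' i x) (hw0 i x).le
    rw [J.liftPr_apply]
    calc _ ≤ Cj * ((∑ i, |N i|) * (w i x * ‖S.pr i x (J.p x g)‖)) :=
          (hj x _).trans (mul_le_mul_of_nonneg_left h3 hCj.le)
      _ = (Cj * ∑ i, |N i|) * (w i x * ‖S.pr i x (J.p x g)‖) := by ring
      _ ≤ _ := by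
        refine mul_le_mul_of_nonneg_right ?_ (mul_nonneg (hw0 i x).le (norm_nonneg _))
        have : 0 ≤ (∑ i, |M i|) * (C₀ * Cp) := by positivity
        linarith

/-- An operator which contracts the norm of the `(i, j)` entry with respect to the weighted
lengths has a power of norm less than one. -/
theorem LineSplitting.exists_norm_pow_lt_one {w : Fin d → X → ℝ} (hw : ∀ i, Continuous (w i))
    (hw0 : ∀ i x, 0 < w i x) (i j : Fin d) (U : EndoFamily X G →L[ℝ] EndoFamily X G) {ρ : ℝ}
    (hρ : 0 ≤ ρ) (hρ1 : ρ < 1)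
    (hU : ∀ M κ, 0 ≤ κ →
      (∀ x g, w i x * ‖S.pr i x (J.p x (M.app x g))‖ ≤ κ * (w j x * ‖S.pr j x (J.p x g)‖)) →
      ∀ x g, w i x * ‖S.pr i x (J.p x ((U M).app x g))‖ ≤ ρ * κ * (w j x * ‖S.pr j x (J.p x g)‖)) :
    ∃ n : ℕ, ‖((ContinuousLinearMap.mulLeftRight ℝ _ (J.liftPr S i) (J.liftPr S j)).comp U) ^ n‖
      < 1 := by
  obtain ⟨C, hC, hbound⟩ := LineSplitting.exists_weight_bound (S := S) J hw hw0
  set U' := (ContinuousLinearMap.mulLeftRight ℝ _ (J.liftPr S i) (J.liftPr S j)).comp U with hU'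
  have hU'_apply : ∀ M, U' M = J.liftPr S i * U M * J.liftPr S j := fun M => by
    simp [hU']
  have hi : ∀ M, J.liftPr S i * U' M = U' M := fun M => by
    rw [hU'_apply, ← mul_assoc, ← mul_assoc, J.liftPr_mul_self]
  have hcomp : ∀ M x g, w i x * ‖S.pr i x (J.p x ((U' M).app x g))‖ =
      w i x * ‖S.pr i x (J.p x ((U M).app x ((J.liftPr S j).app x g)))‖ := fun M x g => by
    rw [hU'_apply]
    change _ * ‖S.pr i x (J.p x ((J.liftPr S i).app x ((U M).app x ((J.liftPr S j).app x g))))‖ = _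
    rw [J.liftPr_apply S i, J.p_j, S.pr_pr_self]
  have hj : ∀ x g, S.pr j x (J.p x ((J.liftPr S j).app x g)) = S.pr j x (J.p x g) := fun x g => by
    rw [J.liftPr_apply, J.p_j, S.pr_pr_self]
  refine CocycleStability.exists_norm_pow_lt_one U' (fun M κ => J.liftPr S i * M = M ∧
    ∀ x g, w i x * ‖S.pr i x (J.p x (M.app x g))‖ ≤ κ * (w j x * ‖S.pr j x (J.p x g)‖))
    (C := C + C * ‖U‖ * C + C * C) (by positivity) hρ hρ1 ?_ ?_ ?_
  · refine fun M => ⟨hi M, fun x g => ?_⟩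
    rw [hcomp]
    have h0 : 0 ≤ w j x * ‖S.pr j x (J.p x g)‖ := mul_nonneg (hw0 j x).le (norm_nonneg _)
    calc _ ≤ C * ‖(U M).app x ((J.liftPr S j).app x g)‖ := (hbound i x _).1
      _ ≤ C * ((‖U‖ * ‖M‖) * (C * (w j x * ‖S.pr j x (J.p x g)‖))) := by
        refine mul_le_mul_of_nonneg_left (((U M).norm_app_apply_le x _).trans ?_) hC.le
        exact mul_le_mul (U.le_opNorm M) (hbound j x g).2
          (norm_nonneg _) (by positivity)
      _ = (C * ‖U‖ * C) * (‖M‖ * (w j x * ‖S.pr j x (J.p x g)‖)) := by ring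
      _ ≤ (C + C * ‖U‖ * C + C * C) * (‖M‖ * (w j x * ‖S.pr j x (J.p x g)‖)) := by
        refine mul_le_mul_of_nonneg_right ?_ (by positivity)
        nlinarith
      _ = _ := by ring
  · refine fun M κ hκ h => ⟨hi M, fun x g => ?_⟩
    rw [hcomp]
    refine (hU M κ hκ h.2 x _).trans (le_of_eq ?_)
    rw [hj]
  · refine fun M κ hκ h => M.norm_le_of_app (by positivity) fun x g => ?_
    have h1 : M.app x g = (J.liftPr S i).app x (M.app x g) := by
      conv_lhs => rw [← h.1]
      rfl
    rw [h1]
    calc _ ≤ C * (κ * (C * ‖g‖)) := (hbound i x _).2.trans (mul_le_mul_of_nonneg_left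
          ((h.2 x g).trans (mul_le_mul_of_nonneg_left (hbound j x g).1 hκ)) hC.le)
      _ = (C * C) * (κ * ‖g‖) := by ring
      _ ≤ (C + C * ‖U‖ * C + C * C) * (κ * ‖g‖) := by
        refine mul_le_mul_of_nonneg_right ?_ (by positivity)
        have : 0 ≤ C * ‖U‖ * C := by positivity
        linarith
      _ = _ := by ring

end Geometric

section LinearConjugacy

variable {X : Type*} [MetricSpace X] [CompactSpace X]
  {F : Type*} [NormedAddCommGroup F] [NormedSpace ℝ F] [FiniteDimensional ℝ F]
  {V : X → Type*} [TopologicalSpace (TotalSpace F V)]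
  [∀ x, NormedAddCommGroup (V x)] [∀ x, InnerProductSpace ℝ (V x)]
  [FiberBundle F V] [VectorBundle ℝ F V] [IsContinuousRiemannianBundle F V]
  {G : Type*} [NormedAddCommGroup G] [NormedSpace ℝ G] [FiniteDimensional ℝ G]
  {T : X ≃ₜ X} {d : ℕ} {S : LineSplitting F V d} (J : FiberEmbedding F V G)
  {A : Cocycle F V T} {w α : Fin d → X → ℝ} {c : ℝ}

namespace LineSplitting

variable (S) in
/-- The diagonal entries of an endomorphism are multiples of the projections onto the lines. -/
theorem exists_diagonal_entry (M : EndoFamily X G) (i : Fin d) :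
    ∃ t : X → ℝ, Continuous t ∧ (∀ x, |t x| ≤ ‖J.liftPr S i * M‖) ∧
      ∀ x v, S.pr i x (J.p x (M.app x (J.j x (S.pr i x v)))) = t x • S.pr i x v := by
  have h1 : ∀ x, ∃ t : ℝ, ∀ v, S.pr i x (J.p x (M.app x (J.j x (S.pr i x v)))) = t • S.pr i x v := by
    intro x
    obtain ⟨v₀, hv₀⟩ := S.exists_ne i x
    obtain ⟨t, ht⟩ := S.rank_one i x (J.p x (M.app x (J.j x (S.pr i x v₀)))) v₀ hv₀
    refine ⟨t, fun v => ?_⟩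
    obtain ⟨c, hc⟩ := S.rank_one i x v v₀ hv₀
    rw [hc, map_smul, map_smul, map_smul, map_smul, ht, smul_comm]
  choose t ht using h1
  have hlift : ∀ x g, (J.liftPr S i * M * J.liftPr S i).app x g = t x • (J.liftPr S i).app x g :=
    fun x g => by
      simp only [EndoFamily.app_mul, J.liftPr_apply]
      rw [ht, map_smul]
  have hne : ∀ x, ∃ g, (J.liftPr S i).app x g ≠ 0 := fun x => by
    obtain ⟨v₀, hv₀⟩ := S.exists_ne i x
    refine ⟨J.j x v₀, fun h => hv₀ (J.j_injective x ?_)⟩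
    rw [J.liftPr_apply, J.p_j] at h
    rw [h, map_zero]
  refine ⟨t, ?_, ?_, ht⟩
  · refine continuous_iff_continuousAt.2 fun x₀ => ?_
    obtain ⟨g, hg⟩ := hne x₀
    obtain ⟨f, -, hf⟩ := exists_dual_vector ℝ _ (norm_ne_zero_iff.2 hg)
    have hc : ∀ N : EndoFamily X G, Continuous fun x => f (N.app x g) := fun N =>
      f.continuous.comp (N.continuous_app.clm_apply continuous_const)
    have hf0 : f ((J.liftPr S i).app x₀ g) ≠ 0 := by
      rw [hf]; exact_mod_cast (norm_pos_iff.2 hg).ne'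
    have h2 : ContinuousAt (fun x => f ((J.liftPr S i * M * J.liftPr S i).app x g) /
        f ((J.liftPr S i).app x g)) x₀ :=
      (hc _).continuousAt.div (hc _).continuousAt hf0
    refine h2.congr ?_
    filter_upwards [(hc (J.liftPr S i)).continuousAt.eventually_ne hf0] with x hx
    rw [hlift, map_smul, smul_eq_mul, mul_div_cancel_right₀ _ hx]
  · intro x
    obtain ⟨g, hg⟩ := hne x
    have h3 := (J.liftPr S i * M).norm_app_apply_le x ((J.liftPr S i).app x g)
    have h4 := hlift x g
    rw [EndoFamily.app_mul] at h4
    rw [h4, norm_smul, Real.norm_eq_abs] at h3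
    exact le_of_mul_le_mul_right h3 (norm_pos_iff.2 hg)

end LineSplitting

namespace LineSplitting.Adapted

theorem liftInv_mul_lift : J.liftInv A * J.lift A = ∑ i, J.liftPr S i :=
  EndoFamily.ext_app fun x g => by
    rw [J.sum_liftPr_apply, EndoFamily.app_mul, J.lift_apply, J.liftInv_apply, J.p_j,
      LinearEquiv.symm_apply_apply]

theorem lift_mul_liftInv : J.lift A * J.liftInv A = EndoFamily.comp G T (∑ i, J.liftPr S i) :=
  EndoFamily.ext_app fun x g => by
    rw [EndoFamily.app_comp, J.sum_liftPr_apply, EndoFamily.app_mul, J.lift_apply,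
      J.liftInv_apply, J.p_j, LinearEquiv.apply_symm_apply]

theorem liftInv_mul_comp :
    J.liftInv A * EndoFamily.comp G T (∑ i, J.liftPr S i) = J.liftInv A :=
  EndoFamily.ext_app fun x g => by
    rw [EndoFamily.app_mul, EndoFamily.app_comp, J.sum_liftPr_apply, J.liftInv_apply, J.p_j,
      J.liftInv_apply]

theorem comp_mul_lift (B : Cocycle F V T) :
    EndoFamily.comp G T (∑ i, J.liftPr S i) * J.lift B = J.lift B :=
  EndoFamily.ext_app fun x g => by
    rw [EndoFamily.app_mul, EndoFamily.app_comp, J.sum_liftPr_apply, J.lift_apply, J.p_j]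

variable (h : S.Adapted A w α c)

include h in
theorem symm_pr (i : Fin d) (x : X) (v : V (T x)) :
    (A.fib x).symm (S.pr i (T x) v) = S.pr i x ((A.fib x).symm v) := by
  rw [LinearEquiv.symm_apply_eq, h.commute, LinearEquiv.apply_symm_apply]

include h in
theorem lift_mul_liftPr (i : Fin d) :
    J.lift A * J.liftPr S i = EndoFamily.comp G T (J.liftPr S i) * J.lift A :=
  EndoFamily.ext_app fun x g => by
    simp [J.lift_apply, J.liftPr_apply, J.p_j, h.commute]

include h in
theorem liftPr_mul_liftInv (i : Fin d) :
    J.liftPr S i * J.liftInv A = J.liftInv A * EndoFamily.comp G T (J.liftPr S i) :=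
  EndoFamily.ext_app fun x g => by
    simp [J.liftInv_apply, J.liftPr_apply, J.p_j, h.symm_pr]

include h in
theorem transfer_entry (i j : Fin d) (M : EndoFamily X G) :
    EndoFamily.transfer T (J.lift A) (J.liftInv A) (J.liftPr S i * M * J.liftPr S j) =
      J.liftPr S i * EndoFamily.transfer T (J.lift A) (J.liftInv A) M * J.liftPr S j := by
  simp only [EndoFamily.transfer_apply, map_mul]
  rw [← mul_assoc, ← mul_assoc, ← h.liftPr_mul_liftInv, mul_assoc, mul_assoc, mul_assoc,
    ← h.lift_mul_liftPr]
  simp only [mul_assoc]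

/-- The inverse of the operator `transfer T (J.lift A) (J.liftInv A)`. -/
def invTransfer (A : Cocycle F V T) : EndoFamily X G →L[ℝ] EndoFamily X G :=
  EndoFamily.transfer T.symm (EndoFamily.comp G T.symm (J.liftInv A))
    (EndoFamily.comp G T.symm (J.lift A))

theorem invTransfer_app (M : EndoFamily X G) (x : X) (g : G) :
    (invTransfer J A M).app (T x) g = (J.lift A).app x (M.app x ((J.liftInv A).app x g)) := by
  simp [invTransfer, EndoFamily.transfer_apply]

include h in
theorem invTransfer_entry (i j : Fin d) (M : EndoFamily X G) :
    invTransfer J A (J.liftPr S i * M * J.liftPr S j) =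
      J.liftPr S i * invTransfer J A M * J.liftPr S j := by
  refine EndoFamily.ext_app fun y g => ?_
  obtain ⟨x, rfl⟩ := T.surjective y
  have h1 : ∀ g, (J.lift A).app x ((J.liftPr S i).app x g) =
      (J.liftPr S i).app (T x) ((J.lift A).app x g) := fun g => by
    simp [J.lift_apply, J.liftPr_apply, J.p_j, h.commute]
  have h2 : ∀ g, (J.liftPr S j).app x ((J.liftInv A).app x g) =
      (J.liftInv A).app x ((J.liftPr S j).app (T x) g) := fun g => by
    simp [J.liftInv_apply, J.liftPr_apply, J.p_j, h.symm_pr]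
  rw [invTransfer_app]
  simp only [EndoFamily.app_mul]
  rw [h1, h2, invTransfer_app]

theorem transfer_invTransfer (i j : Fin d) (M : EndoFamily X G) :
    EndoFamily.transfer T (J.lift A) (J.liftInv A)
      (invTransfer J A (J.liftPr S i * M * J.liftPr S j)) = J.liftPr S i * M * J.liftPr S j := by
  refine EndoFamily.ext_app fun x g => ?_
  rw [EndoFamily.transfer_apply]
  simp only [EndoFamily.app_mul, EndoFamily.app_comp, invTransfer_app]
  simp [J.lift_apply, J.liftInv_apply, J.liftPr_apply, J.p_j]

include h in
theorem length_symm (i : Fin d) (x : X) (v : V (T x)) :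
    w i x * ‖S.pr i x ((A.fib x).symm v)‖ =
      Real.exp (-α i x) * (w i (T x) * ‖S.pr i (T x) v‖) := by
  have := h.length i x ((A.fib x).symm v)
  rw [LinearEquiv.apply_symm_apply] at this
  rw [this, ← mul_assoc, ← Real.exp_add, neg_add_cancel, Real.exp_zero, one_mul]

include h in
theorem exists_norm_transfer_pow_lt (hc : 0 < c) {i j : Fin d} (hij : j < i) : ∃ n : ℕ,
    ‖((ContinuousLinearMap.mulLeftRight ℝ _ (J.liftPr S i) (J.liftPr S j)).comp
      (EndoFamily.transfer T (J.lift A) (J.liftInv A))) ^ n‖ < 1 := by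
  refine LineSplitting.exists_norm_pow_lt_one J h.continuous_w h.w_pos i j _ (Real.exp_pos (-c)).le
    (Real.exp_lt_one_iff.2 (neg_lt_zero.2 hc)) fun M κ hκ hM x g => ?_
  rw [EndoFamily.transfer_apply]
  simp only [EndoFamily.app_mul, EndoFamily.app_comp, J.liftInv_apply, J.p_j, h.length_symm]
  have h1 := hM (T x) ((J.lift A).app x g)
  rw [J.lift_apply, J.p_j, h.length] at h1
  have h2 : Real.exp (-α i x) * Real.exp (α j x) ≤ Real.exp (-c) := by
    rw [← Real.exp_add, Real.exp_le_exp]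
    linarith [h.gap j i hij x]
  have h3 : 0 ≤ w j x * ‖S.pr j x (J.p x g)‖ := mul_nonneg (h.w_pos j x).le (norm_nonneg _)
  calc _ ≤ Real.exp (-α i x) * (κ * (Real.exp (α j x) * (w j x * ‖S.pr j x (J.p x g)‖))) :=
        mul_le_mul_of_nonneg_left h1 (Real.exp_pos _).le
    _ = (Real.exp (-α i x) * Real.exp (α j x)) * (κ * (w j x * ‖S.pr j x (J.p x g)‖)) := by ring
    _ ≤ Real.exp (-c) * (κ * (w j x * ‖S.pr j x (J.p x g)‖)) :=
      mul_le_mul_of_nonneg_right h2 (by positivity)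
    _ = _ := by ring

include h in
theorem exists_norm_invTransfer_pow_lt (hc : 0 < c) {i j : Fin d} (hij : i < j) : ∃ n : ℕ,
    ‖((ContinuousLinearMap.mulLeftRight ℝ _ (J.liftPr S i) (J.liftPr S j)).comp
      (invTransfer J A)) ^ n‖ < 1 := by
  refine LineSplitting.exists_norm_pow_lt_one J h.continuous_w h.w_pos i j _ (Real.exp_pos (-c)).le
    (Real.exp_lt_one_iff.2 (neg_lt_zero.2 hc)) fun M κ hκ hM y g => ?_
  obtain ⟨x, rfl⟩ := T.surjective y
  rw [invTransfer_app, J.lift_apply, J.p_j, h.length]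
  have h1 := hM x ((J.liftInv A).app x g)
  rw [J.liftInv_apply, J.p_j, h.length_symm] at h1
  have h2 : Real.exp (α i x) * Real.exp (-α j x) ≤ Real.exp (-c) := by
    rw [← Real.exp_add, Real.exp_le_exp]
    linarith [h.gap i j hij x]
  have h3 : 0 ≤ w j (T x) * ‖S.pr j (T x) (J.p (T x) g)‖ :=
    mul_nonneg (h.w_pos j _).le (norm_nonneg _)
  calc _ ≤ Real.exp (α i x) *
        (κ * (Real.exp (-α j x) * (w j (T x) * ‖S.pr j (T x) (J.p (T x) g)‖))) :=
        mul_le_mul_of_nonneg_left h1 (Real.exp_pos _).le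
    _ = (Real.exp (α i x) * Real.exp (-α j x)) *
        (κ * (w j (T x) * ‖S.pr j (T x) (J.p (T x) g)‖)) := by ring
    _ ≤ Real.exp (-c) * (κ * (w j (T x) * ‖S.pr j (T x) (J.p (T x) g)‖)) :=
      mul_le_mul_of_nonneg_right h2 (by positivity)
    _ = _ := by ring

theorem _root_.CocycleStability.abs_log_one_add_le {t : ℝ} (ht : |t| ≤ 1 / 2) :
    |Real.log (1 + t)| ≤ 2 * |t| := by
  have h1 := abs_le.1 ht
  have hpos : 0 < 1 + t := by linarith
  have hu := Real.log_le_sub_one_of_pos hpos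
  have hl := Real.one_sub_inv_le_log_of_pos hpos
  have hl' : -(2 * |t|) ≤ 1 - (1 + t)⁻¹ := by
    have e : 1 - (1 + t)⁻¹ = t / (1 + t) := by field_simp; ring
    rw [e, le_div_iff₀ hpos]
    rcases abs_cases t with ⟨h, _⟩ | ⟨h, _⟩ <;> rw [h] <;> nlinarith
  rw [abs_le]
  exact ⟨by linarith, by linarith [le_abs_self t, abs_nonneg t]⟩

include h in
/-- A cocycle near one which is block diagonal and dominated along a splitting into lines is
linearly conjugate to a cocycle which is diagonal along the same splitting. -/
theorem exists_projConj_of_near (hc : 0 < c) {ε : ℝ} (hε : 0 < ε) :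
    ∃ η > 0, ∀ B : Cocycle F V T, (∀ x u, ‖B.fib x u - A.fib x u‖ ≤ η * ‖u‖) →
      ∃ (γ : Fin d → X → ℝ) (hγ : ∀ i, Continuous (γ i)), (∀ i x, |γ i x| ≤ ε) ∧
        Cocycle.ProjConj ε (S.scale A hγ) B := by
  obtain ⟨t, ⟨J⟩⟩ := exists_fiberEmbedding (F := F) (V := V)
  obtain ⟨Cp, hCp, hp⟩ := J.exists_norm_p_le
  obtain ⟨Cj, hCj, hj⟩ := J.exists_norm_j_le
  obtain ⟨K, hK⟩ := exists_offdiag_inverse (J.liftPr_mul_self S) (J.liftPr_mul_ne S)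
    (h.transfer_entry J) (h.invTransfer_entry J) (transfer_invTransfer J (A := A))
    (fun i j hij => h.exists_norm_transfer_pow_lt J hc hij)
    (fun i j hij => h.exists_norm_invTransfer_pow_lt J hc hij)
  set Cpr := ∑ i, ‖J.liftPr S i‖ with hCpr
  have hCpr0 : 0 ≤ Cpr := Finset.sum_nonneg fun i _ => norm_nonneg _
  set ε' := min (ε / (2 * (Cp * Cj + 1))) (min (1 / (2 * (Cp * Cj + 1)))
    (min (1 / (2 * (Cpr + 1))) (ε / (2 * (Cpr + 1))))) with hε'
  have hε'0 : 0 < ε' := by positivity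
  obtain ⟨η, hη, key⟩ := exists_block_conjugacy (J.liftPr_mul_self S) (J.liftPr_mul_ne S)
    (EndoFamily.comp _ T) (fun M => EndoFamily.transfer_apply T _ _ M) (h.transfer_entry J) hK
    (liftInv_mul_lift J) (lift_mul_liftInv J) (liftInv_mul_comp J) (comp_mul_lift J A) hε'0
  refine ⟨η / (‖J.liftInv A‖ * (Cj * Cp) + 1), by positivity, fun B hB => ?_⟩
  have hPsmall : ‖J.liftInv A * (J.lift B - J.lift A)‖ ≤ η := by
    have hd : ‖J.lift B - J.lift A‖ ≤ Cj * Cp * (η / (‖J.liftInv A‖ * (Cj * Cp) + 1)) := by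
      refine EndoFamily.norm_le_of_app _ (by positivity) fun x g => ?_
      rw [EndoFamily.app_sub, J.lift_apply, J.lift_apply, ← map_sub]
      calc _ ≤ Cj * (η / (‖J.liftInv A‖ * (Cj * Cp) + 1) * (Cp * ‖g‖)) :=
            (hj _ _).trans (mul_le_mul_of_nonneg_left ((hB x _).trans
              (mul_le_mul_of_nonneg_left (hp x g) (by positivity))) hCj.le)
        _ = _ := by ring
    refine (norm_mul_le _ _).trans ((mul_le_mul_of_nonneg_left hd (norm_nonneg _)).trans ?_)
    calc _ = η * ((‖J.liftInv A‖ * (Cj * Cp)) / (‖J.liftInv A‖ * (Cj * Cp) + 1)) := by ring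
      _ ≤ η * 1 := by
        refine mul_le_mul_of_nonneg_left ((div_le_one (by positivity)).2 (by linarith)) hη.le
      _ = η := mul_one η
  obtain ⟨Q, M, hQ, hM, hconj⟩ := key (J.lift B) (comp_mul_lift J B) hPsmall
  -- the diagonal of `M` acts on the `i`-th line as the multiplication by a function `s i`
  choose s hs hs1 hs2 using fun i => S.exists_diagonal_entry J M i
  have hsle : ∀ i x, |s i x| ≤ Cpr * ε' := fun i x =>
    (hs1 i x).trans ((norm_mul_le _ _).trans (mul_le_mul
      (Finset.single_le_sum (f := fun i => ‖J.liftPr S i‖) (fun i _ => norm_nonneg _)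
        (Finset.mem_univ i)) hM (norm_nonneg _) hCpr0))
  have hsle1 : ∀ i x, |s i x| ≤ 1 / 2 := fun i x => by
    refine (hsle i x).trans ?_
    calc Cpr * ε' ≤ (Cpr + 1) * (1 / (2 * (Cpr + 1))) :=
          mul_le_mul (by linarith) ((min_le_right _ _).trans ((min_le_right _ _).trans
            (min_le_left _ _))) hε'0.le (by positivity)
      _ = 1 / 2 := by field_simp
  have hsle2 : ∀ i x, |s i x| ≤ ε / 2 := fun i x => by
    refine (hsle i x).trans ?_
    calc Cpr * ε' ≤ (Cpr + 1) * (ε / (2 * (Cpr + 1))) :=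
          mul_le_mul (by linarith) ((min_le_right _ _).trans ((min_le_right _ _).trans
            (min_le_right _ _))) hε'0.le (by positivity)
      _ = ε / 2 := by field_simp
  have hspos : ∀ i x, 0 < 1 + s i x := fun i x => by linarith [(abs_le.1 (hsle1 i x)).1]
  refine ⟨fun i x => Real.log (1 + s i x), fun i => (continuous_const.add (hs i)).log
    fun x => (hspos i x).ne', fun i x => ?_, ?_⟩
  · exact (abs_log_one_add_le (hsle1 i x)).trans (by linarith [hsle2 i x])
  have hQle : ∀ x v, ‖J.p x (Q.app x (J.j x v))‖ ≤ Cp * Cj * ε' * ‖v‖ := fun x v => by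
    calc _ ≤ Cp * (ε' * (Cj * ‖v‖)) := (hp _ _).trans (mul_le_mul_of_nonneg_left
          ((Q.norm_app_apply_le x _).trans (mul_le_mul hQ (hj x v) (norm_nonneg _) hε'0.le)) hCp.le)
      _ = _ := by ring
  have hle1 : Cp * Cj * ε' ≤ 1 / 2 := by
    calc Cp * Cj * ε' ≤ (Cp * Cj + 1) * (1 / (2 * (Cp * Cj + 1))) :=
          mul_le_mul (by linarith) ((min_le_right _ _).trans (min_le_left _ _)) hε'0.le
            (by positivity)
      _ = 1 / 2 := by field_simp
  have hle2 : Cp * Cj * ε' ≤ ε / 2 := by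
    calc Cp * Cj * ε' ≤ (Cp * Cj + 1) * (ε / (2 * (Cp * Cj + 1))) :=
          mul_le_mul (by linarith) (min_le_left _ _) hε'0.le (by positivity)
      _ = ε / 2 := by field_simp
  -- the conjugacy `∑ i, ϖ i + Q`, read in the fibers of `V`
  let H : ∀ x, V x →ₗ[ℝ] V x := fun x =>
    LinearMap.id + (J.p x ∘L Q.app x ∘L J.j x).toLinearMap
  have hH : ∀ x v, H x v = v + J.p x (Q.app x (J.j x v)) := fun x v => rfl
  refine Cocycle.ProjConj.of_homogeneous (ε' := ε / 2) (half_lt_self hε) (fun x => H x) ?_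
    (fun x c v _ => map_smul _ _ _) (fun x => map_zero _) ?_ ?_ ?_
  · refine Continuous.comp (g := fun z : TotalSpace F V => (⟨z.proj, H z.proj z.snd⟩ :
      TotalSpace F V)) ?_ continuous_subtype_val
    refine (J.continuous_mk_iff (b := fun z : TotalSpace F V => z.proj)).2
      ⟨FiberBundle.continuous_proj F V, ?_⟩
    have hr : Continuous fun z : TotalSpace F V => J.j z.proj z.snd := J.continuous_j
    have hq : Continuous fun z : TotalSpace F V => Q.app z.proj (J.j z.proj z.snd) :=
      (Q.continuous_app.comp (FiberBundle.continuous_proj F V)).clm_apply hr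
    have hpq : Continuous fun z : TotalSpace F V =>
        J.j z.proj (J.p z.proj (Q.app z.proj (J.j z.proj z.snd))) :=
      J.continuous_j.comp (J.continuous_p.comp ((FiberBundle.continuous_proj F V).prodMk hq))
    refine (hr.add hpq).congr fun z => ?_
    rw [hH, map_add]
    rfl
  · intro x
    have := finite_fiber F V x
    have hinj : Function.Injective (H x) := by
      refine (injective_iff_map_eq_zero (H x)).2 fun v hv => ?_
      by_contra hv0
      have h1 := hQle x v
      have h2 : J.p x (Q.app x (J.j x v)) = -v := by
        rw [hH] at hv
        exact eq_neg_of_add_eq_zero_right hv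
      rw [h2, norm_neg] at h1
      have := norm_pos_iff.2 hv0
      nlinarith
    exact ⟨hinj, LinearMap.injective_iff_surjective.1 hinj⟩
  · intro x v _
    refine ⟨1, ?_⟩
    rw [one_smul, S.scale_fib]
    have h1 := congrArg (fun N : EndoFamily X _ => J.p (T x) (N.app x (J.j x v))) hconj
    have hdiag : (∑ i, J.liftPr S i + ∑ i, J.liftPr S i * M * J.liftPr S i).app x (J.j x v) =
        J.j x (S.diag (fun i x => Real.log (1 + s i x)) x v) := by
      rw [EndoFamily.app_add, J.sum_liftPr_apply, J.p_j, EndoFamily.app_sum, S.diag_apply]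
      simp only [EndoFamily.app_mul, J.liftPr_apply, J.p_j, hs2]
      conv_lhs => rw [← S.sum_pr x v]
      rw [← map_sum, ← map_add, ← Finset.sum_add_distrib]
      refine congrArg _ (Finset.sum_congr rfl fun i _ => ?_)
      rw [Real.exp_log (hspos i x), add_smul, one_smul, S.sum_pr]
    have hZ : ∀ y u, (∑ i, J.liftPr S i + Q).app y (J.j y u) = J.j y u + Q.app y (J.j y u) :=
      fun y u => by rw [EndoFamily.app_add, J.sum_liftPr_apply, J.p_j]
    simp only [EndoFamily.app_mul, EndoFamily.app_comp] at h1
    rw [hdiag, hZ, J.lift_apply, J.lift_apply, J.p_j, hZ, J.p_j, map_add, map_add, J.p_j,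
      J.p_j] at h1
    rw [hH, hH]
    exact h1
  · intro x v
    have : H x v - v = J.p x (Q.app x (J.j x v)) := by rw [hH]; abel
    change ‖H x v - v‖ ≤ _
    rw [this]
    exact (hQle x v).trans (mul_le_mul_of_nonneg_right hle2 (norm_nonneg _))

end LineSplitting.Adapted

end LinearConjugacy

/-! ### The splitting into line bundles given by the dominated splittings -/

section Iterates

variable {X : Type*} [MetricSpace X]
  {F : Type*} [NormedAddCommGroup F] [NormedSpace ℝ F]
  {V : X → Type*} [TopologicalSpace (TotalSpace F V)]
  [∀ x, NormedAddCommGroup (V x)] [∀ x, InnerProductSpace ℝ (V x)]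
  {T : X ≃ₜ X} (A : Cocycle F V T)

namespace Cocycle

/-- The iterates of a cocycle on the fibers. -/
def pow : ∀ (n : ℕ) (x : X), V x ≃ₗ[ℝ] V (T^[n] x)
  | 0, _ => LinearEquiv.refl ℝ _
  | n + 1, x => (A.fib x).trans (pow n (T x))

theorem iterate_map (n : ℕ) (x : X) (u : V x) : A.map^[n] ⟨x, u⟩ = ⟨T^[n] x, A.pow n x u⟩ := by
  induction n generalizing x with
  | zero => rfl
  | succ n ih => exact ih (T x) (A.fib x u)

theorem norm_pow_add (m n : ℕ) (x : X) (u : V x) :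
    ‖A.pow (m + n) x u‖ = ‖A.pow m (T^[n] x) (A.pow n x u)‖ := by
  have h : A.map^[m + n] ⟨x, u⟩ = A.map^[m] (A.map^[n] ⟨x, u⟩) := Function.iterate_add_apply _ _ _ _
  rw [A.iterate_map, A.iterate_map, A.iterate_map] at h
  exact congrArg (fun z : TotalSpace F V => ‖z.snd‖) h

theorem pow_commute {P : ∀ x, V x →L[ℝ] V x} (hP : ∀ x v, A.fib x (P x v) = P (T x) (A.fib x v))
    (n : ℕ) (x : X) (v : V x) : A.pow n x (P x v) = P (T^[n] x) (A.pow n x v) := by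
  induction n generalizing x with
  | zero => rfl
  | succ n ih =>
    change A.pow n (T x) (A.fib x (P x v)) = _
    rw [hP, ih]
    rfl

end Cocycle

/-- A family of projections of rank `i` which defines a dominated splitting of index `i`: the first
bundle, which is the weaker one, consists of the ranges, and the second one of the kernels. With
every `N` iterates, the ranges are contracted at least twice as much as the kernels. -/
structure DominatedProjection (A : Cocycle F V T) (i N : ℕ) where
  /-- The projections. -/
  P : ∀ x, V x →L[ℝ] V x
  idem : ∀ x v, P x (P x v) = P x v
  commute : ∀ x v, A.fib x (P x v) = P (T x) (A.fib x v)
  finrank_range : ∀ x, Module.finrank ℝ (LinearMap.range (P x).toLinearMap) = i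
  continuous_P : Continuous fun z : TotalSpace F V => (⟨z.proj, P z.proj z.snd⟩ : TotalSpace F V)
  dom : ∀ x u v, P x u = u → P x v = 0 → ∀ k : ℕ,
    ‖A.pow (N * k) x u‖ * ‖v‖ ≤ (1 / 2) ^ k * (‖u‖ * ‖A.pow (N * k) x v‖)

/-- A family of invariant projections is dominated if it is so for one iterate. -/
theorem dominated_iterate {A : Cocycle F V T} {N : ℕ} {P : ∀ x, V x →L[ℝ] V x}
    (hP : ∀ x v, A.fib x (P x v) = P (T x) (A.fib x v))
    (h : ∀ x u v, P x u = u → P x v = 0 → ‖A.pow N x u‖ * ‖v‖ ≤ 1 / 2 * (‖u‖ * ‖A.pow N x v‖))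
    (x : X) (u v : V x) (hu : P x u = u) (hv : P x v = 0) (k : ℕ) :
    ‖A.pow (N * k) x u‖ * ‖v‖ ≤ (1 / 2) ^ k * (‖u‖ * ‖A.pow (N * k) x v‖) := by
  rcases eq_or_ne v 0 with rfl | hv0
  · simp
  induction k with
  | zero =>
    rw [pow_zero, one_mul]
    exact le_rfl
  | succ k ih =>
    rw [Nat.mul_succ, add_comm (N * k) N, A.norm_pow_add, A.norm_pow_add]
    have h1 := h (T^[N * k] x) (A.pow (N * k) x u) (A.pow (N * k) x v)
      (by rw [← A.pow_commute hP, hu]) (by rw [← A.pow_commute hP, hv, map_zero])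
    have h2 : 0 < ‖A.pow (N * k) x v‖ :=
      norm_pos_iff.2 ((A.pow (N * k) x).map_ne_zero_iff.2 hv0)
    set a := ‖A.pow N (T^[N * k] x) (A.pow (N * k) x u)‖
    set b := ‖A.pow N (T^[N * k] x) (A.pow (N * k) x v)‖
    refine le_of_mul_le_mul_right ?_ h2
    have hb : 0 ≤ b := norm_nonneg _
    calc a * ‖v‖ * ‖A.pow (N * k) x v‖ = (a * ‖A.pow (N * k) x v‖) * ‖v‖ := by ring
      _ ≤ (1 / 2 * (‖A.pow (N * k) x u‖ * b)) * ‖v‖ :=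
        mul_le_mul_of_nonneg_right h1 (norm_nonneg _)
      _ = 1 / 2 * b * (‖A.pow (N * k) x u‖ * ‖v‖) := by ring
      _ ≤ 1 / 2 * b * ((1 / 2) ^ k * (‖u‖ * ‖A.pow (N * k) x v‖)) :=
        mul_le_mul_of_nonneg_left ih (by positivity)
      _ = _ := by ring

variable {A}

/-- The domination is inherited by the multiples of `N`. -/
def DominatedProjection.ofDvd {i N N' : ℕ} (D : DominatedProjection A i N) (hN' : N' ≠ 0)
    (h : N ∣ N') : DominatedProjection A i N' where
  P := D.P
  idem := D.idem
  commute := D.commute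
  finrank_range := D.finrank_range
  continuous_P := D.continuous_P
  dom x u v hu hv k := by
    obtain ⟨m, rfl⟩ := h
    have hm : 1 ≤ m := Nat.one_le_iff_ne_zero.2 fun hm => hN' (by simp [hm])
    rw [mul_assoc]
    refine (D.dom x u v hu hv (m * k)).trans (mul_le_mul_of_nonneg_right ?_ (by positivity))
    exact pow_le_pow_of_le_one (by norm_num) (by norm_num) (Nat.le_mul_of_pos_left k hm)

end Iterates

section Projection

variable {X : Type*} [MetricSpace X]
  {F : Type*} [NormedAddCommGroup F] [NormedSpace ℝ F] [FiniteDimensional ℝ F]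
  {V : X → Type*} [TopologicalSpace (TotalSpace F V)]
  [∀ x, NormedAddCommGroup (V x)] [∀ x, InnerProductSpace ℝ (V x)]
  [FiberBundle F V] [VectorBundle ℝ F V]

/-- A bundle map which has constant coefficients in a continuous local frame is continuous. -/
theorem continuousAt_of_frame {ι : Type*} [Fintype ι] (b : Module.Basis ι ℝ F) (x₀ : X)
    (s : ι → ∀ x, V x) (hs : ∀ k, ContinuousAt (fun x => (⟨x, s k x⟩ : TotalSpace F V)) x₀)
    (hli : ∀ᶠ x in 𝓝 x₀, LinearIndependent ℝ fun k => s k x) (m : ι → ℝ)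
    (P : ∀ x, V x →L[ℝ] V x) (hP : ∀ᶠ x in 𝓝 x₀, ∀ k, P x (s k x) = m k • s k x) (v₀ : V x₀) :
    ContinuousAt (fun z : TotalSpace F V => (⟨z.proj, P z.proj z.snd⟩ : TotalSpace F V))
      ⟨x₀, v₀⟩ := by
  set e := trivializationAt F V x₀ with he
  have hx₀ : x₀ ∈ e.baseSet := FiberBundle.mem_baseSet_trivializationAt' _
  let φ : ∀ x, F →ₗ[ℝ] V x := fun x => b.constr ℝ fun k => s k x
  let M : X → F →L[ℝ] F := fun x =>
    ∑ k, (LinearMap.toContinuousLinearMap (b.coord k)).smulRight (e.continuousLinearMapAt ℝ x (s k x))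
  have hφ_apply : ∀ x g, φ x g = ∑ k, b.repr g k • s k x := fun x g =>
    b.constr_apply_fintype ℝ _ g
  have hφ_basis : ∀ x k, φ x (b k) = s k x := fun x k => b.constr_basis ℝ _ k
  have hM : ∀ x g, M x g = e.continuousLinearMapAt ℝ x (φ x g) := fun x g => by
    rw [hφ_apply, map_sum]
    simp only [M, sum_apply, map_smul]
    rfl
  have hMc : ContinuousAt M x₀ := by
    refine tendsto_finsetSum Finset.univ fun k _ => ?_
    have h1 := ((continuousAt_mk_iff (b := fun x : X => x) (s := s k)).1 (hs k)).2
    exact Tendsto.comp ((ContinuousLinearMap.smulRightL ℝ F F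
      (LinearMap.toContinuousLinearMap (b.coord k))).continuous.tendsto _) h1
  have hbase : ∀ᶠ x in 𝓝 x₀, x ∈ e.baseSet := e.open_baseSet.mem_nhds hx₀
  have hunit : ∀ᶠ x in 𝓝 x₀, IsUnit (M x) := by
    filter_upwards [hli, hbase] with x hx hxb
    have hφ : Function.Injective (φ x) := by
      refine (injective_iff_map_eq_zero (φ x)).2 fun g hg => ?_
      rw [hφ_apply] at hg
      exact b.ext_elem fun k => by rw [Fintype.linearIndependent_iff.1 hx _ hg k, map_zero]; rfl
    have hinj : Function.Injective (M x).toLinearMap := fun g g' hg => by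
      refine hφ ?_
      have h2 : e.continuousLinearMapAt ℝ x (φ x g) = e.continuousLinearMapAt ℝ x (φ x g') := by
        rw [← hM, ← hM]; exact hg
      rw [← e.symmL_continuousLinearMapAt (R := ℝ) hxb (φ x g), h2,
        e.symmL_continuousLinearMapAt hxb]
    exact ⟨(ContinuousLinearEquiv.toUnit
      (LinearEquiv.ofInjectiveEndo (M x).toLinearMap hinj).toContinuousLinearEquiv), by ext; rfl⟩
  let D : F →L[ℝ] F := LinearMap.toContinuousLinearMap (b.constr ℝ fun k => m k • b k)
  have hD : ∀ x, (∀ k, P x (s k x) = m k • s k x) → ∀ g, P x (φ x g) = φ x (D g) := by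
    intro x hx g
    have : (P x).toLinearMap ∘ₗ φ x = φ x ∘ₗ D.toLinearMap := b.ext fun k => by
      change P x (φ x (b k)) = φ x (b.constr ℝ (fun k => m k • b k) (b k))
      rw [hφ_basis, b.constr_basis, map_smul, hφ_basis, hx]
    exact LinearMap.congr_fun this g
  have : CompleteSpace F := FiniteDimensional.complete ℝ F
  have hinv : ContinuousAt (fun x => Ring.inverse (M x)) x₀ := by
    obtain ⟨u, hu⟩ := hunit.self_of_nhds
    have := NormedRing.inverse_continuousAt u
    rw [hu] at this
    exact ContinuousAt.comp (f := M) this hMc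
  have hproj : ContinuousAt (fun z : TotalSpace F V => z.proj) ⟨x₀, v₀⟩ :=
    (FiberBundle.continuous_proj F V).continuousAt
  rw [continuousAt_mk_iff]
  refine ⟨hproj, ?_⟩
  have h3 : ContinuousAt (fun z : TotalSpace F V => M z.proj (D (Ring.inverse (M z.proj)
      (e.continuousLinearMapAt ℝ z.proj z.snd)))) ⟨x₀, v₀⟩ := by
    have h4 : ContinuousAt (fun z : TotalSpace F V => M z.proj) ⟨x₀, v₀⟩ :=
      ContinuousAt.comp (f := fun z : TotalSpace F V => z.proj) (g := M) hMc hproj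
    have h5 : ContinuousAt (fun z : TotalSpace F V => Ring.inverse (M z.proj)) ⟨x₀, v₀⟩ :=
      ContinuousAt.comp (f := fun z : TotalSpace F V => z.proj)
        (g := fun x => Ring.inverse (M x)) hinv hproj
    exact h4.clm_apply (D.continuous.continuousAt.comp
      (h5.clm_apply (continuousAt_trivialization e (z₀ := ⟨x₀, v₀⟩) hx₀)))
  refine h3.congr ?_
  filter_upwards [hproj.eventually hbase, hproj.eventually hunit, hproj.eventually hP]
    with z hz1 hz2 hz3
  obtain ⟨x, v⟩ := z
  change M x (D (Ring.inverse (M x) (e.continuousLinearMapAt ℝ x v))) =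
    e.continuousLinearMapAt ℝ x (P x v)
  set g := Ring.inverse (M x) (e.continuousLinearMapAt ℝ x v) with hg
  have h6 : M x g = e.continuousLinearMapAt ℝ x v := by
    change (M x * Ring.inverse (M x)) _ = _
    rw [Ring.mul_inverse_cancel _ hz2]
    rfl
  have h7 : v = φ x g := by
    rw [hM] at h6
    rw [← e.symmL_continuousLinearMapAt (R := ℝ) hz1 v, ← h6, e.symmL_continuousLinearMapAt hz1]
  rw [hM, h7, hD x hz3]

variable {T : X ≃ₜ X} {A : Cocycle F V T}

/-- The projections onto the first bundle of a dominated splitting along the second one are a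
continuous bundle map. As both bundles are nonzero, `N = 0` is impossible. -/
theorem Cocycle.HasDominatedSplitting.exists_projection [Nonempty X] {i : ℕ}
    (h : A.HasDominatedSplitting i) (hi0 : 0 < i) (hi : i < Module.finrank ℝ F) :
    ∃ N, N ≠ 0 ∧ Nonempty (DominatedProjection A i N) := by
  obtain ⟨E₁, E₂, h1, h2, hc, hA1, hA2, N, hN⟩ := h
  have hfin : ∀ x, FiniteDimensional ℝ (V x) := fun x => finite_fiber F V x
  have hrank : ∀ {W : ∀ x, Submodule ℝ (V x)} {k : ℕ}, IsSubbundle F V W k →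
      ∀ x, Module.finrank ℝ (W x) = k := fun {W k} hW x => by
    obtain ⟨U, hU, s, -, hs⟩ := hW x
    obtain ⟨hs1, hs2⟩ := hs x (mem_of_mem_nhds hU)
    rw [← hs2, finrank_span_eq_card hs1, Fintype.card_fin]
  have hpos : ∀ {W : ∀ x, Submodule ℝ (V x)} {k : ℕ}, IsSubbundle F V W k → 0 < k →
      ∀ x, ∃ u ∈ W x, ‖u‖ = 1 := fun {W k} hW hk x => by
    have : W x ≠ ⊥ := fun hb => by
      have := hrank hW x
      rw [hb, finrank_bot] at this
      omega
    obtain ⟨u, hu, hu0⟩ := Submodule.exists_mem_ne_zero_of_ne_bot this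
    refine ⟨‖u‖⁻¹ • u, Submodule.smul_mem _ _ hu, ?_⟩
    rw [norm_smul, norm_inv, norm_norm, inv_mul_cancel₀ (norm_ne_zero_iff.2 hu0)]
  refine ⟨N, ?_, ⟨?_⟩⟩
  · rintro rfl
    obtain ⟨x⟩ := ‹Nonempty X›
    obtain ⟨u, hu, hu1⟩ := hpos h1 hi0 x
    obtain ⟨v, hv, hv1⟩ := hpos h2 (by omega) x
    have : ‖u‖ < 1 / 2 * ‖v‖ := hN x u hu v hv hu1 hv1
    rw [hu1, hv1] at this
    norm_num at this
  let P : ∀ x, V x →L[ℝ] V x := fun x =>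
    LinearMap.toContinuousLinearMap ((E₁ x).projection (E₂ x) (hc x))
  have hP : ∀ x v, P x v = (E₁ x).projection (E₂ x) (hc x) v := fun x v => rfl
  have hPl : ∀ x, ∀ v ∈ E₁ x, P x v = v := fun x v hv =>
    Submodule.projection_apply_of_mem_left (hc x) hv
  have hPr : ∀ x, ∀ v ∈ E₂ x, P x v = 0 := fun x v hv =>
    (Submodule.projection_apply_eq_zero_iff (hc x)).2 hv
  have hPm : ∀ x v, P x v ∈ E₁ x := fun x v => Submodule.projection_apply_mem (hc x) v
  have hcomm : ∀ x v, A.fib x (P x v) = P (T x) (A.fib x v) := fun x v => by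
    have e1 : A.fib x (P x v) ∈ E₁ (T x) := by
      rw [← hA1]; exact Submodule.mem_map_of_mem (hPm x v)
    have e2 : A.fib x (v - P x v) ∈ E₂ (T x) := by
      rw [← hA2]; exact Submodule.mem_map_of_mem (Submodule.sub_projection_mem (hc x) v)
    have e3 : A.fib x v = A.fib x (P x v) + A.fib x (v - P x v) := by rw [← map_add]; simp
    rw [e3, map_add, hPl _ _ e1, hPr _ _ e2, add_zero]
  refine ⟨P, fun x v => hPl x _ (hPm x v), hcomm, fun x => ?_, ?_, ?_⟩
  · have : LinearMap.range (P x).toLinearMap = E₁ x := Submodule.range_projection (hc x)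
    rw [this, hrank h1]
  · refine continuous_iff_continuousAt.2 fun z₀ => ?_
    obtain ⟨x₀, v₀⟩ := z₀
    obtain ⟨U₁, hU₁, s₁, hs₁, hs₁'⟩ := h1 x₀
    obtain ⟨U₂, hU₂, s₂, hs₂, hs₂'⟩ := h2 x₀
    let b : Module.Basis (Fin i ⊕ Fin (Module.finrank ℝ F - i)) ℝ F :=
      (Module.finBasis ℝ F).reindex (Fintype.equivOfCardEq (by simp; omega))
    refine continuousAt_of_frame b x₀ (Sum.elim s₁ s₂) ?_ ?_
      (Sum.elim (fun _ => 1) fun _ => 0) P ?_ v₀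
    · rintro (k | k)
      · exact (hs₁ k).continuousAt hU₁
      · exact (hs₂ k).continuousAt hU₂
    · filter_upwards [hU₁, hU₂] with x hx₁ hx₂
      have e : (fun k => Sum.elim s₁ s₂ k x) = Sum.elim (fun k => s₁ k x) fun k => s₂ k x := by
        funext k
        cases k <;> rfl
      rw [e]
      refine (hs₁' x hx₁).1.sum_type (hs₂' x hx₂).1 ?_
      rw [(hs₁' x hx₁).2, (hs₂' x hx₂).2]
      exact (hc x).disjoint
    · filter_upwards [hU₁, hU₂] with x hx₁ hx₂
      rintro (k | k)
      · rw [Sum.elim_inl, Sum.elim_inl, one_smul, hPl]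
        rw [← (hs₁' x hx₁).2]
        exact Submodule.subset_span ⟨k, rfl⟩
      · rw [Sum.elim_inr, Sum.elim_inr, zero_smul, hPr]
        rw [← (hs₂' x hx₂).2]
        exact Submodule.subset_span ⟨k, rfl⟩
  · refine dominated_iterate hcomm fun x u v hu hv => ?_
    rcases eq_or_ne u 0 with rfl | hu0
    · simp
    rcases eq_or_ne v 0 with rfl | hv0
    · simp
    have hu' := norm_pos_iff.2 hu0
    have hv' := norm_pos_iff.2 hv0
    have := hN x (‖u‖⁻¹ • u) (Submodule.smul_mem _ _ (by rw [← hu]; exact hPm x u))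
      (‖v‖⁻¹ • v) (Submodule.smul_mem _ _ ((Submodule.projection_apply_eq_zero_iff (hc x)).1 hv))
      (by rw [norm_smul, norm_inv, norm_norm, inv_mul_cancel₀ hu'.ne'])
      (by rw [norm_smul, norm_inv, norm_norm, inv_mul_cancel₀ hv'.ne'])
    rw [A.iterate_map, A.iterate_map] at this
    simp only [map_smul, norm_smul, norm_inv, norm_norm] at this
    have h3 := mul_le_mul_of_nonneg_left this.le (mul_pos hu' hv').le
    calc _ = ‖u‖ * ‖v‖ * (‖u‖⁻¹ * ‖A.pow N x u‖) := by field_simp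
      _ ≤ _ := h3
      _ = _ := by field_simp

variable [IsContinuousRiemannianBundle F V] [CompactSpace X]

namespace DominatedProjection

variable {i i' N : ℕ} (D : DominatedProjection A i N) (D' : DominatedProjection A i' N)

/-- The weaker bundle of the larger index meets the stronger bundle of the smaller index, by a count
of dimensions. -/
theorem exists_mem_inter (hi : i < i') (x : X) : ∃ w, D'.P x w = w ∧ D.P x w = 0 ∧ w ≠ 0 := by
  have := finite_fiber F V x
  have h1 : LinearMap.ker ((D.P x).toLinearMap.rangeRestrict ∘ₗ
      (LinearMap.range (D'.P x).toLinearMap).subtype) ≠ ⊥ :=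
    LinearMap.ker_ne_bot_of_finrank_lt (by rwa [D.finrank_range, D'.finrank_range])
  obtain ⟨w, hw, hw0⟩ := Submodule.exists_mem_ne_zero_of_ne_bot h1
  obtain ⟨v, hv⟩ := w.2
  refine ⟨w, ?_, congrArg Subtype.val hw, fun h => hw0 (Subtype.ext h)⟩
  rw [← hv]
  exact D'.idem x v

theorem le_zero_of_geometric {a C : ℝ} (h : ∀ k : ℕ, a ≤ (1 / 2) ^ k * ((1 / 2) ^ k * C)) :
    a ≤ 0 := by
  have hlim : Tendsto (fun k : ℕ => ((1 / 2 : ℝ)) ^ k * ((1 / 2) ^ k * C)) atTop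
      (𝓝 (0 * (0 * C))) := by
    have h0 : Tendsto (fun k : ℕ => ((1 / 2 : ℝ)) ^ k) atTop (𝓝 0) :=
      tendsto_pow_atTop_nhds_zero_of_lt_one (by norm_num) (by norm_num)
    exact h0.mul (h0.mul_const C)
  rw [zero_mul] at hlim
  exact ge_of_tendsto' hlim h

/-- The dominated bundles are nested: a vector of the bundle of smaller rank grows too slowly
to have a component in the complement of the bundle of larger rank. -/
theorem apply_eq_self_of_lt (hi : i < i') (x : X) (u : V x) (hu : D.P x u = u) :
    D'.P x u = u := by
  obtain ⟨C, hC, hD'⟩ := exists_norm_bundleMap_le continuous_id D'.continuous_P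
  obtain ⟨w, hw1, hw2, hw0⟩ := D.exists_mem_inter D' hi x
  set y := u - D'.P x u with hy
  have hy0 : D'.P x y = 0 := by rw [hy, map_sub, D'.idem, sub_self]
  suffices ‖y‖ ≤ 0 by
    have := norm_le_zero_iff.1 this
    rw [hy, sub_eq_zero] at this
    exact this.symm
  refine le_zero_of_geometric (C := (1 + C) * ‖u‖) fun k => ?_
  have h1 := D'.dom x w y hw1 hy0 k
  have h2 := D.dom x u w hu hw2 k
  have h3 : ‖A.pow (N * k) x y‖ ≤ (1 + C) * ‖A.pow (N * k) x u‖ := by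
    rw [hy, map_sub, A.pow_commute D'.commute]
    refine (norm_sub_le _ _).trans ?_
    linarith [hD' _ (A.pow (N * k) x u)]
  have h4 : 0 < ‖w‖ := norm_pos_iff.2 hw0
  have h5 : 0 < ‖A.pow (N * k) x w‖ := norm_pos_iff.2 ((A.pow (N * k) x).map_ne_zero_iff.2 hw0)
  refine le_of_mul_le_mul_left ?_ h5
  calc _ ≤ (1 / 2) ^ k * (‖w‖ * ‖A.pow (N * k) x y‖) := h1
    _ ≤ (1 / 2) ^ k * (‖w‖ * ((1 + C) * ‖A.pow (N * k) x u‖)) := by gcongr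
    _ = (1 / 2) ^ k * (1 + C) * (‖A.pow (N * k) x u‖ * ‖w‖) := by ring
    _ ≤ (1 / 2) ^ k * (1 + C) * ((1 / 2) ^ k * (‖u‖ * ‖A.pow (N * k) x w‖)) := by gcongr
    _ = _ := by ring

/-- The complements of the dominated bundles are nested: the backward iterates of a vector of the
smaller complement are too small to have a component in the bundle of smaller rank. -/
theorem apply_eq_zero_of_lt (hi : i < i') (x : X) (u : V x) (hu : D'.P x u = 0) :
    D.P x u = 0 := by
  obtain ⟨C, hC, hD⟩ := exists_norm_bundleMap_le continuous_id D.continuous_P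
  rw [← norm_le_zero_iff]
  refine le_zero_of_geometric (C := C * ‖u‖) fun k => ?_
  obtain ⟨y, rfl⟩ : ∃ y, T^[N * k] y = x := T.surjective.iterate (N * k) x
  obtain ⟨v, rfl⟩ := (A.pow (N * k) y).surjective u
  obtain ⟨w, hw1, hw2, hw0⟩ := D.exists_mem_inter D' hi y
  have hv : D'.P y v = 0 := by
    rw [← A.pow_commute D'.commute] at hu
    exact (A.pow (N * k) y).map_eq_zero_iff.1 hu
  have h1 := D.dom y (D.P y v) w (D.idem y v) hw2 k
  have h2 := D'.dom y w v hw1 hv k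
  rw [A.pow_commute D.commute] at h1
  have h4 : 0 < ‖w‖ := norm_pos_iff.2 hw0
  refine le_of_mul_le_mul_right ?_ h4
  calc _ ≤ (1 / 2) ^ k * (‖D.P y v‖ * ‖A.pow (N * k) y w‖) := h1
    _ ≤ (1 / 2) ^ k * ((C * ‖v‖) * ‖A.pow (N * k) y w‖) := by gcongr; exact hD y v
    _ = (1 / 2) ^ k * C * (‖A.pow (N * k) y w‖ * ‖v‖) := by ring
    _ ≤ (1 / 2) ^ k * C * ((1 / 2) ^ k * (‖w‖ * ‖A.pow (N * k) y v‖)) := by gcongr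
    _ = _ := by ring

end DominatedProjection

end Projection

section Splitting

variable {X : Type*} [MetricSpace X] [CompactSpace X]
  {F : Type*} [NormedAddCommGroup F] [NormedSpace ℝ F] [FiniteDimensional ℝ F]
  {V : X → Type*} [TopologicalSpace (TotalSpace F V)]
  [∀ x, NormedAddCommGroup (V x)] [∀ x, InnerProductSpace ℝ (V x)]
  [FiberBundle F V] [VectorBundle ℝ F V] [IsContinuousRiemannianBundle F V]
  {T : X ≃ₜ X} {A : Cocycle F V T}

theorem finrank_fiber (F : Type*) [NormedAddCommGroup F] [NormedSpace ℝ F]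
    (V : X → Type*) [TopologicalSpace (TotalSpace F V)]
    [∀ x, NormedAddCommGroup (V x)] [∀ x, InnerProductSpace ℝ (V x)]
    [FiberBundle F V] [VectorBundle ℝ F V] (x : X) :
    Module.finrank ℝ (V x) = Module.finrank ℝ F :=
  ((trivializationAt F V x).continuousLinearEquivAt ℝ x
    (mem_baseSet_trivializationAt F V x)).toLinearEquiv.finrank_eq

/-- The projections of all ranks, with a common number `N` of iterates. The zero map and the identity
serve as the projections of rank `0` and `d`. -/
theorem Cocycle.HasAllDominatedSplittings.exists_projections [Nonempty X]
    (h : A.HasAllDominatedSplittings) : ∃ N, N ≠ 0 ∧ ∀ i, i ≤ Module.finrank ℝ F →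
      Nonempty (DominatedProjection A i N) := by
  have hfin : ∀ x, FiniteDimensional ℝ (V x) := fun x => finite_fiber F V x
  have h1 : ∀ i, ∃ N, N ≠ 0 ∧ (i ≤ Module.finrank ℝ F → Nonempty (DominatedProjection A i N)) := by
    intro i
    rcases Nat.eq_zero_or_pos i with rfl | hi0
    · refine ⟨1, one_ne_zero, fun _ => ⟨?_⟩⟩
      refine ⟨fun x => 0, fun x v => rfl, fun x v => by simp, fun x => ?_, ?_, ?_⟩
      · rw [ContinuousLinearMap.toLinearMap_zero, LinearMap.range_zero, finrank_bot]
      · have := continuous_mk_smul (F := F) (V := V) (b := fun z : TotalSpace F V => z.proj)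
          (s := fun z => z.snd) (c := fun _ => 0) continuous_id continuous_const
        simpa using this
      · intro x u v hu hv k
        have hu' : u = 0 := hu.symm
        simp [hu']
    · rcases lt_trichotomy i (Module.finrank ℝ F) with hi | hi | hi
      · obtain ⟨N, hN, hD⟩ := (h i hi0 hi).exists_projection hi0 hi
        exact ⟨N, hN, fun _ => hD⟩
      · refine ⟨1, one_ne_zero, fun _ => ⟨?_⟩⟩
        refine ⟨fun x => ContinuousLinearMap.id ℝ _, fun x v => rfl, fun x v => rfl, fun x => ?_,
          continuous_id, ?_⟩
        · rw [ContinuousLinearMap.coe_id, LinearMap.range_id, finrank_top, finrank_fiber F V, hi]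
        · intro x u v hu hv k
          have hv' : v = 0 := hv
          simp [hv']
      · exact ⟨1, one_ne_zero, fun hi' => absurd hi' (not_le.2 hi)⟩
  choose N hN hD using h1
  refine ⟨∏ i ∈ Finset.range (Module.finrank ℝ F + 1), N i,
    Finset.prod_ne_zero_iff.2 fun i _ => hN i, fun i hi => ?_⟩
  obtain ⟨D⟩ := hD i hi
  exact ⟨D.ofDvd (Finset.prod_ne_zero_iff.2 fun i _ => hN i)
    (Finset.dvd_prod_of_mem _ (Finset.mem_range.2 (by omega)))⟩

section Nested

variable {d N : ℕ} (D : ∀ i : Fin (d + 1), DominatedProjection A i N)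

theorem DominatedProjection.P_P_of_le {a b : Fin (d + 1)} (hab : a ≤ b) (x : X) (v : V x) :
    (D a).P x ((D b).P x v) = (D a).P x v := by
  rcases hab.lt_or_eq with hab | rfl
  · have h := (D a).apply_eq_zero_of_lt (D b) hab x (v - (D b).P x v)
      (by rw [map_sub, (D b).idem, sub_self])
    rw [map_sub, sub_eq_zero] at h
    exact h.symm
  · exact (D a).idem x v

theorem DominatedProjection.P_P_of_ge {a b : Fin (d + 1)} (hab : a ≤ b) (x : X) (v : V x) :
    (D b).P x ((D a).P x v) = (D a).P x v := by
  rcases hab.lt_or_eq with hab | rfl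
  · exact (D a).apply_eq_self_of_lt (D b) hab x _ ((D a).idem x v)
  · exact (D a).idem x v

/-- The splitting into lines given by nested dominated bundles of all ranks. -/
def lineSplitting (hd : Module.finrank ℝ F = d) : LineSplitting F V d where
  pr j x := (D j.succ).P x - (D j.castSucc).P x
  pr_pr_self j x v := by
    have hlt : j.castSucc ≤ j.succ := Fin.castSucc_le_succ j
    simp only [sub_apply, map_sub, (D _).idem,
      DominatedProjection.P_P_of_le D hlt, DominatedProjection.P_P_of_ge D hlt]
    abel
  pr_pr_ne i j hij x v := by
    rcases lt_or_gt_of_ne hij with h | h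
    · have h1 : i.succ ≤ j.castSucc := Fin.succ_le_castSucc_iff.2 h
      have h2 : i.succ ≤ j.succ := Fin.succ_le_succ_iff.2 h.le
      have h3 : i.castSucc ≤ j.castSucc := Fin.castSucc_le_castSucc_iff.2 h.le
      have h4 : i.castSucc ≤ j.succ := h3.trans (Fin.castSucc_le_succ j)
      simp only [sub_apply, map_sub, DominatedProjection.P_P_of_le D h1,
        DominatedProjection.P_P_of_le D h2, DominatedProjection.P_P_of_le D h3,
        DominatedProjection.P_P_of_le D h4]
      abel
    · have h1 : j.succ ≤ i.castSucc := Fin.succ_le_castSucc_iff.2 h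
      have h2 : j.succ ≤ i.succ := Fin.succ_le_succ_iff.2 h.le
      have h3 : j.castSucc ≤ i.castSucc := Fin.castSucc_le_castSucc_iff.2 h.le
      have h4 : j.castSucc ≤ i.succ := h3.trans (Fin.castSucc_le_succ i)
      simp only [sub_apply, map_sub, DominatedProjection.P_P_of_ge D h1,
        DominatedProjection.P_P_of_ge D h2, DominatedProjection.P_P_of_ge D h3,
        DominatedProjection.P_P_of_ge D h4]
      abel
  sum_pr x v := by
    have := finite_fiber F V x
    have h0 : (D 0).P x v = 0 := by
      have := (D 0).finrank_range x
      have h : LinearMap.range ((D 0).P x).toLinearMap = ⊥ := Submodule.finrank_eq_zero.1 this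
      exact (Submodule.mem_bot ℝ).1 (h ▸ LinearMap.mem_range_self ((D 0).P x).toLinearMap v)
    have h1 : (D (Fin.last d)).P x v = v := by
      have h : LinearMap.range ((D (Fin.last d)).P x).toLinearMap = ⊤ :=
        Submodule.eq_top_of_finrank_eq (by
          rw [(D (Fin.last d)).finrank_range, finrank_fiber F V, hd, Fin.val_last])
      obtain ⟨u, rfl⟩ := LinearMap.range_eq_top.1 h v
      exact (D (Fin.last d)).idem x u
    have h2 := Fin.sum_univ_succ fun a => (D a).P x v
    have h3 := Fin.sum_univ_castSucc fun a => (D a).P x v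
    rw [h3, h0, h1, zero_add] at h2
    simp only [sub_apply, Finset.sum_sub_distrib]
    rw [← h2]
    abel
  exists_ne j x := by
    by_contra! h
    have := finite_fiber F V x
    have e : ((D j.succ).P x).toLinearMap = ((D j.castSucc).P x).toLinearMap :=
      LinearMap.ext fun v => sub_eq_zero.1 (h v)
    have h1 := (D j.succ).finrank_range x
    rw [e, (D j.castSucc).finrank_range x] at h1
    simp at h1
  rank_one j x v w hw := by
    have := finite_fiber F V x
    have htr : ∀ a, LinearMap.trace ℝ (V x) ((D a).P x).toLinearMap = (a : ℕ) := fun a => by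
      have h : LinearMap.IsProj (LinearMap.range ((D a).P x).toLinearMap) ((D a).P x).toLinearMap :=
        ⟨fun v => LinearMap.mem_range_self _ v, by rintro _ ⟨u, rfl⟩; exact (D a).idem x u⟩
      rw [h.trace, (D a).finrank_range]
    set p : V x →ₗ[ℝ] V x := ((D j.succ).P x).toLinearMap - ((D j.castSucc).P x).toLinearMap with hp
    have hlt : j.castSucc ≤ j.succ := Fin.castSucc_le_succ j
    have hpp : ∀ v, p (p v) = p v := fun v => by
      simp only [hp, LinearMap.sub_apply, ContinuousLinearMap.coe_coe, map_sub,
        (D _).idem, DominatedProjection.P_P_of_le D hlt,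
        DominatedProjection.P_P_of_ge D hlt]
      abel
    have h : LinearMap.IsProj (LinearMap.range p) p :=
      ⟨fun v => LinearMap.mem_range_self _ v, by rintro _ ⟨u, rfl⟩; exact hpp u⟩
    have h1 : Module.finrank ℝ (LinearMap.range p) = 1 := by
      have h2 := h.trace
      rw [hp, map_sub, htr, htr, ← hp] at h2
      have h3 : ((1 : ℕ) : ℝ) = (Module.finrank ℝ (LinearMap.range p) : ℝ) := by
        rw [← h2]; simp
      exact_mod_cast h3.symm
    have hw' : (⟨p w, LinearMap.mem_range_self p w⟩ : LinearMap.range p) ≠ 0 := fun h =>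
      hw (congrArg Subtype.val h)
    obtain ⟨c, hc⟩ := (finrank_eq_one_iff_of_nonzero' _ hw').1 h1
      ⟨p v, LinearMap.mem_range_self p v⟩
    exact ⟨c, (congrArg Subtype.val hc).symm⟩
  continuous_pr j := by
    have h1 := continuous_mk_sum (F := F) (V := V) (b := fun z : TotalSpace F V => z.proj)
      (FiberBundle.continuous_proj F V) (Finset.univ : Finset (Fin 2))
      (s := fun k z => ![(D j.succ).P z.proj z.snd, (-1 : ℝ) • (D j.castSucc).P z.proj z.snd] k) (by
        intro k _
        fin_cases k
        · exact (D j.succ).continuous_P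
        · exact continuous_mk_smul (D j.castSucc).continuous_P continuous_const)
    refine h1.congr fun z => ?_
    refine congrArg (TotalSpace.mk (F := F) z.proj) ?_
    simp [Fin.sum_univ_two, sub_eq_add_neg]

end Nested

/-- The cocycle multiplies the lengths of the vectors in a line by a continuous positive factor. -/
theorem LineSplitting.exists_factor {d : ℕ} (S : LineSplitting F V d)
    (hS : ∀ i x v, A.fib x (S.pr i x v) = S.pr i (T x) (A.fib x v)) (i : Fin d) :
    ∃ l : X → ℝ, Continuous l ∧
      ∀ x v, ‖S.pr i (T x) (A.fib x v)‖ = Real.exp (l x) * ‖S.pr i x v‖ := by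
  obtain ⟨t, ⟨J⟩⟩ := exists_fiberEmbedding (F := F) (V := V)
  have hne : ∀ x v, S.pr i x v ≠ 0 → S.pr i (T x) (A.fib x v) ≠ 0 := fun x v hv => by
    rw [← hS]
    exact (A.fib x).map_ne_zero_iff.2 hv
  have h1 : ∀ x, ∃ l : ℝ, ∀ v, ‖S.pr i (T x) (A.fib x v)‖ = Real.exp l * ‖S.pr i x v‖ := by
    intro x
    obtain ⟨v₀, hv₀⟩ := S.exists_ne i x
    have h0 := norm_pos_iff.2 hv₀
    have h0' := norm_pos_iff.2 (hne x v₀ hv₀)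
    refine ⟨Real.log (‖S.pr i (T x) (A.fib x v₀)‖ / ‖S.pr i x v₀‖), fun v => ?_⟩
    obtain ⟨c, hc⟩ := S.rank_one i x v v₀ hv₀
    rw [Real.exp_log (div_pos h0' h0), ← hS, hc, map_smul, norm_smul, norm_smul, ← hS]
    field_simp
  choose l hl using h1
  refine ⟨l, continuous_iff_continuousAt.2 fun x₀ => ?_, hl⟩
  obtain ⟨v₀, hv₀⟩ := S.exists_ne i x₀
  have hsec : Continuous fun x : X => (⟨x, J.p x (J.j x₀ v₀)⟩ : TotalSpace F V) :=
    J.continuous_p.comp (continuous_id.prodMk continuous_const)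
  have hc1 : Continuous fun x : X => ‖S.pr i x (J.p x (J.j x₀ v₀))‖ :=
    (S.continuous_norm_pr i).comp hsec
  have hc2 : Continuous fun x : X => ‖S.pr i (T x) (A.fib x (J.p x (J.j x₀ v₀)))‖ :=
    (S.continuous_norm_pr i).comp (A.continuous_fib.comp hsec)
  have hp1 : S.pr i x₀ (J.p x₀ (J.j x₀ v₀)) ≠ 0 := by rwa [J.p_j]
  have hlog := ((hc2.continuousAt (x := x₀)).div (hc1.continuousAt (x := x₀))
    (norm_ne_zero_iff.2 hp1)).log
    (div_pos (norm_pos_iff.2 (hne _ _ hp1)) (norm_pos_iff.2 hp1)).ne'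
  refine hlog.congr ?_
  filter_upwards [hc1.continuousAt.eventually_ne (norm_ne_zero_iff.2 hp1)] with x hx
  rw [Pi.div_apply, hl, mul_div_cancel_right₀ _ hx, Real.log_exp]

theorem LineSplitting.norm_pow_pr {d : ℕ} (S : LineSplitting F V d)
    (hS : ∀ i x v, A.fib x (S.pr i x v) = S.pr i (T x) (A.fib x v)) (i : Fin d) {l : X → ℝ}
    (hl : ∀ x v, ‖S.pr i (T x) (A.fib x v)‖ = Real.exp (l x) * ‖S.pr i x v‖) (n : ℕ) (x : X)
    (v : V x) : ‖A.pow n x (S.pr i x v)‖ =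
      Real.exp (∑ k ∈ Finset.range n, l (T^[k] x)) * ‖S.pr i x v‖ := by
  induction n generalizing x with
  | zero =>
    rw [Finset.sum_range_zero, Real.exp_zero, one_mul]
    rfl
  | succ n ih =>
    change ‖A.pow n (T x) (A.fib x (S.pr i x v))‖ = _
    rw [hS, ih, hl, ← mul_assoc, ← Real.exp_add, Finset.sum_range_succ']
    rfl

/-- The weights are the geometric means of the growth along the partial orbits of length at most
`N`; for them the factors become the means of the original ones over orbits of length `N`. -/
theorem Cocycle.HasAllDominatedSplittings.exists_adapted [Nonempty X]
    (h : A.HasAllDominatedSplittings) :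
    ∃ (S : LineSplitting F V (Module.finrank ℝ F)) (w α : Fin (Module.finrank ℝ F) → X → ℝ)
      (c : ℝ), 0 < c ∧ S.Adapted A w α c := by
  obtain ⟨N, hN, hD⟩ := h.exists_projections
  let D : ∀ i : Fin (Module.finrank ℝ F + 1), DominatedProjection A i N := fun i =>
    (hD i (Nat.lt_succ_iff.1 i.2)).some
  let S := lineSplitting D rfl
  have hpr : ∀ j x v, S.pr j x v = (D j.succ).P x v - (D j.castSucc).P x v := fun j x v => rfl
  have hS : ∀ i x v, A.fib x (S.pr i x v) = S.pr i (T x) (A.fib x v) := fun i x v => by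
    rw [hpr, hpr, map_sub, (D _).commute, (D _).commute]
  choose l hlc hl using fun i => S.exists_factor hS i
  have hN0 : (0 : ℝ) < N := by exact_mod_cast Nat.pos_of_ne_zero hN
  let q : Fin (Module.finrank ℝ F) → X → ℝ := fun i x =>
    (∑ k ∈ Finset.range N, ((N : ℝ) - 1 - k) * l i (T^[k] x)) / N
  let α : Fin (Module.finrank ℝ F) → X → ℝ := fun i x => (∑ k ∈ Finset.range N, l i (T^[k] x)) / N
  have hqc : ∀ i, Continuous (q i) := fun i =>
    (continuous_finsetSum _ fun k _ => continuous_const.mul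
      ((hlc i).comp (T.continuous.iterate k))).div_const _
  have hq : ∀ i x, q i (T x) + l i x = α i x + q i x := by
    intro i x
    have e1 : ∑ k ∈ Finset.range N, ((N : ℝ) - 1 - k) * l i (T^[k] (T x)) =
        ∑ k ∈ Finset.range N, ((N : ℝ) - k) * l i (T^[k] x) - N * l i x := by
      have h1 := Finset.sum_range_succ (fun k => ((N : ℝ) - k) * l i (T^[k] x)) N
      rw [Finset.sum_range_succ', sub_self, zero_mul, add_zero] at h1
      rw [← h1]
      simp only [Function.iterate_zero, id, Nat.cast_zero, sub_zero, add_sub_cancel_right]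
      refine Finset.sum_congr rfl fun k _ => ?_
      rw [Function.iterate_succ_apply]
      push_cast
      ring
    have e2 : ∑ k ∈ Finset.range N, ((N : ℝ) - k) * l i (T^[k] x) =
        ∑ k ∈ Finset.range N, l i (T^[k] x) +
          ∑ k ∈ Finset.range N, ((N : ℝ) - 1 - k) * l i (T^[k] x) := by
      rw [← Finset.sum_add_distrib]
      exact Finset.sum_congr rfl fun k _ => by ring
    simp only [q, α]
    rw [e1, e2]
    field_simp
    ring
  refine ⟨S, fun i x => Real.exp (q i x), α, Real.log 2 / N,
    div_pos (Real.log_pos one_lt_two) hN0, hS, fun i x => Real.exp_pos _,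
    fun i => Real.continuous_exp.comp (hqc i), fun i x v => ?_, fun i j hij x => ?_⟩
  · rw [hl, ← mul_assoc, ← mul_assoc, ← Real.exp_add, ← Real.exp_add, hq]
  · have h1 : i.succ ≤ j.castSucc := Fin.succ_le_castSucc_iff.2 hij
    obtain ⟨u, hu⟩ := S.exists_ne i x
    obtain ⟨v, hv⟩ := S.exists_ne j x
    have h2 := (D i.succ).dom x (S.pr i x u) (S.pr j x v)
      (by rw [hpr, map_sub, (D _).idem, DominatedProjection.P_P_of_ge D (Fin.castSucc_le_succ i)])
      (by rw [hpr, map_sub, DominatedProjection.P_P_of_le D h1,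
        DominatedProjection.P_P_of_le D (h1.trans (Fin.castSucc_le_succ j)), sub_self]) 1
    rw [mul_one, pow_one, S.norm_pow_pr hS i (hl i), S.norm_pow_pr hS j (hl j)] at h2
    have hu' := norm_pos_iff.2 hu
    have hv' := norm_pos_iff.2 hv
    have h3 : 2 * Real.exp (∑ k ∈ Finset.range N, l i (T^[k] x)) ≤
        Real.exp (∑ k ∈ Finset.range N, l j (T^[k] x)) := by
      refine le_of_mul_le_mul_right ?_ (mul_pos hu' hv')
      linarith
    have h4 := Real.log_le_log (by positivity) h3
    rw [Real.log_mul two_ne_zero (Real.exp_pos _).ne', Real.log_exp, Real.log_exp] at h4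
    simp only [α]
    rw [← add_div]
    exact div_le_div_of_nonneg_right (by linarith) hN0.le

/-- The dominated splittings of all indices give structural stability. -/
theorem Cocycle.HasAllDominatedSplittings.structurallyStable (h : A.HasAllDominatedSplittings)
    {nhdsA : Filter (Cocycle F V T)} (hle : nhdsA ≤ A.nhdsC0) : A.StructurallyStable nhdsA := by
  intro ε hε
  rcases isEmpty_or_nonempty X with hX | hX
  · refine ⟨Set.univ, univ_mem, fun B _ => ?_⟩
    rw [Cocycle.ext_fib (A := B) (B := A) fun x => isEmptyElim x]
    exact Cocycle.ProjConj.refl A hε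
  obtain ⟨S, w, α, c, hc, hS⟩ := h.exists_adapted
  obtain ⟨δ, hδ, hδ'⟩ := hS.exists_projConj_scale hc (half_pos hε)
  obtain ⟨η, hη, hη'⟩ := hS.exists_projConj_of_near hc (lt_min hδ (half_pos hε))
  refine ⟨_, hle (mem_iInf_of_mem η (mem_iInf_of_mem hη (mem_principal_self _))), fun B hB => ?_⟩
  obtain ⟨γ, hγ, hγδ, hconj⟩ := hη' B hB
  have h1 := hδ' γ hγ fun i x => (hγδ i x).trans (min_le_left _ _)
  exact (h1.trans (hconj.mono (min_le_right _ _))).mono (by linarith)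

end Splitting

/-! ### Perturbations of linear maps with infinitely or finitely many periodic lines -/

section LinearAlgebra

/-- The lines preserved by a linear map. -/
def fixedLines {W : Type*} [AddCommGroup W] [Module ℝ W] (N : W →ₗ[ℝ] W) : Set (ℙ ℝ W) :=
  {l | ∃ (v : W) (hv : v ≠ 0), l = Projectivization.mk ℝ v hv ∧ ∃ c : ℝ, N v = c • v}

/-- A linear map with a cyclic vector has one line of eigenvectors for each eigenvalue. -/
theorem finite_fixedLines_of_cyclic {W : Type*} [AddCommGroup W] [Module ℝ W]
    [FiniteDimensional ℝ W] (N : W →ₗ[ℝ] W) (v : W)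
    (h : Submodule.span ℝ (Set.range fun k : ℕ => (N ^ k) v) = ⊤) : (fixedLines N).Finite := by
  have hker : ∀ μ : ℝ, Module.finrank ℝ (LinearMap.ker (N - μ • LinearMap.id)) ≤ 1 := by
    intro μ
    set N' := N - μ • LinearMap.id with hN'
    have htop : (ℝ ∙ v) ⊔ LinearMap.range N' = ⊤ := by
      rw [eq_top_iff, ← h, Submodule.span_le]
      rintro _ ⟨k, rfl⟩
      induction k with
      | zero => exact Submodule.mem_sup_left (Submodule.mem_span_singleton_self v)
      | succ k ih =>
        have e : (N ^ (k + 1)) v = μ • (N ^ k) v + N' ((N ^ k) v) := by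
          rw [pow_succ', hN']
          simp
        change (N ^ (k + 1)) v ∈ _
        rw [e]
        exact Submodule.add_mem _ (Submodule.smul_mem _ _ ih)
          (Submodule.mem_sup_right (LinearMap.mem_range_self _ _))
    have h1 := Submodule.finrank_add_le_finrank_add_finrank (ℝ ∙ v) (LinearMap.range N')
    rw [htop, finrank_top] at h1
    have h2 := finrank_span_le_card (R := ℝ) ({v} : Set W)
    rw [Set.toFinset_singleton, Finset.card_singleton] at h2
    have h3 := LinearMap.finrank_range_add_finrank_ker N'
    omega
  have hfin : {μ : ℝ | Module.End.HasEigenvalue N μ}.Finite := Module.End.finite_hasEigenvalue N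
  refine (hfin.biUnion (t := fun μ => {l | ∃ (v : W) (hv : v ≠ 0),
    l = Projectivization.mk ℝ v hv ∧ N v = μ • v}) fun μ _ => ?_).subset ?_
  · refine Set.Subsingleton.finite ?_
    rintro _ ⟨u, hu, rfl, hu'⟩ _ ⟨w, hw, rfl, hw'⟩
    have hu1 : u ∈ LinearMap.ker (N - μ • LinearMap.id) := by simp [hu']
    have hw1 : w ∈ LinearMap.ker (N - μ • LinearMap.id) := by simp [hw']
    have hw0 : (⟨w, hw1⟩ : LinearMap.ker (N - μ • LinearMap.id)) ≠ 0 := fun h =>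
      hw (congrArg Subtype.val h)
    have h1 : Module.finrank ℝ (LinearMap.ker (N - μ • LinearMap.id)) = 1 :=
      le_antisymm (hker μ) (Module.finrank_pos_iff_exists_ne_zero.2 ⟨_, hw0⟩)
    obtain ⟨c, hc⟩ := (finrank_eq_one_iff_of_nonzero' _ hw0).1 h1 ⟨u, hu1⟩
    rw [Projectivization.mk_eq_mk_iff']
    exact ⟨c, congrArg Subtype.val hc⟩
  · rintro _ ⟨u, hu, rfl, c, hc⟩
    refine Set.mem_biUnion (x := c) ?_ ⟨u, hu, rfl, hc⟩
    exact Module.End.hasEigenvalue_of_hasEigenvector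
      ⟨Module.End.mem_eigenspace_iff.2 hc, hu⟩

open Polynomial in
/-- On the segment from a matrix to one with simple positive eigenvalues, the vector with unit
entries is cyclic for all the powers, except for countably many parameters. -/
theorem frequently_krylov_ne_zero {n : ℕ} (M : Matrix (Fin n) (Fin n) ℝ) :
    ∃ D : Matrix (Fin n) (Fin n) ℝ, ∃ᶠ t in 𝓝 (0 : ℝ), ∀ q : ℕ, 1 ≤ q →
      (Matrix.of fun i j : Fin n =>
        ((((M + t • D) ^ q) ^ (j : ℕ)).mulVec fun _ => (1 : ℝ)) i).det ≠ 0 := by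
  let D₀ : Matrix (Fin n) (Fin n) ℝ := Matrix.diagonal fun i => (i : ℝ) + 1
  let D := D₀ - M
  let PM : Matrix (Fin n) (Fin n) ℝ[X] := M.map C + (X : ℝ[X]) • D.map C
  let f : ℕ → ℝ[X] := fun q => (Matrix.of fun i j : Fin n =>
    (((PM ^ q) ^ (j : ℕ)).mulVec fun _ => (1 : ℝ[X])) i).det
  have hPM : ∀ t, PM.map (evalRingHom t) = M + t • D := fun t => by
    ext i j
    simp only [PM, Matrix.map_apply, Matrix.add_apply, Matrix.smul_apply, smul_eq_mul,
      coe_evalRingHom, eval_add, eval_mul, eval_C, eval_X]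
  have hf : ∀ q t, (f q).eval t = (Matrix.of fun i j : Fin n =>
      ((((M + t • D) ^ q) ^ (j : ℕ)).mulVec fun _ => (1 : ℝ)) i).det := by
    intro q t
    have h1 := RingHom.map_det (evalRingHom t) (Matrix.of fun i j : Fin n =>
      (((PM ^ q) ^ (j : ℕ)).mulVec fun _ => (1 : ℝ[X])) i)
    rw [coe_evalRingHom] at h1
    rw [h1]
    congr 1
    ext i j
    rw [RingHom.mapMatrix_apply, Matrix.map_apply, Matrix.of_apply, Matrix.of_apply,
      RingHom.map_mulVec, ← RingHom.mapMatrix_apply, map_pow, map_pow, RingHom.mapMatrix_apply, hPM]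
    have : (evalRingHom t ∘ fun _ : Fin n => (1 : ℝ[X])) = fun _ => 1 := funext fun k => map_one _
    rw [this]
  have hf1 : ∀ q, 1 ≤ q → f q ≠ 0 := by
    intro q hq h0
    -- at `t = 1` the matrix is diagonal, and the determinant is a Vandermonde determinant
    have h1 : (f q).eval 1 = 0 := by rw [h0, eval_zero]
    rw [hf, one_smul] at h1
    have e : (Matrix.of fun i j : Fin n =>
        ((((M + D) ^ q) ^ (j : ℕ)).mulVec fun _ => (1 : ℝ)) i) =
        Matrix.vandermonde fun i : Fin n => ((i : ℝ) + 1) ^ q := by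
      ext i j
      have : M + D = D₀ := by simp [D]
      rw [this, Matrix.of_apply, Matrix.vandermonde_apply]
      simp only [D₀, Matrix.diagonal_pow, Matrix.mulVec_diagonal]
      simp
    rw [e] at h1
    refine Matrix.det_vandermonde_ne_zero_iff.2 ?_ h1
    intro i j hij
    have h2 : ((i : ℝ) + 1) = (j : ℝ) + 1 :=
      (pow_left_inj₀ (by positivity) (by positivity) (by omega)).1 hij
    exact Fin.ext (by exact_mod_cast add_right_cancel h2)
  refine ⟨D, ?_⟩
  have hcount : (⋃ q : ℕ, ⋃ _ : 1 ≤ q, {t : ℝ | (f q).IsRoot t}).Countable :=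
    Set.countable_iUnion fun q => Set.countable_iUnion fun hq =>
      (finite_setOfPred_isRoot (hf1 q hq)).countable
  have hdense := hcount.dense_compl ℝ
  refine (mem_closure_iff_frequently.1 (hdense 0)).mono fun t ht q hq => ?_
  rw [← hf]
  intro h0
  exact ht (Set.mem_iUnion₂.2 ⟨q, hq, h0⟩)

variable {W : Type*} [NormedAddCommGroup W] [NormedSpace ℝ W] [FiniteDimensional ℝ W]

/-- A small perturbation makes all powers of a linear isomorphism cyclic; a cyclic map has
one-dimensional eigenspaces, hence finitely many invariant lines. -/
theorem frequently_finite_fixedLines (L : W ≃ₗ[ℝ] W) :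
    ∃ᶠ R in 𝓝 (ContinuousLinearMap.id ℝ W), ∀ q : ℕ, 1 ≤ q →
      (fixedLines ((L.toLinearMap ∘ₗ R.toLinearMap) ^ q)).Finite := by
  let b := Module.finBasis ℝ W
  obtain ⟨D, hD⟩ := frequently_krylov_ne_zero (LinearMap.toMatrix b b L.toLinearMap)
  let N : W →ₗ[ℝ] W := L.symm.toLinearMap ∘ₗ Matrix.toLin b b D
  let R : ℝ → W →L[ℝ] W := fun t => ContinuousLinearMap.id ℝ W + t • LinearMap.toContinuousLinearMap N
  have hR : Tendsto R (𝓝 0) (𝓝 (ContinuousLinearMap.id ℝ W)) := by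
    have hc : Continuous R := continuous_const.add (continuous_id.smul continuous_const)
    have := hc.tendsto 0
    simpa [R] using this
  refine hR.frequently (hD.mono fun t ht q hq => ?_)
  set L' : W →ₗ[ℝ] W := L.toLinearMap ∘ₗ (R t).toLinearMap with hL'
  have hmat : LinearMap.toMatrix b b L' = LinearMap.toMatrix b b L.toLinearMap + t • D := by
    have e : L' = L.toLinearMap + t • Matrix.toLin b b D := by
      ext w
      simp [hL', R, N]
    rw [e, map_add, map_smul, LinearMap.toMatrix_toLin]
  refine finite_fixedLines_of_cyclic _ (∑ i, b i) ?_
  have hli : LinearIndependent ℝ fun j : Fin (Module.finrank ℝ W) =>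
      ((L' ^ q) ^ (j : ℕ)) (∑ i, b i) := by
    have h1 := ht q hq
    have e : (Matrix.of fun i j : Fin (Module.finrank ℝ W) =>
        ((((LinearMap.toMatrix b b L.toLinearMap + t • D) ^ q) ^ (j : ℕ)).mulVec
          fun _ => (1 : ℝ)) i) =
        b.toMatrix fun j : Fin (Module.finrank ℝ W) => ((L' ^ q) ^ (j : ℕ)) (∑ i, b i) := by
      ext i j
      rw [Matrix.of_apply, Module.Basis.toMatrix_apply, ← hmat, LinearMap.toMatrix_pow,
        LinearMap.toMatrix_pow, ← LinearMap.toMatrix_mulVec_repr b b]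
      congr 2
      funext k
      simp
    rw [e] at h1
    have h2 := (b.is_basis_iff_det (v := fun j : Fin (Module.finrank ℝ W) => ((L' ^ q) ^ (j : ℕ)) (∑ i, b i))).2
      (isUnit_iff_ne_zero.2 (by rwa [Module.Basis.det_apply]))
    exact h2.1
  have hspan := hli.span_eq_top_of_card_eq_finrank' (by simp)
  rw [eq_top_iff, ← hspan]
  refine Submodule.span_mono ?_
  rintro _ ⟨j, rfl⟩
  exact ⟨j, rfl⟩

open Complex in
/-- A complex eigenvalue which is not real gives an invariant plane. -/
theorem exists_complex_plane (L : W ≃ₗ[ℝ] W) {z : ℂ} (hz : z.im ≠ 0)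
    (hroot : z ∈ (L.toLinearMap.charpoly.map (algebraMap ℝ ℂ)).roots) :
    ∃ φ : ℂ →ₗ[ℝ] W, Function.Injective φ ∧ ∀ c, L (φ c) = φ (z * c) := by
  let b := Module.finBasis ℝ W
  set M := LinearMap.toMatrix b b L.toLinearMap with hM
  have hdet : (z • (1 : Matrix _ _ ℂ) - M.map (algebraMap ℝ ℂ)).det = 0 := by
    have h1 : (L.toLinearMap.charpoly.map (algebraMap ℝ ℂ)).eval z = 0 :=
      Polynomial.isRoot_of_mem_roots hroot
    rw [← LinearMap.charpoly_toMatrix L.toLinearMap b, ← Matrix.charpoly_map,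
      Matrix.eval_charpoly] at h1
    rw [← h1]
    congr 1
    rw [Matrix.scalar_apply, Matrix.smul_one_eq_diagonal]
  obtain ⟨w, hw0, hw⟩ := Matrix.exists_mulVec_eq_zero_iff.2 hdet
  have hw' : ∀ i, ∑ j, (M i j : ℂ) * w j = z * w i := fun i => by
    have := congrFun hw i
    rw [Matrix.sub_mulVec, Matrix.smul_mulVec, Matrix.one_mulVec] at this
    simp only [Pi.sub_apply, Pi.smul_apply, Pi.zero_apply, smul_eq_mul, sub_eq_zero] at this
    rw [this]
    rfl
  let φ : ℂ →ₗ[ℝ] W :=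
    { toFun := fun c => ∑ i, (c * w i).re • b i
      map_add' := fun c c' => by
        simp only [add_mul, Complex.add_re, add_smul, Finset.sum_add_distrib]
      map_smul' := fun t c => by
        simp only [Complex.real_smul, mul_assoc, Complex.re_ofReal_mul, RingHom.id_apply,
          Finset.smul_sum, smul_smul] }
  have hφ : ∀ c, φ c = ∑ i, (c * w i).re • b i := fun c => rfl
  have hL : ∀ c, L (φ c) = φ (z * c) := by
    intro c
    have e : ∀ j, L (b j) = ∑ i, M i j • b i := fun j => by
      have := LinearMap.toMatrix_apply b b L.toLinearMap
      conv_lhs => rw [← b.sum_repr (L (b j))]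
      exact Finset.sum_congr rfl fun i _ => by rw [hM, this]; rfl
    rw [hφ, hφ, map_sum]
    simp only [map_smul, e, Finset.smul_sum, smul_smul]
    rw [Finset.sum_comm]
    refine Finset.sum_congr rfl fun i _ => ?_
    rw [← Finset.sum_smul]
    congr 1
    have e2 : z * c * w i = ∑ j, (M i j : ℂ) * (c * w j) := by
      rw [mul_comm z c, mul_assoc, ← hw', Finset.mul_sum]
      exact Finset.sum_congr rfl fun j _ => by ring
    rw [e2, Complex.re_sum]
    exact Finset.sum_congr rfl fun j _ => by rw [Complex.re_ofReal_mul, mul_comm]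
  refine ⟨φ, (injective_iff_map_eq_zero φ).2 fun c hc => ?_, hL⟩
  by_contra hc0
  -- the kernel would contain `c` and `z * c`, a basis over the reals
  have h1 : φ (z * c) = 0 := by rw [← hL, hc, map_zero]
  have hzero : ∀ y : ℂ, φ y = 0 := by
    intro y
    have h2 : y = ((y / c).re - (y / c).im / z.im * z.re) • c + ((y / c).im / z.im) • (z * c) := by
      rw [Complex.real_smul, Complex.real_smul, ← mul_assoc, ← add_mul]
      rw [← div_eq_iff hc0]
      apply Complex.ext
      · simp
      · simp [hz]
    rw [h2, map_add, map_smul, map_smul, hc, h1, smul_zero, smul_zero, add_zero]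
  have hre : ∀ (y : ℂ) i, (y * w i).re = 0 := fun y i => by
    have h3 := hzero y
    rw [hφ] at h3
    exact Fintype.linearIndependent_iff.1 b.linearIndependent _ h3 i
  refine hw0 (funext fun i => ?_)
  apply Complex.ext
  · simpa using hre 1 i
  · simpa using hre (-I) i

open Complex in
/-- Rotations by small angles make a nonzero complex number have a real power. -/
theorem frequently_pow_real {z : ℂ} :
    ∃ᶠ u in 𝓝 (1 : ℂ), ∃ q : ℕ, 1 ≤ q ∧ ∃ c : ℝ, (z * u) ^ q = c := by
  -- a rotation by `θ n` makes the argument a multiple of `π / (n + 1)`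
  let θ : ℕ → ℝ := fun n => Real.pi * ⌊arg z * (n + 1) / Real.pi⌋ / (n + 1) - arg z
  have hθ : Tendsto θ atTop (𝓝 0) := by
    have h1 : ∀ n : ℕ, |θ n| ≤ Real.pi * (1 / ((n : ℝ) + 1)) := fun n => by
      have hn : (0 : ℝ) < n + 1 := by positivity
      have h2 := Int.floor_le (arg z * (n + 1) / Real.pi)
      have h3 := Int.lt_floor_add_one (arg z * (n + 1) / Real.pi)
      rw [le_div_iff₀ Real.pi_pos] at h2
      rw [div_lt_iff₀ Real.pi_pos] at h3
      have e : θ n = (Real.pi * ⌊arg z * (n + 1) / Real.pi⌋ - arg z * (n + 1)) / (n + 1) := by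
        simp only [θ]
        field_simp
      rw [e, abs_div, abs_of_pos hn, mul_one_div]
      refine div_le_div_of_nonneg_right ?_ hn.le
      rw [abs_le]
      constructor <;> linarith
    have h4 : Tendsto (fun n : ℕ => Real.pi * (1 / ((n : ℝ) + 1))) atTop (𝓝 (Real.pi * 0)) :=
      tendsto_one_div_add_atTop_nhds_zero_nat.const_mul _
    rw [mul_zero] at h4
    exact squeeze_zero_norm h1 h4
  have hu : Tendsto (fun n => exp (θ n * I)) atTop (𝓝 1) := by
    have hc : Continuous fun t : ℝ => exp (t * I) := by fun_prop
    have := (hc.tendsto 0).comp hθ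
    simp only [Complex.ofReal_zero, zero_mul, Complex.exp_zero] at this
    exact this
  refine hu.frequently (Frequently.of_forall fun n => ⟨n + 1, by omega,
    ‖z‖ ^ (n + 1) * Real.cos (Real.pi * ⌊arg z * (n + 1) / Real.pi⌋), ?_⟩)
  have hn : ((n : ℂ) + 1) ≠ 0 := by exact_mod_cast Nat.succ_ne_zero n
  set m := ⌊arg z * (n + 1) / Real.pi⌋ with hm
  have e : z * exp (θ n * I) = ‖z‖ * exp ((Real.pi * m / (n + 1) : ℝ) * I) := by
    conv_lhs => rw [← Complex.norm_mul_exp_arg_mul_I z, mul_assoc, ← Complex.exp_add]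
    congr 2
    simp only [θ]
    push_cast
    ring
  rw [e, mul_pow, ← Complex.exp_nat_mul]
  have e2 : ((n + 1 : ℕ) : ℂ) * (((Real.pi * m / (n + 1) : ℝ) : ℂ) * I) =
      ((Real.pi * m : ℝ) : ℂ) * I := by
    push_cast
    field_simp
  rw [e2, Complex.exp_mul_I, ← Complex.ofReal_cos, ← Complex.ofReal_sin]
  have hs : Real.sin (Real.pi * m) = 0 := by rw [mul_comm]; exact Real.sin_int_mul_pi m
  rw [hs]
  push_cast
  ring

/-- Near a linear isomorphism with a non-real eigenvalue `z` there are maps of which a power has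
infinitely many invariant lines: on the invariant plane of `z`, multiply by a number `u` near `1`
such that a power of `z * u` is real. -/
theorem frequently_infinite_fixedLines (L : W ≃ₗ[ℝ] W) {z : ℂ} (hz : z.im ≠ 0)
    (hroot : z ∈ (L.toLinearMap.charpoly.map (algebraMap ℝ ℂ)).roots) :
    ∃ᶠ R in 𝓝 (ContinuousLinearMap.id ℝ W), ∃ q : ℕ, 1 ≤ q ∧
      (fixedLines ((L.toLinearMap ∘ₗ R.toLinearMap) ^ q)).Infinite := by
  obtain ⟨φ, hφ, hL⟩ := exists_complex_plane L hz hroot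
  obtain ⟨κ, hκ⟩ := LinearMap.exists_leftInverse_of_injective φ (LinearMap.ker_eq_bot.2 hφ)
  have hκ' : ∀ c, κ (φ c) = c := fun c => LinearMap.congr_fun hκ c
  let Φ := LinearMap.toContinuousLinearMap φ
  let K := LinearMap.toContinuousLinearMap κ
  let R : ℂ → W →L[ℝ] W := fun u =>
    ContinuousLinearMap.id ℝ W + Φ ∘L (ContinuousLinearMap.mul ℝ ℂ (u - 1)) ∘L K
  have hR : Tendsto R (𝓝 1) (𝓝 (ContinuousLinearMap.id ℝ W)) := by
    have hc : Continuous R := by fun_prop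
    have := hc.tendsto 1
    simpa [R] using this
  have hRφ : ∀ u c, R u (φ c) = φ (u * c) := fun u c => by
    change φ c + φ ((u - 1) * κ (φ c)) = _
    rw [hκ', ← map_add]
    congr 1
    ring
  refine hR.frequently ((frequently_pow_real (z := z)).mono ?_)
  rintro u ⟨q, hq, r, hr⟩
  refine ⟨q, hq, ?_⟩
  have hpow : ∀ (k : ℕ) c, ((L.toLinearMap ∘ₗ (R u).toLinearMap) ^ k) (φ c) = φ ((z * u) ^ k * c) := by
    intro k
    induction k with
    | zero => intro c; simp
    | succ k ih =>
      intro c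
      rw [pow_succ', Module.End.mul_apply, ih, LinearMap.comp_apply]
      change L (R u (φ _)) = _
      rw [hRφ, hL]
      congr 1
      ring
  have hne : ∀ t : ℝ, φ (1 + t * Complex.I) ≠ 0 := fun t h => by
    have := (injective_iff_map_eq_zero φ).1 hφ _ h
    have := congrArg Complex.re this
    simp at this
  refine Set.infinite_of_injective_forall_mem (f := fun t : ℝ =>
    Projectivization.mk ℝ (φ (1 + t * Complex.I)) (hne t)) ?_ ?_
  · intro t s hts
    rw [Projectivization.mk_eq_mk_iff'] at hts
    obtain ⟨a, ha⟩ := hts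
    rw [← map_smul] at ha
    have h1 := hφ ha
    have h2 := congrArg Complex.re h1
    have h3 := congrArg Complex.im h1
    simp at h2 h3
    rw [h2, one_mul] at h3
    exact h3.symm
  · intro t
    refine ⟨_, hne t, rfl, r, ?_⟩
    rw [hpow, hr, ← map_smul, Complex.real_smul]

end LinearAlgebra

/-! ### Structural stability excludes elliptic points -/

section Elliptic

variable {X : Type*} [MetricSpace X]
  {F : Type*} [NormedAddCommGroup F] [NormedSpace ℝ F]
  {V : X → Type*} [TopologicalSpace (TotalSpace F V)]
  [∀ x, NormedAddCommGroup (V x)] [∀ x, InnerProductSpace ℝ (V x)]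
  {T : X ≃ₜ X}

/-- The lines above `x` which are mapped to themselves by the `n`-th iterate. -/
def Cocycle.periodicLines (A : Cocycle F V T) (n : ℕ) (x : X) : Set (ProjBundle F V) :=
  {l | l.base = x ∧ A.proj^[n] l = l}

theorem Cocycle.ProjConj.finite_periodicLines {A B : Cocycle F V T} {ε : ℝ} (h : ProjConj ε A B)
    {n : ℕ} {x : X} (hA : (A.periodicLines n x).Finite) : (B.periodicLines n x).Finite := by
  obtain ⟨g, hg1, -, hg2⟩ := h
  refine (hA.image g).subset ?_
  rintro l ⟨hl1, hl2⟩
  have hg3 : Function.Semiconj g A.proj B.proj := hg2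
  refine ⟨g.symm l, ⟨?_, ?_⟩, g.apply_symm_apply l⟩
  · rw [← hg1, g.apply_symm_apply, hl1]
  · apply g.injective
    rw [(hg3.iterate_right n).eq, g.apply_symm_apply, hl2]

theorem Cocycle.iterate_proj (A : Cocycle F V T) (n : ℕ) (z : TotalSpace F V) (hz : z.snd ≠ 0) :
    ∃ h : (A.map^[n] z).snd ≠ 0, A.proj^[n] ⟨z.proj, Projectivization.mk ℝ z.snd hz⟩ =
      ⟨(A.map^[n] z).proj, Projectivization.mk ℝ (A.map^[n] z).snd h⟩ := by
  induction n generalizing z with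
  | zero => exact ⟨hz, rfl⟩
  | succ n ih => exact ih (A.map z) ((A.fib z.proj).map_ne_zero_iff.2 hz)

theorem Cocycle.periodicLines_eq (A : Cocycle F V T) {n : ℕ} {x : X} {N : V x →ₗ[ℝ] V x}
    (hN : ∀ u, A.map^[n] ⟨x, u⟩ = ⟨x, N u⟩) :
    A.periodicLines n x = (fun l => (⟨x, l⟩ : ProjBundle F V)) '' fixedLines N := by
  have key : ∀ (v : V x) (hv : v ≠ 0), A.proj^[n] ⟨x, Projectivization.mk ℝ v hv⟩ =
      ⟨x, Projectivization.mk ℝ v hv⟩ ↔ ∃ c : ℝ, N v = c • v := by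
    intro v hv
    obtain ⟨h, h'⟩ := A.iterate_proj n ⟨x, v⟩ hv
    have hNv : ∃ h : N v ≠ 0, A.proj^[n] ⟨x, Projectivization.mk ℝ v hv⟩ =
        ⟨x, Projectivization.mk ℝ (N v) h⟩ := by
      revert h h'
      rw [hN]
      exact fun h h' => ⟨h, h'⟩
    obtain ⟨h0, h1⟩ := hNv
    rw [h1]
    constructor
    · intro e
      have e' : Projectivization.mk ℝ (N v) h0 = Projectivization.mk ℝ v hv := by
        injection e
      obtain ⟨c, hc⟩ := (Projectivization.mk_eq_mk_iff' _ _ _ _ _).1 e'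
      exact ⟨c, hc.symm⟩
    · rintro ⟨c, hc⟩
      have e' : Projectivization.mk ℝ (N v) h0 = Projectivization.mk ℝ v hv :=
        (Projectivization.mk_eq_mk_iff' _ _ _ _ _).2 ⟨c, hc.symm⟩
      rw [e']
  ext l
  constructor
  · obtain ⟨y, l⟩ := l
    rintro ⟨rfl, hl⟩
    induction l using Projectivization.ind with
    | h v hv => exact ⟨_, ⟨v, hv, rfl, (key v hv).1 hl⟩, rfl⟩
  · rintro ⟨_, ⟨v, hv, rfl, hc⟩, rfl⟩
    exact ⟨rfl, (key v hv).2 hc⟩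

theorem Cocycle.finite_periodicLines_iff (A : Cocycle F V T) {n : ℕ} {x : X} {N : V x →ₗ[ℝ] V x}
    (hN : ∀ u, A.map^[n] ⟨x, u⟩ = ⟨x, N u⟩) :
    (A.periodicLines n x).Finite ↔ (fixedLines N).Finite := by
  rw [A.periodicLines_eq hN]
  refine Set.finite_image_iff (Function.Injective.injOn fun l l' h => ?_)
  injection h

/-- The cocycles of a filter can be perturbed above a point, in all directions, without being
changed above finitely many other points: for each neighborhood `U` this is possible inside `U`
for all cocycles of some smaller neighborhood. -/
def LocallyPerturbable (nhdsA : Filter (Cocycle F V T)) : Prop :=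
  ∀ U ∈ nhdsA, ∀ᶠ B in nhdsA, ∀ (x : X) (O : Finset X), x ∉ O →
    ∀ᶠ R in 𝓝 (ContinuousLinearMap.id ℝ (V x)), ∃ B' ∈ U,
      (∀ u, B'.fib x u = B.fib x (R u)) ∧ ∀ y ∈ O, ∀ u, B'.fib y u = B.fib y u

/-- The effect on the return map of a perturbation above one point of a periodic orbit. -/
theorem Cocycle.iterate_map_perturbed {B B' : Cocycle F V T} {x : X} {R L : V x →ₗ[ℝ] V x}
    (hx : x ∈ Function.periodicPts T)
    (hL : ∀ u, B.map^[Function.minimalPeriod T x] ⟨x, u⟩ = ⟨x, L u⟩)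
    (hx' : ∀ u, B'.fib x u = B.fib x (R u))
    (hO : ∀ k, 0 < k → k < Function.minimalPeriod T x → ∀ u, B'.fib (T^[k] x) u = B.fib (T^[k] x) u)
    (q : ℕ) (u : V x) :
    B'.map^[Function.minimalPeriod T x * q] ⟨x, u⟩ = ⟨x, ((L ∘ₗ R) ^ q) u⟩ := by
  set p := Function.minimalPeriod T x with hp
  have hp0 : 0 < p := Function.minimalPeriod_pos_of_mem_periodicPts hx
  have h1 : ∀ u, ∀ k, k + 1 ≤ p → B'.map^[k + 1] ⟨x, u⟩ = B.map^[k + 1] ⟨x, R u⟩ := by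
    intro u k
    induction k with
    | zero =>
      intro _
      exact congrArg (TotalSpace.mk (F := F) (T x)) (hx' u)
    | succ k ih =>
      intro hk
      rw [Function.iterate_succ_apply' B'.map (k + 1), Function.iterate_succ_apply' B.map (k + 1),
        ih (by omega),
        B.iterate_map]
      exact congrArg (TotalSpace.mk (F := F) (T (T^[k + 1] x))) (hO (k + 1) (by omega) (by omega) _)
  have h2 : ∀ u, B'.map^[p] ⟨x, u⟩ = ⟨x, L (R u)⟩ := fun u => by
    rw [← hL]
    have := h1 u (p - 1) (by omega)
    rwa [Nat.sub_add_cancel hp0] at this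
  induction q generalizing u with
  | zero => rfl
  | succ q ih =>
    rw [Nat.mul_succ, Function.iterate_add_apply, h2, ih, pow_succ]
    rfl

variable [FiniteDimensional ℝ F] [FiberBundle F V] [VectorBundle ℝ F V]

/-- Two perturbations of the return map at an elliptic point, one with infinitely many periodic
lines of some period, the other one with finitely many for each period, cannot both be conjugate to
the same projective cocycle by homeomorphisms which preserve the fibers. -/
theorem Cocycle.StructurallyStable.robustlyNoElliptic {A : Cocycle F V T}
    {nhdsA : Filter (Cocycle F V T)} (h : A.StructurallyStable nhdsA)
    (hP : LocallyPerturbable nhdsA) : Cocycle.RobustlyNoElliptic nhdsA := by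
  -- the closeness of the conjugacies to the identity plays no role, so any `ε` will do
  obtain ⟨U, hU, hconj⟩ := h 1 one_pos
  refine ⟨_, hP U hU, fun B hB i x hell => ?_⟩
  have hfin := finite_fiber F V x
  obtain ⟨hi0, hi, hx, L, hL, z, lam, hz, -, -, -, -, him, -⟩ := hell
  set p := Function.minimalPeriod T x with hp
  have hinj : Function.Injective L := fun u v huv => by
    have h1 : B.map^[p] ⟨x, u⟩ = B.map^[p] ⟨x, v⟩ := by rw [hL, hL, huv]
    have h2 := (B.bijective_map.1.iterate p) h1
    simpa using h2
  let L' : V x ≃ₗ[ℝ] V x := LinearEquiv.ofInjectiveEndo L hinj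
  have hL' : L'.toLinearMap = L := LinearMap.ext fun v => rfl
  have hroot : z i ∈ (L'.toLinearMap.charpoly.map (algebraMap ℝ ℂ)).roots := by
    rw [hL', ← hz]
    exact Multiset.mem_map_of_mem z (Finset.mem_Icc.2 ⟨hi0, hi.le⟩)
  classical
  -- the rest of the orbit, where the cocycle is not to be changed
  let O : Finset X := (Finset.Ioo 0 p).image fun k => T^[k] x
  have hxO : x ∉ O := by
    intro hmem
    obtain ⟨k, hk, hkx⟩ := Finset.mem_image.1 hmem
    rw [Finset.mem_Ioo] at hk
    exact Function.not_isPeriodicPt_of_pos_of_lt_minimalPeriod hk.1.ne' hk.2 hkx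
  have hpert := hB x O hxO
  have hO : ∀ k, 0 < k → k < p → T^[k] x ∈ O := fun k h1 h2 =>
    Finset.mem_image_of_mem _ (Finset.mem_Ioo.2 ⟨h1, h2⟩)
  obtain ⟨R₁, ⟨q, hq, hinf⟩, B₁, hB₁, hB₁x, hB₁O⟩ :=
    ((frequently_infinite_fixedLines L' him hroot).and_eventually hpert).exists
  obtain ⟨R₂, hfin₂, B₂, hB₂, hB₂x, hB₂O⟩ :=
    ((frequently_finite_fixedLines L').and_eventually hpert).exists
  rw [hL'] at hinf hfin₂
  have h1 := B₁.finite_periodicLines_iff (Cocycle.iterate_map_perturbed (R := R₁.toLinearMap) hx hL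
    hB₁x (fun k hk hk' u => hB₁O _ (hO k hk hk') u) q)
  have h2 := B₂.finite_periodicLines_iff (Cocycle.iterate_map_perturbed (R := R₂.toLinearMap) hx hL
    hB₂x (fun k hk hk' u => hB₂O _ (hO k hk hk') u) q)
  have h3 := (hconj B₂ hB₂).symm.finite_periodicLines (h2.2 (hfin₂ q hq))
  exact hinf (h1.1 ((hconj B₁ hB₁).finite_periodicLines h3))

end Elliptic

/-! ### Local perturbations in the uniform topology -/

section Uniform

variable {X : Type*} [MetricSpace X]
  {F : Type*} [NormedAddCommGroup F] [NormedSpace ℝ F]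
  {V : X → Type*} [TopologicalSpace (TotalSpace F V)]
  [∀ x, NormedAddCommGroup (V x)] [∀ x, InnerProductSpace ℝ (V x)]
  {T : X ≃ₜ X}

namespace Cocycle

theorem mem_nhdsC0 {A : Cocycle F V T} {U : Set (Cocycle F V T)} :
    U ∈ A.nhdsC0 ↔ ∃ δ > 0, ∀ B : Cocycle F V T,
      (∀ x u, ‖B.fib x u - A.fib x u‖ ≤ δ * ‖u‖) → B ∈ U := by
  change U ∈ ⨅ δ ∈ Set.Ioi (0 : ℝ),
    𝓟 {B : Cocycle F V T | ∀ x (u : V x), ‖B.fib x u - A.fib x u‖ ≤ δ * ‖u‖} ↔ _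
  rw [mem_biInf_of_directed]
  · simp only [mem_principal, Set.subset_def]
    rfl
  · intro a ha b hb
    refine ⟨min a b, Set.mem_Ioi.2 (lt_min ha hb), ?_, ?_⟩ <;> refine principal_mono.2 fun B hB x u => (hB x u).trans
      (mul_le_mul_of_nonneg_right ?_ (norm_nonneg u))
    · exact min_le_left a b
    · exact min_le_right a b
  · exact ⟨1, Set.mem_Ioi.2 one_pos⟩

variable [FiberBundle F V] [VectorBundle ℝ F V] [FiniteDimensional ℝ F]

/-- Precomposition of a cocycle with the bundle endomorphism `id + E`, if that one is
injective. -/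
theorem exists_precomp_add (B : Cocycle F V T) {E : ∀ x, V x →ₗ[ℝ] V x}
    (hE : Continuous fun z : TotalSpace F V => (⟨z.proj, E z.proj z.snd⟩ : TotalSpace F V))
    (hinj : ∀ x u, u + E x u = 0 → u = 0) :
    ∃ B' : Cocycle F V T, ∀ x u, B'.fib x u = B.fib x (u + E x u) := by
  have := finite_fiber F V
  refine ⟨B.precomp (fun x => LinearEquiv.ofInjectiveEndo (LinearMap.id + E x) ?_) ?_,
    fun x u => rfl⟩
  · refine (injective_iff_map_eq_zero _).2 fun u hu => hinj x u hu
  · refine continuous_iff_continuousAt.2 fun z => ?_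
    have h1 := continuousAt_mk_iff.1 (hE.continuousAt (x := z))
    refine continuousAt_mk_iff.2 ⟨h1.1, ?_⟩
    exact ((continuousAt_mk_iff.1 (continuousAt_id (x := z))).2.add h1.2).congr
      (Eventually.of_forall fun w => (map_add _ _ _).symm)

variable [IsContinuousRiemannianBundle F V] [CompactSpace X]

/-- The uniform topology is locally perturbable: a perturbation of the identity of one fiber
extends to a bundle automorphism by cutting off the endomorphism of a trivial bundle in which the
bundle embeds. -/
theorem locallyPerturbable_nhdsC0 (A : Cocycle F V T) : LocallyPerturbable A.nhdsC0 := by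
  intro U hU
  obtain ⟨δ, hδ, hU⟩ := mem_nhdsC0.1 hU
  obtain ⟨t, ⟨J⟩⟩ := exists_fiberEmbedding (F := F) (V := V)
  obtain ⟨Cp, hCp, hp⟩ := J.exists_norm_p_le
  obtain ⟨Cj, hCj, hj⟩ := J.exists_norm_j_le
  obtain ⟨a, ha, hA⟩ := exists_norm_bundleMap_le T.continuous
    (P := fun x => (A.fibL x).toContinuousLinearMap) A.continuous_fib
  refine mem_nhdsC0.2 ⟨δ / 2, half_pos hδ, fun B hB x O hxO => ?_⟩
  have hB' : ∀ y u, ‖B.fib y u‖ ≤ (a + δ) * ‖u‖ := fun y u => by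
    calc ‖B.fib y u‖ = ‖A.fib y u + (B.fib y u - A.fib y u)‖ := by rw [add_sub_cancel]
      _ ≤ a * ‖u‖ + δ / 2 * ‖u‖ := (norm_add_le _ _).trans (add_le_add (hA y u) (hB y u))
      _ ≤ _ := by nlinarith [mul_nonneg hδ.le (norm_nonneg u)]
  obtain ⟨f, hf0, hf1, hf⟩ := exists_continuous_zero_one_of_isClosed
    (O.finite_toSet.isClosed) (isClosed_singleton (x := x))
    (Set.disjoint_singleton_right.2 (by simpa using hxO))
  let L : (V x →L[ℝ] V x) → ((t → F) →L[ℝ] (t → F)) := fun R =>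
    J.j x ∘L (R - ContinuousLinearMap.id ℝ (V x)) ∘L J.p x
  have hL : Continuous L :=
    continuous_const.clm_comp ((continuous_id.sub continuous_const).clm_comp continuous_const)
  have hL0 : L (ContinuousLinearMap.id ℝ (V x)) = 0 := by simp [L]
  set η := min (1 / 2) (δ / 2 / (a + δ)) with hη
  have hη0 : 0 < η := by positivity
  have hev : ∀ᶠ R in 𝓝 (ContinuousLinearMap.id ℝ (V x)), Cp * (‖L R‖ * Cj) < η := by
    have h1 : Continuous fun R => Cp * (‖L R‖ * Cj) := by fun_prop
    have h2 := h1.tendsto (ContinuousLinearMap.id ℝ (V x))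
    rw [hL0, norm_zero, zero_mul, mul_zero] at h2
    exact h2.eventually (gt_mem_nhds hη0)
  filter_upwards [hev] with R hR
  let E : ∀ y, V y →L[ℝ] V y := fun y => f y • (J.p y ∘L L R ∘L J.j y)
  have hEc : Continuous fun z : TotalSpace F V => (⟨z.proj, E z.proj z.snd⟩ : TotalSpace F V) :=
    continuous_mk_smul (b := fun z : TotalSpace F V => z.proj)
      (s := fun z => J.p z.proj (L R (J.j z.proj z.snd))) (c := fun z => f z.proj)
      (J.continuous_p.comp ((FiberBundle.continuous_proj F V).prodMk
        ((L R).continuous.comp J.continuous_j)))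
      (f.continuous.comp (FiberBundle.continuous_proj F V))
  have hE : ∀ y u, ‖E y u‖ ≤ η * ‖u‖ := fun y u => by
    have h1 : ‖J.p y (L R (J.j y u))‖ ≤ η * ‖u‖ := by
      calc _ ≤ Cp * (‖L R‖ * (Cj * ‖u‖)) :=
            (hp _ _).trans (mul_le_mul_of_nonneg_left (((L R).le_opNorm _).trans
              (mul_le_mul_of_nonneg_left (hj y u) (norm_nonneg _))) hCp.le)
        _ = Cp * (‖L R‖ * Cj) * ‖u‖ := by ring
        _ ≤ _ := mul_le_mul_of_nonneg_right hR.le (norm_nonneg u)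
    calc ‖E y u‖ = |f y| * ‖J.p y (L R (J.j y u))‖ := norm_smul _ _
      _ ≤ 1 * ‖J.p y (L R (J.j y u))‖ := by
        refine mul_le_mul_of_nonneg_right ?_ (norm_nonneg _)
        rw [abs_of_nonneg (hf y).1]
        exact (hf y).2
      _ ≤ _ := by rwa [one_mul]
  obtain ⟨B', hB'E⟩ := B.exists_precomp_add (E := fun y => (E y).toLinearMap) hEc (fun y u hu => by
    have h1 : ‖u‖ ≤ η * ‖u‖ := by
      calc ‖u‖ = ‖E y u‖ := (congrArg norm (eq_neg_of_add_eq_zero_left hu)).trans (norm_neg _)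
        _ ≤ _ := hE y u
    have h2 : η * ‖u‖ ≤ 1 / 2 * ‖u‖ := mul_le_mul_of_nonneg_right (min_le_left _ _) (norm_nonneg u)
    exact norm_le_zero_iff.1 (by linarith))
  refine ⟨B', hU B' fun y u => ?_, fun u => ?_, fun y hy u => ?_⟩
  · have h1 : B'.fib y u - A.fib y u = B.fib y (E y u) + (B.fib y u - A.fib y u) := by
      rw [hB'E, map_add, ContinuousLinearMap.coe_coe]
      abel
    have h2 : ‖B.fib y (E y u)‖ ≤ δ / 2 * ‖u‖ := by
      calc _ ≤ (a + δ) * (η * ‖u‖) :=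
            (hB' _ _).trans (mul_le_mul_of_nonneg_left (hE y u) (by positivity))
        _ ≤ (a + δ) * (δ / 2 / (a + δ) * ‖u‖) := by
          gcongr
          exact min_le_right _ _
        _ = _ := by field_simp
    rw [h1]
    refine (norm_add_le _ _).trans ?_
    linarith [hB y u]
  · have h1 : f x = 1 := hf1 rfl
    have h2 : E x u = R u - u := by
      change f x • J.p x (J.j x (R (J.p x (J.j x u)) - J.p x (J.j x u))) = _
      rw [h1, one_smul, J.p_j, J.p_j]
    rw [hB'E, ContinuousLinearMap.coe_coe, h2, add_sub_cancel]
  · have h1 : f y = 0 := hf0 hy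
    have h2 : E y u = 0 := by
      change f y • J.p y (L R (J.j y u)) = 0
      rw [h1, zero_smul]
    rw [hB'E, ContinuousLinearMap.coe_coe, h2, add_zero]

end Cocycle

end Uniform

/-! ### Sections of the endomorphism bundle of a smooth vector bundle -/

section Sections

variable {F : Type*} [NormedAddCommGroup F] [NormedSpace ℝ F]
  {E : Type*} [NormedAddCommGroup E] [NormedSpace ℝ E]
  {M : Type*} [TopologicalSpace M] [ChartedSpace E M]
  {W : M → Type*} [TopologicalSpace (TotalSpace F W)]
  [∀ m, AddCommGroup (W m)] [∀ m, Module ℝ (W m)] [∀ m, TopologicalSpace (W m)]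
  [FiberBundle F W] [VectorBundle ℝ F W]
  [∀ m, IsTopologicalAddGroup (W m)] [∀ m, ContinuousSMul ℝ (W m)]

variable (F E) in
/-- Smoothness of class `C^r` of a section of the endomorphism bundle. -/
def IsCrSection (r : ℕ∞) (S : ∀ m, W m →L[ℝ] W m) : Prop :=
  ContMDiff 𝓘(ℝ, E) (𝓘(ℝ, E).prod 𝓘(ℝ, F →L[ℝ] F)) r
    (fun m => (⟨m, S m⟩ : TotalSpace (F →L[ℝ] F) fun m => W m →L[ℝ] W m))

variable (F) in
/-- A section of the endomorphism bundle, read in the trivialization around `m₁`. -/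
def inTriv (m₁ : M) (S : ∀ m, W m →L[ℝ] W m) (m : M) : F →L[ℝ] F :=
  ContinuousLinearMap.inCoordinates F W F W m₁ m m₁ m (S m)

theorem inTriv_add (m₁ : M) (S S' : ∀ m, W m →L[ℝ] W m) (m : M) :
    inTriv F m₁ (S + S') m = inTriv F m₁ S m + inTriv F m₁ S' m := by
  simp [inTriv, ContinuousLinearMap.inCoordinates]

theorem inTriv_smul (m₁ : M) (c : ℝ) (S : ∀ m, W m →L[ℝ] W m) (m : M) :
    inTriv F m₁ (c • S) m = c • inTriv F m₁ S m := by
  simp [inTriv, ContinuousLinearMap.inCoordinates]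

theorem inTriv_sum {ι : Type*} (t : Finset ι) (m₁ : M) (S : ι → ∀ m, W m →L[ℝ] W m) (m : M) :
    inTriv F m₁ (∑ i ∈ t, S i) m = ∑ i ∈ t, inTriv F m₁ (S i) m := by
  classical
  induction t using Finset.induction_on with
  | empty => simp [inTriv, ContinuousLinearMap.inCoordinates]
  | insert i t hi ih => rw [Finset.sum_insert hi, inTriv_add, ih, Finset.sum_insert hi]

theorem inTriv_comp {m₁ m : M} (hm : m ∈ (trivializationAt F W m₁).baseSet)
    (S S' : ∀ m, W m →L[ℝ] W m) :
    inTriv F m₁ (fun m => S m ∘L S' m) m = inTriv F m₁ S m ∘L inTriv F m₁ S' m := by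
  ext w
  simp [inTriv, ContinuousLinearMap.inCoordinates, -Trivialization.continuousLinearMapAt_apply,
    -Trivialization.symmL_apply, Trivialization.symmL_continuousLinearMapAt _ hm]

variable [ContMDiffVectorBundle ∞ F W 𝓘(ℝ, E)] {r : ℕ∞}

theorem contMDiffAt_section_iff_inTriv {S : ∀ m, W m →L[ℝ] W m} {m₁ m : M}
    (hm : m ∈ (trivializationAt F W m₁).baseSet) :
    ContMDiffAt 𝓘(ℝ, E) (𝓘(ℝ, E).prod 𝓘(ℝ, F →L[ℝ] F)) r
      (fun m => (⟨m, S m⟩ : TotalSpace (F →L[ℝ] F) fun m => W m →L[ℝ] W m)) m ↔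
    ContMDiffAt 𝓘(ℝ, E) 𝓘(ℝ, F →L[ℝ] F) r (inTriv F m₁ S) m := by
  have : ContMDiffVectorBundle r F W 𝓘(ℝ, E) :=
    ContMDiffVectorBundle.of_le (n := ∞) (WithTop.coe_le_coe.2 le_top)
  exact Trivialization.contMDiffAt_section_iff
    (trivializationAt (F →L[ℝ] F) (fun m => W m →L[ℝ] W m) m₁)
    (by rw [hom_trivializationAt_baseSet]; exact ⟨hm, hm⟩)

theorem IsCrSection.contDiffAt_inTriv [IsManifold 𝓘(ℝ, E) ∞ M] {S : ∀ m, W m →L[ℝ] W m}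
    (hS : IsCrSection F E r S) {m₁ m : M}
    (hm : m ∈ (chartAt E m₁).source ∩ (trivializationAt F W m₁).baseSet) :
    ContDiffAt ℝ r (fun y => inTriv F m₁ S ((chartAt E m₁).symm y)) (chartAt E m₁ m) := by
  have : IsManifold 𝓘(ℝ, E) r M := IsManifold.of_le (n := ∞) (WithTop.coe_le_coe.2 le_top)
  have h1 := (contMDiffAt_section_iff_inTriv hm.2).1 (hS m)
  have h2 : ContMDiffAt 𝓘(ℝ, E) 𝓘(ℝ, E) r (chartAt E m₁).symm (chartAt E m₁ m) :=
    (contMDiffOn_chart_symm (I := 𝓘(ℝ, E)) (x := m₁)).contMDiffAt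
      ((chartAt E m₁).open_target.mem_nhds ((chartAt E m₁).map_source hm.1))
  rw [← (chartAt E m₁).left_inv hm.1] at h1
  exact contMDiffAt_iff_contDiffAt.1
    (ContMDiffAt.comp (g := inTriv F m₁ S) (f := (chartAt E m₁).symm) _ h1 h2)

/-- The perturbations of a section within a finite-dimensional space of `C^r` sections: if they are
small enough, then they do not leave a given neighborhood. -/
theorem eventually_add_mem_nhdsIdSection [FiniteDimensional ℝ F] [IsManifold 𝓘(ℝ, E) ∞ M]
    {N : Set (∀ m, W m →L[ℝ] W m)} (hN : N ∈ nhdsIdSection F E W r) :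
    ∀ᶠ S in nhdsIdSection F E W r, ∀ Λ : (F →L[ℝ] F) →ₗ[ℝ] (∀ m, W m →L[ℝ] W m),
      (∀ K, IsCrSection F E r (Λ K)) → ∀ᶠ K in 𝓝 0, S + Λ K ∈ N := by
  -- The sets `N` with this property form a filter, so that generators can be treated one by one.
  let P : Set (∀ m, W m →L[ℝ] W m) → Prop := fun N => ∀ᶠ S in nhdsIdSection F E W r,
    ∀ Λ : (F →L[ℝ] F) →ₗ[ℝ] (∀ m, W m →L[ℝ] W m),
      (∀ K, IsCrSection F E r (Λ K)) → ∀ᶠ K in 𝓝 0, S + Λ K ∈ N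
  have h1 : P Set.univ := Eventually.of_forall fun S Λ _ => Eventually.of_forall fun K => trivial
  have h2 : ∀ {N N'}, P N → N ⊆ N' → P N' := fun {N N'} h hNN' =>
    Eventually.mono h fun S hS Λ hΛ => (hS Λ hΛ).mono fun K hK => hNN' hK
  have h3 : ∀ {N N'}, P N → P N' → P (N ∩ N') := fun {N N'} h h' =>
    (Eventually.and h h').mono fun S hS Λ hΛ => (hS.1 Λ hΛ).and (hS.2 Λ hΛ)
  let f : Filter (∀ m, W m →L[ℝ] W m) :=
    { sets := {N | P N}
      univ_sets := h1
      sets_of_superset := fun h => h2 h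
      inter_sets := fun h => h3 h }
  suffices f ≤ nhdsIdSection F E W r from this hN
  have hCr : ∀ᶠ S in nhdsIdSection F E W r, IsCrSection F E r S :=
    mem_inf_of_left (mem_principal_self _)
  refine le_inf (le_principal_iff.2 ?_) ?_
  · refine hCr.mono fun S hS Λ hΛ => Eventually.of_forall fun K => ?_
    have : ContMDiffVectorBundle r F W 𝓘(ℝ, E) :=
      ContMDiffVectorBundle.of_le (n := ∞) (WithTop.coe_le_coe.2 le_top)
    exact ContMDiff.add_section hS (hΛ K)
  refine le_iInf fun m₁ => le_iInf fun Z => le_iInf fun k => le_iInf fun δ => le_iInf fun hZ =>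
    le_iInf fun hZm => le_iInf fun hk => le_iInf fun hδ => le_principal_iff.2 ?_
  have hgen : ∀ᶠ S in nhdsIdSection F E W r, ∀ m ∈ Z, ∀ j ≤ k,
      ‖iteratedFDeriv ℝ j (fun y : E => inTriv F m₁ S ((chartAt E m₁).symm y)
        - ContinuousLinearMap.id ℝ F) (chartAt E m₁ m)‖ < δ / 2 :=
    mem_inf_of_right (mem_iInf_of_mem m₁ <| mem_iInf_of_mem Z <| mem_iInf_of_mem k <|
      mem_iInf_of_mem (δ / 2) <| mem_iInf_of_mem hZ <| mem_iInf_of_mem hZm <| mem_iInf_of_mem hk <|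
        mem_iInf_of_mem (half_pos hδ) (mem_principal_self _))
  refine (hCr.and hgen).mono fun S ⟨hS, hSδ⟩ Λ hΛ => ?_
  let b := Module.finBasis ℝ (F →L[ℝ] F)
  have hle : ∀ j ≤ k, ((j : ℕ) : WithTop ℕ∞) ≤ (r : WithTop ℕ∞) := fun j hj => by
    refine le_trans ?_ (WithTop.coe_le_coe.2 hk)
    exact_mod_cast hj
  let g : Fin (Module.finrank ℝ (F →L[ℝ] F)) → E → (F →L[ℝ] F) := fun a y =>
    inTriv F m₁ (Λ (b a)) ((chartAt E m₁).symm y)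
  have hg : ∀ a, ∀ m ∈ Z, ∀ j ≤ k, ContDiffAt ℝ j (g a) (chartAt E m₁ m) := fun a m hm j hj =>
    ((hΛ (b a)).contDiffAt_inTriv (hZm hm)).of_le (hle j hj)
  have hbound : ∀ a, ∀ j : Fin (k + 1), ∃ C, ∀ m ∈ Z,
      ‖iteratedFDeriv ℝ j (g a) (chartAt E m₁ m)‖ ≤ C := fun a j => by
    refine hZ.exists_bound_of_continuousOn
      (f := fun m => iteratedFDeriv ℝ j (g a) (chartAt E m₁ m)) fun m hm => ?_
    refine ContinuousAt.continuousWithinAt (ContinuousAt.comp (f := chartAt E m₁)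
      (g := iteratedFDeriv ℝ j (g a)) ?_ ((chartAt E m₁).continuousAt (hZm hm).1))
    exact (hg a m hm j (Nat.lt_succ_iff.1 j.2)).continuousAt_iteratedFDeriv le_rfl
  choose C hC using hbound
  have hsmall : ∀ᶠ K in 𝓝 (0 : F →L[ℝ] F), ∀ j : Fin (k + 1),
      ∑ a, ‖b.repr K a‖ * C a j < δ / 2 := by
    refine eventually_all.2 fun j => ?_
    have h1 : Continuous fun K : F →L[ℝ] F => ∑ a, ‖b.repr K a‖ * C a j :=
      continuous_finsetSum _ fun a _ =>
        ((LinearMap.continuous_of_finiteDimensional (b.coord a)).norm).mul continuous_const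
    have h2 := h1.tendsto 0
    simp only [map_zero, Finsupp.coe_zero, Pi.zero_apply, norm_zero, zero_mul,
      Finset.sum_const_zero] at h2
    exact h2.eventually (gt_mem_nhds (half_pos hδ))
  filter_upwards [hsmall] with K hK m hm j hj
  have e1 : (fun y : E => inTriv F m₁ (S + Λ K) ((chartAt E m₁).symm y)
        - ContinuousLinearMap.id ℝ F) =
      (fun y : E => inTriv F m₁ S ((chartAt E m₁).symm y) - ContinuousLinearMap.id ℝ F) +
        ∑ a, b.repr K a • g a := by
    funext y
    have h1 : Λ K = ∑ a, b.repr K a • Λ (b a) := by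
      conv_lhs => rw [← b.sum_repr K]
      simp only [map_sum, map_smul]
    rw [inTriv_add, h1, inTriv_sum, Pi.add_apply, Finset.sum_apply]
    simp only [inTriv_smul, Pi.smul_apply, g]
    abel
  change ‖iteratedFDeriv ℝ j (fun y : E => inTriv F m₁ (S + Λ K) ((chartAt E m₁).symm y)
        - ContinuousLinearMap.id ℝ F) (chartAt E m₁ m)‖ < δ
  have hgj : ∀ a ∈ Finset.univ, ContDiffAt ℝ j (b.repr K a • g a) (chartAt E m₁ m) :=
    fun a _ => ContDiffAt.const_smul (b.repr K a) (hg a m hm j hj)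
  rw [e1, iteratedFDeriv_add_apply
    (((hS.contDiffAt_inTriv (hZm hm)).of_le (hle j hj)).sub contDiffAt_const)
    (by simpa only [Finset.sum_fn] using ContDiffAt.sum hgj), iteratedFDeriv_sum_apply hgj]
  calc _ ≤ _ + ∑ a, ‖iteratedFDeriv ℝ j (b.repr K a • g a) (chartAt E m₁ m)‖ :=
        (norm_add_le _ _).trans (add_le_add_right (norm_sum_le _ _) _)
    _ < δ / 2 + δ / 2 := by
      refine add_lt_add (hSδ m hm j hj) (lt_of_le_of_lt (Finset.sum_le_sum fun a _ => ?_)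
        (hK ⟨j, Nat.lt_succ_iff.2 hj⟩))
      rw [iteratedFDeriv_const_smul_apply (hg a m hm j hj), norm_smul]
      exact mul_le_mul_of_nonneg_left (hC a ⟨j, Nat.lt_succ_iff.2 hj⟩ m hm) (norm_nonneg _)
    _ = δ := add_halves δ

end Sections

/-! ### Local perturbations in the `C^r` topology -/

section Bump

variable {F : Type*} [NormedAddCommGroup F] [NormedSpace ℝ F]
  {E : Type*} [NormedAddCommGroup E] [NormedSpace ℝ E] [FiniteDimensional ℝ E]
  {M : Type*} [TopologicalSpace M] [ChartedSpace E M]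
  {W : M → Type*} [TopologicalSpace (TotalSpace F W)]
  [∀ m, AddCommGroup (W m)] [∀ m, Module ℝ (W m)] [∀ m, TopologicalSpace (W m)]
  [FiberBundle F W] [VectorBundle ℝ F W]
  [∀ m, IsTopologicalAddGroup (W m)] [∀ m, ContinuousSMul ℝ (W m)]

variable (W) in
/-- The section of the endomorphism bundle which is, in the trivialization around `m₀`, the constant
endomorphism `K` multiplied by the bump function `f`. -/
def bumpEndo {m₀ : M} (f : SmoothBumpFunction 𝓘(ℝ, E) m₀) (K : F →L[ℝ] F) (m : M) :
    W m →L[ℝ] W m :=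
  f m • ((trivializationAt F W m₀).symmL ℝ m ∘L K ∘L
    (trivializationAt F W m₀).continuousLinearMapAt ℝ m)

/-- The composition of a section with the sections `bumpEndo W f K`, linear in `K`. -/
def compBumpEndo {m₀ : M} (f : SmoothBumpFunction 𝓘(ℝ, E) m₀) (S : ∀ m, W m →L[ℝ] W m) :
    (F →L[ℝ] F) →ₗ[ℝ] (∀ m, W m →L[ℝ] W m) where
  toFun K m := S m ∘L bumpEndo W f K m
  map_add' K K' := by
    funext m
    simp [bumpEndo]
  map_smul' c K := by
    funext m
    simp [bumpEndo, smul_comm c (f m)]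

theorem inTriv_bumpEndo {m₀ m : M} (f : SmoothBumpFunction 𝓘(ℝ, E) m₀) (K : F →L[ℝ] F)
    (hm : m ∈ (trivializationAt F W m₀).baseSet) :
    inTriv F m₀ (bumpEndo W f K) m = f m • K := by
  ext w
  simp [inTriv, ContinuousLinearMap.inCoordinates, bumpEndo,
    -Trivialization.continuousLinearMapAt_apply,
    -Trivialization.symmL_apply, Trivialization.continuousLinearMapAt_symmL _ hm]

theorem IsCrSection.compBumpEndo [T2Space M] [IsManifold 𝓘(ℝ, E) ∞ M]
    [ContMDiffVectorBundle ∞ F W 𝓘(ℝ, E)] {r : ℕ∞} {S : ∀ m, W m →L[ℝ] W m}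
    (hS : IsCrSection F E r S) {m₀ : M} (f : SmoothBumpFunction 𝓘(ℝ, E) m₀)
    (hf : tsupport f ⊆ (trivializationAt F W m₀).baseSet) (K : F →L[ℝ] F) :
    IsCrSection F E r (compBumpEndo f S K) := by
  intro m
  by_cases hm : m ∈ tsupport f
  · refine (contMDiffAt_section_iff_inTriv (hf hm)).2 ?_
    have h1 := (contMDiffAt_section_iff_inTriv (hf hm)).1 (hS m)
    have h2 : ContMDiffAt 𝓘(ℝ, E) 𝓘(ℝ, F →L[ℝ] F) r (fun m => f m • K) m :=
      ContMDiffAt.smul ((f.contMDiff.of_le (WithTop.coe_le_coe.2 le_top)).contMDiffAt)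
        contMDiffAt_const
    refine (h1.clm_comp h2).congr_of_eventuallyEq ?_
    filter_upwards [(trivializationAt F W m₀).open_baseSet.mem_nhds (hf hm)] with m' hm'
    rw [← inTriv_bumpEndo f K hm']
    exact inTriv_comp hm' S (bumpEndo W f K)
  · refine (contMDiffAt_section_iff_inTriv (mem_baseSet_trivializationAt F W m)).2 ?_
    refine (contMDiffAt_const (c := (0 : F →L[ℝ] F))).congr_of_eventuallyEq ?_
    filter_upwards [notMem_tsupport_iff_eventuallyEq.1 hm] with m' hm'
    have h0 : f m' = 0 := hm'
    have h1 : CocycleStability.compBumpEndo f S K m' = 0 := by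
      simp [CocycleStability.compBumpEndo, bumpEndo, h0]
    simp [inTriv, ContinuousLinearMap.inCoordinates, h1]

end Bump

section Frame

variable {X : Type*} [MetricSpace X]
  {F : Type*} [NormedAddCommGroup F] [NormedSpace ℝ F]
  {V : X → Type*} [TopologicalSpace (TotalSpace F V)]
  [∀ x, NormedAddCommGroup (V x)] [∀ x, InnerProductSpace ℝ (V x)]
  {M : Type*} [TopologicalSpace M]
  {W : M → Type*} [TopologicalSpace (TotalSpace F W)]
  [∀ m, AddCommGroup (W m)] [∀ m, Module ℝ (W m)] [∀ m, TopologicalSpace (W m)]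
  [FiberBundle F W] [VectorBundle ℝ F W]

namespace Realization

variable (ρ : Realization F V W) (m₀ : M)

/-- The coordinates of the vectors of `V` in the trivialization of `W` around `m₀`. -/
def coord (y : X) : V y →ₗ[ℝ] F :=
  ((trivializationAt F W m₀).continuousLinearMapAt ℝ (ρ.ι y)).toLinearMap ∘ₗ (ρ.Φ y).toLinearMap

/-- The vector of `V` with given coordinates in the trivialization of `W` around `m₀`. -/
def frame (y : X) : F →ₗ[ℝ] V y :=
  (ρ.Φ y).symm.toLinearMap ∘ₗ ((trivializationAt F W m₀).symmL ℝ (ρ.ι y)).toLinearMap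

variable {ρ m₀}

theorem frame_coord {y : X} (hy : ρ.ι y ∈ (trivializationAt F W m₀).baseSet) (v : V y) :
    ρ.frame m₀ y (ρ.coord m₀ y v) = v := by
  simp [frame, coord, -Trivialization.continuousLinearMapAt_apply,
    -Trivialization.symmL_apply, Trivialization.symmL_continuousLinearMapAt _ hy]

theorem coord_frame {y : X} (hy : ρ.ι y ∈ (trivializationAt F W m₀).baseSet) (w : F) :
    ρ.coord m₀ y (ρ.frame m₀ y w) = w := by
  simp [frame, coord, -Trivialization.continuousLinearMapAt_apply,
    -Trivialization.symmL_apply, Trivialization.continuousLinearMapAt_symmL _ hy]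

theorem eventually_mem_baseSet {y : X} (hy : ρ.ι y ∈ (trivializationAt F W m₀).baseSet) :
    ∀ᶠ y' in 𝓝 y, ρ.ι y' ∈ (trivializationAt F W m₀).baseSet :=
  ρ.isEmbedding.continuous.continuousAt ((trivializationAt F W m₀).open_baseSet.mem_nhds hy)

variable [FiberBundle F V] [VectorBundle ℝ F V]

theorem continuousAt_coord {z₀ : TotalSpace F V}
    (h : ρ.ι z₀.proj ∈ (trivializationAt F W m₀).baseSet) :
    ContinuousAt (fun z : TotalSpace F V => ρ.coord m₀ z.proj z.snd) z₀ := by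
  set e := trivializationAt F W m₀ with he
  have h1 : ContinuousAt (fun w : TotalSpace F W => (e w).2) ⟨ρ.ι z₀.proj, ρ.Φ _ z₀.snd⟩ :=
    (e.continuousAt (e.mem_source.2 h)).snd
  have h2 := ContinuousAt.comp (x := z₀)
    (f := fun z : TotalSpace F V => (⟨ρ.ι z.proj, ρ.Φ z.proj z.snd⟩ : TotalSpace F W)) h1
    ρ.continuous_Φ.continuousAt
  refine h2.congr ?_
  filter_upwards [(FiberBundle.continuous_proj F V).continuousAt.eventually
    (eventually_mem_baseSet h)] with z hz
  simp only [Function.comp_apply, coord, LinearMap.comp_apply, ContinuousLinearMap.coe_coe,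
    Trivialization.continuousLinearMapAt_apply, Trivialization.coe_linearMapAt_of_mem _ hz]
  rfl

theorem continuousAt_frame [FiniteDimensional ℝ F] {y : X}
    (h : ρ.ι y ∈ (trivializationAt F W m₀).baseSet) (w : F) :
    ContinuousAt (fun z : X × F => (⟨z.1, ρ.frame m₀ z.1 z.2⟩ : TotalSpace F V)) (y, w) :=
  continuousAt_inverse_frame (ρ.coord m₀) (ρ.frame m₀)
    ((eventually_mem_baseSet h).mono fun _ hy => frame_coord hy)
    ((eventually_mem_baseSet h).mono fun _ hy => coord_frame hy)
    (fun _ => continuousAt_coord h) w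

end Realization

end Frame

section Neighborhoods

variable {X : Type*} [MetricSpace X]
  {F : Type*} [NormedAddCommGroup F] [NormedSpace ℝ F]
  {V : X → Type*} [TopologicalSpace (TotalSpace F V)]
  [∀ x, NormedAddCommGroup (V x)] [∀ x, InnerProductSpace ℝ (V x)]
  {E : Type*} [NormedAddCommGroup E] [NormedSpace ℝ E]
  {M : Type*} [TopologicalSpace M] [ChartedSpace E M]
  {W : M → Type*} [TopologicalSpace (TotalSpace F W)]
  [∀ m, AddCommGroup (W m)] [∀ m, Module ℝ (W m)] [∀ m, TopologicalSpace (W m)]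
  [FiberBundle F W] [VectorBundle ℝ F W]
  [∀ m, IsTopologicalAddGroup (W m)] [∀ m, ContinuousSMul ℝ (W m)]
  {T : X ≃ₜ X} (A : Cocycle F V T) (ρ : Realization F V W) (r : ℕ∞)

theorem Cocycle.mem_nhdsCrRight {U : Set (Cocycle F V T)} :
    U ∈ A.nhdsCrRight E ρ r ↔ ∃ N ∈ nhdsIdSection F E W r, ∀ S ∈ N, ∀ B : Cocycle F V T,
      (∀ x u, B.fib x u = A.fib x ((ρ.Φ x).symm (S (ρ.ι x) (ρ.Φ x u)))) → B ∈ U := by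
  rw [nhdsCrRight, mem_lift'_sets]
  · refine exists_congr fun N => and_congr_right fun _ => ⟨fun h S hS B hB => h ⟨S, hS, hB⟩, ?_⟩
    rintro h B ⟨S, hS, hB⟩
    exact h S hS B hB
  · rintro N N' h B ⟨S, hS, hB⟩
    exact ⟨S, h hS, hB⟩

theorem Cocycle.mem_nhdsCrLeft {U : Set (Cocycle F V T)} :
    U ∈ A.nhdsCrLeft E ρ r ↔ ∃ N ∈ nhdsIdSection F E W r, ∀ S ∈ N, ∀ B : Cocycle F V T,
      (∀ x u, B.fib x u = (ρ.Φ (T x)).symm (S (ρ.ι (T x)) (ρ.Φ (T x) (A.fib x u)))) → B ∈ U := by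
  rw [nhdsCrLeft, mem_lift'_sets]
  · refine exists_congr fun N => and_congr_right fun _ => ⟨fun h S hS B hB => h ⟨S, hS, hB⟩, ?_⟩
    rintro h B ⟨S, hS, hB⟩
    exact h S hS B hB
  · rintro N N' h B ⟨S, hS, hB⟩
    exact ⟨S, h hS, hB⟩

theorem eventually_isCrSection : ∀ᶠ S in nhdsIdSection F E W r, IsCrSection F E r S :=
  mem_inf_of_left (mem_principal_self _)

end Neighborhoods

section Perturbation

variable {X : Type*} [MetricSpace X]
  {F : Type*} [NormedAddCommGroup F] [NormedSpace ℝ F] [FiniteDimensional ℝ F]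
  {V : X → Type*} [TopologicalSpace (TotalSpace F V)]
  [∀ x, NormedAddCommGroup (V x)] [∀ x, InnerProductSpace ℝ (V x)]
  [FiberBundle F V] [VectorBundle ℝ F V]
  {E : Type*} [NormedAddCommGroup E] [NormedSpace ℝ E] [FiniteDimensional ℝ E]
  {M : Type*} [TopologicalSpace M] [T2Space M] [ChartedSpace E M] [IsManifold 𝓘(ℝ, E) ∞ M]
  {W : M → Type*} [TopologicalSpace (TotalSpace F W)]
  [∀ m, AddCommGroup (W m)] [∀ m, Module ℝ (W m)] [∀ m, TopologicalSpace (W m)]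
  [FiberBundle F W] [VectorBundle ℝ F W]
  [∀ m, IsTopologicalAddGroup (W m)] [∀ m, ContinuousSMul ℝ (W m)]
  [ContMDiffVectorBundle ∞ F W 𝓘(ℝ, E)]

namespace Realization

variable {ρ : Realization F V W} {m₀ : M} {r : ℕ∞}

/-- The restriction of `bumpEndo W f K` to `V`. -/
def bumpEndo (ρ : Realization F V W) (f : SmoothBumpFunction 𝓘(ℝ, E) m₀) (K : F →L[ℝ] F) (y : X) :
    V y →ₗ[ℝ] V y :=
  f (ρ.ι y) • (ρ.frame m₀ y ∘ₗ K.toLinearMap ∘ₗ ρ.coord m₀ y)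

theorem bumpEndo_apply (f : SmoothBumpFunction 𝓘(ℝ, E) m₀) (K : F →L[ℝ] F) (y : X) (u : V y) :
    ρ.bumpEndo f K y u = (ρ.Φ y).symm (CocycleStability.bumpEndo W f K (ρ.ι y) (ρ.Φ y u)) := by
  simp [bumpEndo, CocycleStability.bumpEndo, frame, coord]

theorem bumpEndo_eq_zero {f : SmoothBumpFunction 𝓘(ℝ, E) m₀} {y : X} (h : f (ρ.ι y) = 0)
    (K : F →L[ℝ] F) (u : V y) : ρ.bumpEndo f K y u = 0 := by
  simp [bumpEndo, h]

theorem continuous_bumpEndo (f : SmoothBumpFunction 𝓘(ℝ, E) m₀)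
    (hf : tsupport f ⊆ (trivializationAt F W m₀).baseSet) (K : F →L[ℝ] F) :
    Continuous fun z : TotalSpace F V =>
      (⟨z.proj, ρ.bumpEndo f K z.proj z.snd⟩ : TotalSpace F V) := by
  refine continuous_iff_continuousAt.2 fun z₀ => ?_
  have hproj := (FiberBundle.continuous_proj F V).continuousAt (x := z₀)
  by_cases hz : ρ.ι z₀.proj ∈ tsupport f
  · have h1 : ContinuousAt (fun z : TotalSpace F V =>
        (z.proj, f (ρ.ι z.proj) • K (ρ.coord m₀ z.proj z.snd))) z₀ :=
      hproj.prodMk (((f.continuous.comp ρ.isEmbedding.continuous).continuousAt.comp hproj).smul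
        (K.continuous.continuousAt.comp (continuousAt_coord (hf hz))))
    refine (ContinuousAt.comp (x := z₀) (continuousAt_frame (hf hz) _) h1).congr
      (Eventually.of_forall fun z => ?_)
    exact congrArg (TotalSpace.mk (F := F) z.proj) (map_smul _ _ _)
  · refine continuousAt_mk_iff.2 ⟨hproj, ?_⟩
    refine (continuousAt_const (y := (0 : F))).congr ?_
    filter_upwards [(ρ.isEmbedding.continuous.continuousAt.comp hproj).eventually
      (notMem_tsupport_iff_eventuallyEq.1 hz)] with z hz'
    rw [bumpEndo_eq_zero hz', map_zero]

/-- A fixed vector of minus the bump endomorphism vanishes: in the chart the latter is a contraction,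
as `f` takes values in `[0, 1]`. -/
theorem injective_add_bumpEndo (f : SmoothBumpFunction 𝓘(ℝ, E) m₀)
    (hf : tsupport f ⊆ (trivializationAt F W m₀).baseSet) {K : F →L[ℝ] F} (hK : ‖K‖ < 1)
    (y : X) (u : V y) (h : u + ρ.bumpEndo f K y u = 0) : u = 0 := by
  by_cases hy : ρ.ι y ∈ (trivializationAt F W m₀).baseSet
  · have h1 : ρ.coord m₀ y u + f (ρ.ι y) • K (ρ.coord m₀ y u) = 0 := by
      have := congrArg (ρ.coord m₀ y) h
      rw [map_add, map_zero, bumpEndo, LinearMap.smul_apply, map_smul, LinearMap.comp_apply,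
        coord_frame hy] at this
      exact this
    set w := ρ.coord m₀ y u with hw
    have h2 : ‖w‖ ≤ ‖K‖ * ‖w‖ := by
      calc ‖w‖ = ‖f (ρ.ι y) • K w‖ := by
            rw [eq_neg_of_add_eq_zero_right h1, norm_neg]
        _ = f (ρ.ι y) * ‖K w‖ := by rw [norm_smul, Real.norm_of_nonneg f.nonneg]
        _ ≤ 1 * (‖K‖ * ‖w‖) :=
          mul_le_mul f.le_one (K.le_opNorm w) (norm_nonneg _) zero_le_one
        _ = _ := one_mul _
    have h3 : w = 0 := by
      by_contra hne
      have : 0 < ‖w‖ := norm_pos_iff.2 hne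
      nlinarith
    rw [← frame_coord hy u, ← hw, h3, map_zero]
  · have h0 : f (ρ.ι y) = 0 := by
      by_contra hne
      exact hy (hf (subset_tsupport _ hne))
    rwa [bumpEndo_eq_zero h0, add_zero] at h

/-- A perturbation of the identity of the fiber above `x`, extended to a bundle endomorphism which
vanishes above `O` and is the restriction of a smooth section of `End W`. -/
theorem eventually_exists_extension {N : Set (∀ m, W m →L[ℝ] W m)} {S : ∀ m, W m →L[ℝ] W m}
    (hS : IsCrSection F E r S)
    (hSN : ∀ Λ : (F →L[ℝ] F) →ₗ[ℝ] (∀ m, W m →L[ℝ] W m),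
      (∀ K, IsCrSection F E r (Λ K)) → ∀ᶠ K in 𝓝 0, S + Λ K ∈ N)
    {x : X} {O : Finset X} (hx : x ∉ O) :
    ∀ᶠ R in 𝓝 (ContinuousLinearMap.id ℝ (V x)), ∃ G : ∀ y, V y →ₗ[ℝ] V y,
      (Continuous fun z : TotalSpace F V => (⟨z.proj, G z.proj z.snd⟩ : TotalSpace F V)) ∧
      (∀ y u, u + G y u = 0 → u = 0) ∧ (∀ u, u + G x u = R u) ∧ (∀ y ∈ O, ∀ u, G y u = 0) ∧
      ∃ S' ∈ N, ∀ y u, (ρ.Φ y).symm (S' (ρ.ι y) (ρ.Φ y u)) =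
        (ρ.Φ y).symm (S (ρ.ι y) (ρ.Φ y (u + G y u))) := by
  have := finite_fiber F V x
  set m₀ := ρ.ι x with hm₀
  have hxm : ρ.ι x ∈ (trivializationAt F W m₀).baseSet := mem_baseSet_trivializationAt F W _
  have hO : (ρ.ι '' (O : Set X))ᶜ ∈ 𝓝 m₀ := by
    refine (O.finite_toSet.image ρ.ι).isClosed.isOpen_compl.mem_nhds ?_
    rintro ⟨y, hy, hyx⟩
    exact hx (ρ.isEmbedding.injective hyx ▸ hy)
  obtain ⟨f, -, hf⟩ := (SmoothBumpFunction.nhds_basis_tsupport (I := 𝓘(ℝ, E)) m₀).mem_iff.1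
    (inter_mem ((trivializationAt F W m₀).open_baseSet.mem_nhds hxm) hO)
  have hfb : tsupport f ⊆ (trivializationAt F W m₀).baseSet := hf.trans Set.inter_subset_left
  let K : (V x →L[ℝ] V x) → (F →L[ℝ] F) := fun R =>
    (LinearMap.toContinuousLinearMap (ρ.coord m₀ x)) ∘L (R - ContinuousLinearMap.id ℝ (V x)) ∘L
      (LinearMap.toContinuousLinearMap (ρ.frame m₀ x))
  have hK : Tendsto K (𝓝 (ContinuousLinearMap.id ℝ (V x))) (𝓝 0) := by
    have h1 : Continuous K :=
      continuous_const.clm_comp ((continuous_id.sub continuous_const).clm_comp continuous_const)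
    have h2 : K (ContinuousLinearMap.id ℝ (V x)) = 0 := by simp [K]
    rw [← h2]
    exact h1.tendsto _
  have hnorm : ∀ᶠ K in 𝓝 (0 : F →L[ℝ] F), ‖K‖ < 1 := by
    filter_upwards [Metric.ball_mem_nhds (0 : F →L[ℝ] F) one_pos] with K hK
    exact mem_ball_zero_iff.1 hK
  filter_upwards [hK.eventually hnorm, hK.eventually (hSN (compBumpEndo f S)
    fun K => hS.compBumpEndo f hfb K)] with R hR1 hRN
  refine ⟨ρ.bumpEndo f (K R), continuous_bumpEndo f hfb _, injective_add_bumpEndo f hfb hR1,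
    fun u => ?_, fun y hy u => bumpEndo_eq_zero ?_ _ u, _, hRN, fun y u => ?_⟩
  · have h1 : ρ.bumpEndo f (K R) x u = R u - u := by
      have h2 : ρ.bumpEndo f (K R) x u = f (ρ.ι x) • ρ.frame m₀ x (ρ.coord m₀ x
        (R (ρ.frame m₀ x (ρ.coord m₀ x u)) - ρ.frame m₀ x (ρ.coord m₀ x u))) := rfl
      rw [h2, frame_coord hxm, frame_coord hxm, f.eq_one, one_smul]
    rw [h1, add_sub_cancel]
  · by_contra hne
    exact (hf (subset_tsupport _ hne)).2 ⟨y, hy, rfl⟩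
  · rw [map_add (ρ.Φ y), bumpEndo_apply, LinearEquiv.apply_symm_apply, map_add (S (ρ.ι y))]
    rfl

end Realization

variable {T : X ≃ₜ X} (A : Cocycle F V T) (ρ : Realization F V W) (r : ℕ∞)

theorem Cocycle.locallyPerturbable_nhdsCrRight : LocallyPerturbable (A.nhdsCrRight E ρ r) := by
  intro U hU
  obtain ⟨N, hN, hU⟩ := (A.mem_nhdsCrRight ρ r).1 hU
  refine (A.mem_nhdsCrRight ρ r).2 ⟨_, (eventually_isCrSection r).and
    (eventually_add_mem_nhdsIdSection hN), fun S hS B hB x O hx => ?_⟩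
  filter_upwards [Realization.eventually_exists_extension (ρ := ρ) hS.1 hS.2 hx] with R
    ⟨G, hG, hinj, hGx, hGO, S', hS', hSS'⟩
  obtain ⟨B', hB'⟩ := B.exists_precomp_add hG hinj
  refine ⟨B', hU S' hS' B' fun y u => ?_, fun u => ?_, fun y hy u => ?_⟩
  · rw [hB', hB, hSS']
  · rw [hB', hGx]
  · rw [hB', hGO y hy, add_zero]

/-- With the perturbation on the left, changing `B` above `x` means changing the section above
`T x`. -/
theorem Cocycle.locallyPerturbable_nhdsCrLeft : LocallyPerturbable (A.nhdsCrLeft E ρ r) := by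
  intro U hU
  obtain ⟨N, hN, hU⟩ := (A.mem_nhdsCrLeft ρ r).1 hU
  refine (A.mem_nhdsCrLeft ρ r).2 ⟨_, (eventually_isCrSection r).and
    (eventually_add_mem_nhdsIdSection hN), fun S hS B hB x O hx => ?_⟩
  have hTx : T x ∉ O.map T.toEquiv.toEmbedding := by simpa using hx
  have hconj : Tendsto (fun R : V x →L[ℝ] V x =>
      (A.fibL x).toContinuousLinearMap ∘L R ∘L (A.fibL x).symm.toContinuousLinearMap)
      (𝓝 (ContinuousLinearMap.id ℝ (V x))) (𝓝 (ContinuousLinearMap.id ℝ (V (T x)))) := by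
    have h1 : Continuous (fun R : V x →L[ℝ] V x =>
      (A.fibL x).toContinuousLinearMap ∘L R ∘L (A.fibL x).symm.toContinuousLinearMap) :=
      continuous_const.clm_comp (continuous_id.clm_comp continuous_const)
    refine (h1.tendsto _).mono_right (le_of_eq (congrArg 𝓝 ?_))
    ext v
    simp
  filter_upwards [hconj.eventually
    (Realization.eventually_exists_extension (ρ := ρ) hS.1 hS.2 hTx)] with R
    ⟨G, hG, hinj, hGx, hGO, S', hS', hSS'⟩
  -- The extension over `T x` is pulled back to the fiber above `x` by means of `A`.
  let H : ∀ y, V y →ₗ[ℝ] V y := fun y =>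
    (A.fib y).symm.toLinearMap ∘ₗ G (T y) ∘ₗ (A.fib y).toLinearMap
  have hH : Continuous fun z : TotalSpace F V => (⟨z.proj, H z.proj z.snd⟩ : TotalSpace F V) := by
    refine (A.homeo.symm.continuous.comp (hG.comp A.continuous_fib)).congr fun z => ?_
    exact A.homeo_symm_mk z.proj (G (T z.proj) (A.fib z.proj z.snd))
  have hAH : ∀ y u, A.fib y (u + H y u) = A.fib y u + G (T y) (A.fib y u) := fun y u => by
    simp [H]
  obtain ⟨B', hB'⟩ := B.exists_precomp_add hH fun y u hu => by
    have h1 := hAH y u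
    rw [hu, map_zero] at h1
    exact (A.fib y).map_eq_zero_iff.1 (hinj _ _ h1.symm)
  refine ⟨B', hU S' hS' B' fun y u => ?_, fun u => ?_, fun y hy u => ?_⟩
  · rw [hB', hB, hSS', hAH]
  · have h1 : u + H x u = R u := by
      apply (A.fib x).injective
      rw [hAH, hGx]
      change A.fib x (R ((A.fib x).symm (A.fib x u))) = _
      rw [LinearEquiv.symm_apply_apply]
    rw [hB', h1]
  · have h1 : H y u = 0 := by
      change (A.fib y).symm (G (T y) (A.fib y u)) = 0
      rw [hGO (T y) (Finset.mem_map.2 ⟨y, hy, rfl⟩), map_zero]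
    rw [hB', h1, add_zero]

end Perturbation

/-! ### The `C^r` topologies are finer than the uniform topology -/

section Comparison

variable {X : Type*} [MetricSpace X] [CompactSpace X]
  {F : Type*} [NormedAddCommGroup F] [NormedSpace ℝ F] [FiniteDimensional ℝ F]
  {V : X → Type*} [TopologicalSpace (TotalSpace F V)]
  [∀ x, NormedAddCommGroup (V x)] [∀ x, InnerProductSpace ℝ (V x)]
  [FiberBundle F V] [VectorBundle ℝ F V] [IsContinuousRiemannianBundle F V]
  {E : Type*} [NormedAddCommGroup E] [NormedSpace ℝ E]
  {M : Type*} [TopologicalSpace M] [ChartedSpace E M]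
  {W : M → Type*} [TopologicalSpace (TotalSpace F W)]
  [∀ m, AddCommGroup (W m)] [∀ m, Module ℝ (W m)] [∀ m, TopologicalSpace (W m)]
  [FiberBundle F W] [VectorBundle ℝ F W]
  [∀ m, IsTopologicalAddGroup (W m)] [∀ m, ContinuousSMul ℝ (W m)]

namespace Realization

variable (ρ : Realization F V W)

theorem eventually_norm_coord_frame_le (x₀ : X) : ∃ c > 0, ∀ᶠ y in 𝓝 x₀,
    (∀ v, ‖ρ.coord (ρ.ι x₀) y v‖ ≤ c * ‖v‖) ∧ ∀ w, ‖ρ.frame (ρ.ι x₀) y w‖ ≤ c * ‖w‖ := by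
  obtain ⟨t, ⟨J⟩⟩ := exists_fiberEmbedding (F := F) (V := V)
  obtain ⟨Cp, hCp, hp⟩ := J.exists_norm_p_le
  obtain ⟨Cj, hCj, hj⟩ := J.exists_norm_j_le
  have hx₀ : ρ.ι x₀ ∈ (trivializationAt F W (ρ.ι x₀)).baseSet := mem_baseSet_trivializationAt F W _
  let P : X → ((t → F) →L[ℝ] F) := fun y =>
    LinearMap.toContinuousLinearMap (ρ.coord (ρ.ι x₀) y ∘ₗ (J.p y).toLinearMap)
  let Q : X → (F →L[ℝ] (t → F)) := fun y =>
    LinearMap.toContinuousLinearMap ((J.j y).toLinearMap ∘ₗ ρ.frame (ρ.ι x₀) y)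
  have hP : ContinuousAt P x₀ := continuousAt_clm_apply.2 fun g =>
    ContinuousAt.comp (f := fun y : X => (⟨y, J.p y g⟩ : TotalSpace F V)) (x := x₀)
      (continuousAt_coord hx₀)
      (J.continuous_p.comp (continuous_id.prodMk continuous_const)).continuousAt
  have hQ : ContinuousAt Q x₀ := continuousAt_clm_apply.2 fun w =>
    J.continuous_j.continuousAt.comp (ContinuousAt.comp (f := fun y : X => (y, w)) (x := x₀)
      (continuousAt_frame hx₀ w) (by fun_prop))
  refine ⟨(‖P x₀‖ + 1) * Cj + Cp * (‖Q x₀‖ + 1), by positivity, ?_⟩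
  filter_upwards [hP.norm.eventually (gt_mem_nhds (lt_add_one ‖P x₀‖)),
    hQ.norm.eventually (gt_mem_nhds (lt_add_one ‖Q x₀‖))] with y hPy hQy
  refine ⟨fun v => ?_, fun w => ?_⟩
  · have h1 : ρ.coord (ρ.ι x₀) y v = P y (J.j y v) := by simp [P, J.p_j]
    calc _ = ‖P y (J.j y v)‖ := by rw [h1]
      _ ≤ (‖P x₀‖ + 1) * (Cj * ‖v‖) := ((P y).le_opNorm _).trans
        (mul_le_mul hPy.le (hj y v) (norm_nonneg _) (by positivity))
      _ = (‖P x₀‖ + 1) * Cj * ‖v‖ := by ring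
      _ ≤ _ := mul_le_mul_of_nonneg_right (le_add_of_nonneg_right (by positivity)) (norm_nonneg v)
  · have h1 : ρ.frame (ρ.ι x₀) y w = J.p y (Q y w) := by simp [Q, J.p_j]
    calc _ = ‖J.p y (Q y w)‖ := by rw [h1]
      _ ≤ Cp * ((‖Q x₀‖ + 1) * ‖w‖) := (hp _ _).trans (mul_le_mul_of_nonneg_left
        (((Q y).le_opNorm _).trans (mul_le_mul_of_nonneg_right hQy.le (norm_nonneg w))) hCp.le)
      _ = Cp * (‖Q x₀‖ + 1) * ‖w‖ := by ring
      _ ≤ _ := mul_le_mul_of_nonneg_right (le_add_of_nonneg_left (by positivity)) (norm_nonneg w)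

/-- The sections which are `C^0`-close to the identity restrict to bundle maps of `V` which are
uniformly close to the identity. -/
theorem eventually_norm_sub_le (r : ℕ∞) {δ : ℝ} (hδ : 0 < δ) :
    ∀ᶠ S in nhdsIdSection F E W r, ∀ y v,
      ‖(ρ.Φ y).symm (S (ρ.ι y) (ρ.Φ y v)) - v‖ ≤ δ * ‖v‖ := by
  have hloc : ∀ x₀ : X, ∃ D ∈ 𝓝 x₀, ∀ᶠ S in nhdsIdSection F E W r, ∀ y ∈ D, ∀ v,
      ‖(ρ.Φ y).symm (S (ρ.ι y) (ρ.Φ y v)) - v‖ ≤ δ * ‖v‖ := fun x₀ => by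
    obtain ⟨c, hc, hcb⟩ := ρ.eventually_norm_coord_frame_le x₀
    set m₀ := ρ.ι x₀ with hm₀
    have hbase : ∀ᶠ y in 𝓝 x₀,
        ρ.ι y ∈ (chartAt E m₀).source ∩ (trivializationAt F W m₀).baseSet :=
      ρ.isEmbedding.continuous.continuousAt (inter_mem (chart_source_mem_nhds E m₀)
        ((trivializationAt F W m₀).open_baseSet.mem_nhds (mem_baseSet_trivializationAt F W m₀)))
    obtain ⟨D, ⟨hD, hDc⟩, hDs⟩ := (compact_basis_nhds x₀).mem_iff.1 (hbase.and hcb)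
    refine ⟨D, hD, ?_⟩
    have hη : 0 < δ / (c * c) := by positivity
    have hgen : ∀ᶠ S in nhdsIdSection F E W r, ∀ m ∈ ρ.ι '' D, ∀ j ≤ 0,
        ‖iteratedFDeriv ℝ j (fun y : E => inTriv F m₀ S ((chartAt E m₀).symm y)
          - ContinuousLinearMap.id ℝ F) (chartAt E m₀ m)‖ < δ / (c * c) :=
      mem_inf_of_right (mem_iInf_of_mem m₀ <| mem_iInf_of_mem (ρ.ι '' D) <| mem_iInf_of_mem 0 <|
        mem_iInf_of_mem (δ / (c * c)) <|
          mem_iInf_of_mem (hDc.image ρ.isEmbedding.continuous) <|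
            mem_iInf_of_mem (Set.image_subset_iff.2 fun y hy => (hDs hy).1) <|
              mem_iInf_of_mem (by simp) <| mem_iInf_of_mem hη (mem_principal_self _))
    filter_upwards [hgen] with S hS y hy v
    obtain ⟨⟨hy1, hy2⟩, hy3, hy4⟩ := hDs hy
    have h1 := hS (ρ.ι y) ⟨y, hy, rfl⟩ 0 le_rfl
    rw [norm_iteratedFDeriv_zero, (chartAt E m₀).left_inv hy1] at h1
    have h2 : ρ.frame m₀ y ((inTriv F m₀ S (ρ.ι y) - ContinuousLinearMap.id ℝ F)
        (ρ.coord m₀ y v)) = (ρ.Φ y).symm (S (ρ.ι y) (ρ.Φ y v)) - v := by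
      rw [sub_apply, map_sub, ContinuousLinearMap.id_apply, frame_coord hy2]
      congr 1
      simp [inTriv, ContinuousLinearMap.inCoordinates, frame, coord,
        -Trivialization.continuousLinearMapAt_apply, -Trivialization.symmL_apply,
        Trivialization.symmL_continuousLinearMapAt _ hy2]
    rw [← h2]
    calc _ ≤ c * (δ / (c * c) * (c * ‖v‖)) :=
          (hy4 _).trans (mul_le_mul_of_nonneg_left ((ContinuousLinearMap.le_opNorm _ _).trans
            (mul_le_mul h1.le (hy3 v) (norm_nonneg _) hη.le)) hc.le)
      _ = δ * ‖v‖ := by field_simp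
  choose D hD hDS using hloc
  obtain ⟨t, -, ht⟩ := (isCompact_univ (X := X)).elim_nhds_subcover D fun x _ => hD x
  filter_upwards [(eventually_all_finset t).2 fun x _ => hDS x] with S hS y v
  obtain ⟨x, hx, hy⟩ := Set.mem_iUnion₂.1 (ht (Set.mem_univ y))
  exact hS x hx y hy v

end Realization

variable {T : X ≃ₜ X} (A : Cocycle F V T) (ρ : Realization F V W) (r : ℕ∞)

theorem Cocycle.nhdsCrRight_le_nhdsC0 : A.nhdsCrRight E ρ r ≤ A.nhdsC0 := by
  intro U hU
  obtain ⟨δ, hδ, hU⟩ := mem_nhdsC0.1 hU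
  obtain ⟨a, ha, hA⟩ := exists_norm_bundleMap_le T.continuous
    (P := fun x => (A.fibL x).toContinuousLinearMap) A.continuous_fib
  refine (A.mem_nhdsCrRight ρ r).2 ⟨_, ρ.eventually_norm_sub_le r (div_pos hδ ha),
    fun S hS B hB => hU B fun x u => ?_⟩
  rw [hB, ← map_sub]
  calc _ ≤ a * (δ / a * ‖u‖) := (hA x _).trans (mul_le_mul_of_nonneg_left (hS x u) ha.le)
    _ = _ := by field_simp

theorem Cocycle.nhdsCrLeft_le_nhdsC0 : A.nhdsCrLeft E ρ r ≤ A.nhdsC0 := by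
  intro U hU
  obtain ⟨δ, hδ, hU⟩ := mem_nhdsC0.1 hU
  obtain ⟨a, ha, hA⟩ := exists_norm_bundleMap_le T.continuous
    (P := fun x => (A.fibL x).toContinuousLinearMap) A.continuous_fib
  refine (A.mem_nhdsCrLeft ρ r).2 ⟨_, ρ.eventually_norm_sub_le r (div_pos hδ ha),
    fun S hS B hB => hU B fun x u => ?_⟩
  rw [hB]
  calc _ ≤ δ / a * (a * ‖u‖) :=
        (hS (T x) _).trans (mul_le_mul_of_nonneg_left (hA x u) (by positivity))
    _ = _ := by field_simp

end Comparison

end CocycleStability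

end

theorem propositionp
    {X : Type*} [MetricSpace X] [CompactSpace X]
    {F : Type*} [NormedAddCommGroup F] [NormedSpace ℝ F] [FiniteDimensional ℝ F]
    {V : X → Type*} [TopologicalSpace (TotalSpace F V)]
    [∀ x, NormedAddCommGroup (V x)] [∀ x, InnerProductSpace ℝ (V x)]
    [FiberBundle F V] [VectorBundle ℝ F V] [IsContinuousRiemannianBundle F V]
    {T : X ≃ₜ X} (A : CocycleStability.Cocycle F V T) :
    A.Implications A.nhdsC0 ∧
    ∀ {E : Type*} [NormedAddCommGroup E] [NormedSpace ℝ E] [FiniteDimensional ℝ E]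
      {M : Type*} [TopologicalSpace M] [T2Space M] [ChartedSpace E M] [IsManifold 𝓘(ℝ, E) ∞ M]
      {W : M → Type*} [TopologicalSpace (TotalSpace F W)]
      [∀ m, AddCommGroup (W m)] [∀ m, Module ℝ (W m)] [∀ m, TopologicalSpace (W m)]
      [∀ m, IsTopologicalAddGroup (W m)] [∀ m, ContinuousSMul ℝ (W m)]
      [FiberBundle F W] [VectorBundle ℝ F W] [ContMDiffVectorBundle ∞ F W 𝓘(ℝ, E)]
      (ρ : CocycleStability.Realization F V W) (r : ℕ∞),
      A.Implications (A.nhdsCrRight E ρ r) ∧ A.Implications (A.nhdsCrLeft E ρ r) := by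
  refine ⟨⟨fun h => h.structurallyStable le_rfl,
    fun h => h.robustlyNoElliptic A.locallyPerturbable_nhdsC0⟩,
    fun ρ r => ⟨⟨fun h => h.structurallyStable (A.nhdsCrRight_le_nhdsC0 ρ r),
      fun h => h.robustlyNoElliptic (A.locallyPerturbable_nhdsCrRight ρ r)⟩,
      ⟨fun h => h.structurallyStable (A.nhdsCrLeft_le_nhdsC0 ρ r),
      fun h => h.robustlyNoElliptic (A.locallyPerturbable_nhdsCrLeft ρ r)⟩⟩⟩
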